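/- Let $k$ be a field. For a category $\mathcal C$ let $\mathrm{Ind}(\mathcal C)$ be the full subcategory of the category $\mathcal C^\vee$ of contravariant functors $\mathcal C\to\mathbf{Set}$ consisting of the functors isomorphic to some $\text{“}\varinjlim\text{”}_{i\in I}C_i : Y\mapsto\varinjlim_{i\in I}\mathrm{Hom}_{\mathcal C}(Y,C_i)$, where $I$ is a small filtrant category and $(C_i)_{i\in I}$ an inductive system in $\mathcal C$. **(A)** Let $X$ be a locally compact Hausdorff space which is countable at infinity, and let $\mathcal A$ be a sheaf of commutative unital $k$-algebras on $X$. For $U\subseteq X$ open, let $\mathrm{Mod}(\mathcal A|_U)$ be the category of sheaves of $\mathcal A|_U$-modules on $U$, let $\mathrm{Mod}_c(\mathcal A|_U)$ be the full subcategory of sheaves with compact support, and set $I(\mathcal A|_U)=\mathrm{Ind}(\mathrm{Mod}_c(\mathcal A|_U))$. For an inclusion $j:V\hookrightarrow U$ of open sets, let $j_!$ be the extension by zero; it maps $\mathrm{Mod}_c(\mathcal A|_V)$ to $\mathrm{Mod}_c(\mathcal A|_U)$. The restriction functor $I(\mathcal A|_U)\to I(\mathcal A|_V)$ is $F\mapsto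 F|_V:=F\circ j_!$. Then: 1. If $F\simeq\text{“}\varinjlim\text{”}_i F_i$ in $I(\mathcal A|_U)$, with $I$ small filtrant and $F_i\in\mathrm{Mod}_c(\mathcal A|_U)$, then $$F|_V\simeq \underset{i,\;W\subset\subset V}{\text{“}\varinjlim\text{”}}\,\bigl((F_i)_W\big|_V\bigr),$$ where $W$ runs through the open subsets of $V$ with compact closure in $V$, and $(F_i)_W$ denotes the sheaf which is $F_i$ on $W$ and $0$ outside $W$. 2. For every open set $U\subseteq X$ (for instance $U=X$) and all $F,G\in I(\mathcal A|_U)$, the presheaf $V\mapsto\mathrm{Hom}_{I(\mathcal A|_V)}(F|_V,G|_V)$ on $U$ is a sheaf. 3. $U\mapsto I(\mathcal A|_U)$ is a stack on $X$: morphisms glue as in (2), and every descent datum of objects along an open covering of an open subset of $X$ is effective. **(B)** In contrast, $U\mapsto\mathrm{Ind}(\mathrm{Mod}(\mathcal A|_U))$, with restriction $F\mapsto F\circ j_!$, i.e. $\text{“}\varinjlim\text{”}_iF_i\mapsto\text{“}\varinjlim\text{”}_i F_i|_V$, is not a stack in general: it is not one for $X=\mathbb R$ and $\mathcal A=k_X$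 the constant sheaf, for any field $k$. -/

import Mathlib

open CategoryTheory Opposite TopologicalSpace Limits

universe u v v' u'

noncomputable section

namespace KSInd

section Sections

variable {Y : TopCat.{u}} {R : Sheaf (Opens.grothendieckTopology Y) RingCat.{u}}

abbrev Mod (R : Sheaf (Opens.grothendieckTopology Y) RingCat.{u}) := SheafOfModules.{u} R

/-- The restriction map `M(W') → M(W)` of a sheaf of modules, for open sets `W ⊆ W'`. -/
def res (M : Mod R) {W W' : Opens Y} (h : W ≤ W') (s : M.val.obj (op W')) : M.val.obj (op W) :=
  M.val.restrictₛₗ (homOfLE h).op s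

variable (M : Mod R)

lemma res_add {W W' : Opens Y} (h : W ≤ W') (s t : M.val.obj (op W')) :
    res M h (s + t) = res M h s + res M h t := map_add (M.val.restrictₛₗ (homOfLE h).op) s t

lemma res_zero {W W' : Opens Y} (h : W ≤ W') :
    res M h 0 = 0 := map_zero (M.val.restrictₛₗ (homOfLE h).op)

lemma res_smul {W W' : Opens Y} (h : W ≤ W') (a : R.obj.obj (op W')) (s : M.val.obj (op W')) :
    res M h (a • s) = (R.obj.map (homOfLE h).op a) • res M h s :=
  map_smulₛₗ (M.val.restrictₛₗ (homOfLE h).op) a s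

lemma res_res {W W' W'' : Opens Y} (h : W ≤ W') (h' : W' ≤ W'') (s : M.val.obj (op W'')) :
    res M h (res M h' s) = res M (h.trans h') s :=
  (PresheafOfModules.map_comp_apply M.val (homOfLE h').op (homOfLE h).op s).symm

lemma res_self {W : Opens Y} (h : W ≤ W) (s : M.val.obj (op W)) :
    res M h s = s := by
  have := congr($(M.val.presheaf.map_id (op W)) s)
  exact this

lemma app_res {M N : Mod R} (f : M ⟶ N) {W W' : Opens Y} (h : W ≤ W') (s : M.val.obj (op W')) :
    f.val.app (op W) (res M h s) = res N h (f.val.app (op W') s) :=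
  PresheafOfModules.naturality_apply f.val (homOfLE h).op s

/-- Sections of a sheaf of modules which agree locally are equal. -/
lemma sec_ext {W : Opens Y} (s t : M.val.obj (op W))
    (h : ∀ x ∈ W, ∃ (W' : Opens Y) (hW : W' ≤ W), x ∈ W' ∧ res M hW s = res M hW t) : s = t := by
  choose V hV hxV e using fun x : W ↦ h x.1 x.2
  exact TopCat.Sheaf.eq_of_locally_eq' ⟨M.val.presheaf, M.isSheaf⟩ V W (fun i ↦ homOfLE (hV i))
    (fun x hx ↦ Opens.mem_iSup.2 ⟨⟨x, hx⟩, hxV ⟨x, hx⟩⟩) s t e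

/-- Compatible sections of a sheaf of modules can be glued. -/
lemma sec_glue {ι : Type u} (V : ι → Opens Y) (W : Opens Y) (hV : ∀ i, V i ≤ W)
    (hW : ∀ x ∈ W, ∃ i, x ∈ V i) (s : ∀ i, M.val.obj (op (V i)))
    (hs : ∀ i j, res M inf_le_left (s i) =
      res M (W' := V j) (W := V i ⊓ V j) inf_le_right (s j)) :
    ∃ t : M.val.obj (op W), ∀ i, res M (hV i) t = s i := by
  have hc : TopCat.Presheaf.IsCompatible M.val.presheaf V s := hs
  exact (TopCat.Sheaf.existsUnique_gluing' ⟨M.val.presheaf, M.isSheaf⟩ V W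
    (fun i ↦ homOfLE (hV i)) (fun x hx ↦ Opens.mem_iSup.2 (hW x hx)) _ hc).exists

/-- The support of a sheaf of modules: the complement of the union of the open sets `W` such
that `M|_W = 0`. -/
def supp : Set Y :=
  (⋃ W ∈ {W : Opens Y | ∀ W' ≤ W, Subsingleton (M.val.obj (op W'))}, (W : Set Y))ᶜ

/-- Sheaves of modules with compact support. -/
def HasCompactSupport : ObjectProperty (Mod R) := fun M ↦ IsCompact (supp M)

/-- The germ of the section `s` at `x` is zero. -/
def VanishesAt {W : Opens Y} (s : M.val.obj (op W)) (x : Y) : Prop :=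
  ∃ (W' : Opens Y) (h : W' ≤ W), x ∈ W' ∧ res M h s = 0

variable {M}

lemma VanishesAt.res {W W' : Opens Y} (h : W ≤ W') {s : M.val.obj (op W')} {x : Y} (hx : x ∈ W)
    (hs : VanishesAt M s x) : VanishesAt M (res M h s) x := by
  obtain ⟨V, hV, hxV, e⟩ := hs
  refine ⟨V ⊓ W, inf_le_right, ⟨hxV, hx⟩, ?_⟩
  rw [res_res, ← res_res M inf_le_left hV, e, res_zero]

lemma VanishesAt.of_res {W W' : Opens Y} (h : W ≤ W') {s : M.val.obj (op W')} {x : Y}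
    (hs : VanishesAt M (KSInd.res M h s) x) : VanishesAt M s x := by
  obtain ⟨V, hV, hxV, e⟩ := hs
  exact ⟨V, hV.trans h, hxV, by rw [← e, res_res]⟩

lemma VanishesAt.map {N : Mod R} (f : M ⟶ N) {W : Opens Y} {s : M.val.obj (op W)} {x : Y}
    (hs : VanishesAt M s x) : VanishesAt N (f.val.app (op W) s) x := by
  obtain ⟨V, hV, hxV, e⟩ := hs
  exact ⟨V, hV, hxV, by rw [← app_res, e, map_zero]⟩

variable (M)

/-- The sections of `M` whose germs vanish outside `S`. -/
def cutSub (S : Opens Y) : M.val.Submodule where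
  obj W :=
    { carrier := {s | ∀ x ∈ W.unop, x ∉ S → VanishesAt M (W := W.unop) s x}
      add_mem' := by
        intro a b ha hb x hx hxS
        obtain ⟨V, hV, hxV, e⟩ := ha x hx hxS
        obtain ⟨V', hV', hxV', e'⟩ := hb x hx hxS
        refine ⟨V ⊓ V', inf_le_left.trans hV, ⟨hxV, hxV'⟩, ?_⟩
        rw [res_add, ← res_res M inf_le_left hV, e, res_zero, ← res_res M inf_le_right hV', e',
          res_zero, add_zero]
      zero_mem' := fun x hx _ ↦ ⟨W.unop, le_rfl, hx, res_zero M _⟩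
      smul_mem' := by
        intro c a ha x hx hxS
        obtain ⟨V, hV, hxV, e⟩ := ha x hx hxS
        exact ⟨V, hV, hxV, by rw [res_smul, e, smul_zero]⟩ }
  map {W W'} f s hs x hx hxS := (hs x (leOfHom f.unop hx) hxS).res (leOfHom f.unop) hx

/-- For an open set `S` of `Y`, the sheaf `M_S`: it is the subsheaf of `M` consisting of the
sections whose germs vanish outside `S`, so that it is `0` on `Y ∖ S` and `M|_S` on `S`. -/
def cut (S : Opens Y) : Mod R where
  val := (cutSub M S).toPresheafOfModules
  isSheaf := by
    refine (TopCat.Presheaf.isSheaf_iff_isSheafUniqueGluing (X := Y)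
      (F := (cutSub M S).toPresheafOfModules.presheaf)).2 ?_
    intro ι V s hs
    have hs' (i j) : res M inf_le_left (s i).1 =
      res M (W' := V j) (W := V i ⊓ V j) inf_le_right (s j).1 := congr($(hs i j).1)
    obtain ⟨t, ht⟩ := sec_glue M V (iSup V) (le_iSup V) (fun x hx ↦ Opens.mem_iSup.1 hx)
      (fun i ↦ (s i).1) hs'
    refine ⟨⟨t, ?_⟩, ?_, ?_⟩
    · intro x hx hxS
      obtain ⟨i, hi⟩ := Opens.mem_iSup.1 hx
      refine VanishesAt.of_res (le_iSup V i) ?_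
      rw [ht i]
      exact (s i).2 x hi hxS
    · intro i
      exact Subtype.ext (ht i)
    · intro t' ht'
      refine Subtype.ext (sec_ext M _ _ fun x hx ↦ ?_)
      obtain ⟨i, hi⟩ := Opens.mem_iSup.1 hx
      refine ⟨V i, le_iSup V i, hi, (congr($(ht' i).1) : _).trans (ht i).symm⟩

/-- The inclusion `M_S → M`. -/
def cutι (S : Opens Y) : cut M S ⟶ M := ⟨(cutSub M S).ι⟩

variable {M}

/-- The morphism `M_S → N_S` induced by a morphism `M → N`. -/
def cutMap (S : Opens Y) {N : Mod R} (f : M ⟶ N) : cut M S ⟶ cut N S where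
  val :=
    { app W := ModuleCat.ofHom ((f.val.app W).hom.restrict
        (p := (cutSub M S).obj W) (q := (cutSub N S).obj W)
        (fun s hs x hx hxS ↦ (hs x hx hxS).map f))
      naturality {W W'} g := by
        ext s
        exact Subtype.ext (PresheafOfModules.naturality_apply f.val g s.1) }

lemma cutMap_apply (S : Opens Y) {N : Mod R} (f : M ⟶ N) (W : Opens Y)
    (s : (cut M S).val.obj (op W)) :
    ((cutMap S f).val.app (op W) s).1 = f.val.app (op W) s.1 := rfl

lemma res_cut_val (S : Opens Y) {W W' : Opens Y} (h : W ≤ W') (s : (cut M S).val.obj (op W')) :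
    (res (cut M S) h s).1 = res M h s.1 := rfl

lemma hom_ext {N : Mod R} {f g : M ⟶ N}
    (h : ∀ (W : Opens Y) (s : M.val.obj (op W)), f.val.app (op W) s = g.val.app (op W) s) :
    f = g := by
  ext W s
  exact h W.unop s

end Sections

section Zero

variable {X : TopCat.{u}} (R : Sheaf (Opens.grothendieckTopology X) RingCat.{u})

/-- The open subset `U` of `X`, as a topological space. -/
abbrev sp (U : Opens X) : TopCat.{u} := (Opens.toTopCat X).obj U

/-- The restriction `R|_U` of a sheaf of rings. -/
def ringOn (U : Opens X) : Sheaf (Opens.grothendieckTopology (sp U)) RingCat.{u} :=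
  U.sheafRestrict.obj R

/-- The open embedding `V → U` for open sets `V ⊆ U` of `X`. -/
abbrev incl {V U : Opens X} (h : V ⟶ U) : sp V ⟶ sp U := (Opens.toTopCat X).map h

/-- The morphism of sheaves of rings `R|_U → j_* (R|_V)`, where `j` is the inclusion `V → U`. -/
def ringToDirect {V U : Opens X} (h : V ⟶ U) :
    ringOn R U ⟶ ((Opens.map (incl h)).sheafPushforwardContinuous RingCat.{u}
      (Opens.grothendieckTopology (sp U)) (Opens.grothendieckTopology (sp V))).obj
        (ringOn R V) where
  hom :=
    { app W := R.obj.map (homOfLE (by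
        rintro _ ⟨y, hy, rfl⟩
        exact ⟨incl h y, hy, rfl⟩)).op
      naturality {W W'} f := by
        refine (R.obj.map_comp _ _).symm.trans (Eq.trans ?_ (R.obj.map_comp _ _))
        rfl }

/-- The direct image functor `j_*` for the inclusion `j : V → U`. -/
def direct {V U : Opens X} (h : V ⟶ U) : Mod (ringOn R V) ⥤ Mod (ringOn R U) :=
  SheafOfModules.pushforward (ringToDirect R h)

/-- The open set `V`, as an open subset of `U`. -/
def sub {V U : Opens X} (_ : V ⟶ U) : Opens (sp U) := (Opens.map (Opens.inclusion' U)).obj V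

/-- The extension by zero functor `j_!` for the inclusion `j : V → U`: the sections of
`j_! M` are the sections of `j_* M` whose germs vanish outside `V`. -/
def extZero {V U : Opens X} (h : V ⟶ U) : Mod (ringOn R V) ⥤ Mod (ringOn R U) where
  obj M := cut ((direct R h).obj M) (sub h)
  map f := cutMap (sub h) ((direct R h).map f)

variable {R}

lemma res_direct {V U : Opens X} (h : V ⟶ U) (M : Mod (ringOn R V)) {W W' : Opens (sp U)}
    (hW : W ≤ W') (s : ((direct R h).obj M).val.obj (op W')) :
    res ((direct R h).obj M) hW s = res M (W := (Opens.map (incl h)).obj W)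
      (W' := (Opens.map (incl h)).obj W') (fun _ hx ↦ hW hx) s := rfl

/-- The restriction map `R(W) → R(V ∩ W)`, for an open subset `W` of `U`. -/
def ringRes {V U : Opens X} (h : V ⟶ U) {W : Opens (sp U)} (a : (ringOn R U).obj.obj (op W)) :
    (ringOn R V).obj.obj (op ((Opens.map (incl h)).obj W)) :=
  (ringToDirect R h).hom.app (op W) a

lemma ringRes_id {U : Opens X} {W : Opens (sp U)} (a : (ringOn R U).obj.obj (op W)) :
    ringRes (𝟙 U) a = a :=
  congr($(R.obj.map_id _) a)

lemma ringRes_comp {U V W : Opens X} (f : U ⟶ V) (g : V ⟶ W) {S : Opens (sp W)}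
    (a : (ringOn R W).obj.obj (op S)) : ringRes (f ≫ g) a = ringRes f (ringRes g a) :=
  congr($(R.obj.map_comp _ _) a)

/-- A section of `j_! M` over `W`, as a section of `M` over `V ∩ W`. -/
def sec {V U : Opens X} (h : V ⟶ U) (M : Mod (ringOn R V)) {W : Opens (sp U)}
    (s : ((extZero R h).obj M).val.obj (op W)) : M.val.obj (op ((Opens.map (incl h)).obj W)) :=
  s.1

section

variable {V U : Opens X} (h : V ⟶ U) (M : Mod (ringOn R V)) {W : Opens (sp U)}

lemma sec_injective {s t : ((extZero R h).obj M).val.obj (op W)} (e : sec h M s = sec h M t) : s = t :=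
  Subtype.ext e

lemma sec_smul (a : (ringOn R U).obj.obj (op W)) (s : ((extZero R h).obj M).val.obj (op W)) :
    sec h M (a • s) = ringRes h a • sec h M s := rfl

lemma sec_add (s t : ((extZero R h).obj M).val.obj (op W)) : sec h M (s + t) = sec h M s + sec h M t := rfl

lemma sec_zero : sec h M (0 : ((extZero R h).obj M).val.obj (op W)) = 0 := rfl

lemma sec_res {W' : Opens (sp U)} (hW : W ≤ W') (s : ((extZero R h).obj M).val.obj (op W')) :
    sec h M (res _ hW s) = res M (fun _ hx ↦ hW hx) (sec h M s) := rfl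

/-- The condition for a section of `M` over `V ∩ W` to be a section of `j_! M` over `W`. -/
def IsExt (s : M.val.obj (op ((Opens.map (incl h)).obj W))) : Prop :=
  ∀ x ∈ W, x.1 ∉ V → ∃ (W' : Opens (sp U)) (hW : W' ≤ W), x ∈ W' ∧
    res M (W := (Opens.map (incl h)).obj W') (fun _ hx ↦ hW hx) s = 0

lemma isExt_sec (s : ((extZero R h).obj M).val.obj (op W)) : IsExt h M (sec h M s) := s.2

def mkSec (s : M.val.obj (op ((Opens.map (incl h)).obj W))) (hs : IsExt h M s) :
    ((extZero R h).obj M).val.obj (op W) := ⟨s, hs⟩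

lemma sec_mkSec (s : M.val.obj (op ((Opens.map (incl h)).obj W))) (hs : IsExt h M s) :
    sec h M (mkSec h M s hs) = s := rfl

lemma mkSec_sec (s : ((extZero R h).obj M).val.obj (op W)) : mkSec h M (sec h M s) s.2 = s := rfl

lemma sec_map {N : Mod (ringOn R V)} (f : M ⟶ N) (s : ((extZero R h).obj M).val.obj (op W)) :
    sec h N (((extZero R h).map f).val.app (op W) s) = f.val.app _ (sec h M s) := rfl

end

/-- Constructor for isomorphisms of sheaves of modules. -/
def isoMk {Y : TopCat.{u}} {R : Sheaf (Opens.grothendieckTopology Y) RingCat.{u}} {M N : Mod R}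
    (e : ∀ W : Opens Y, M.val.obj (op W) ≃ₗ[R.obj.obj (op W)] N.val.obj (op W))
    (he : ∀ (W W' : Opens Y) (h : W ≤ W') (s : M.val.obj (op W')),
      e W (res M h s) = res N h (e W' s)) : M ≅ N :=
  (SheafOfModules.fullyFaithfulForget _).preimageIso
    (PresheafOfModules.isoMk (fun W ↦ (e W.unop).toModuleIso) (by
      intro W W' f
      ext s
      exact he _ _ (leOfHom f.unop) s))

/-- The isomorphism `j_! M ≅ M` for `j = id`. -/
def extZeroIdApp (U : Opens X) (M : Mod (ringOn R U)) :
    (extZero R (𝟙 U)).obj M ≅ M :=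
  isoMk (fun W ↦
      { toFun s := sec (𝟙 U) M s
        invFun s := mkSec (𝟙 U) M s (fun x _ hx ↦ (hx x.2).elim)
        map_add' _ _ := rfl
        map_smul' a s := by
          rw [sec_smul, ringRes_id]
          rfl
        left_inv _ := rfl
        right_inv _ := rfl })
      (fun _ _ _ _ ↦ rfl)

lemma isOpenEmbedding_incl {V U : Opens X} (h : V ⟶ U) : Topology.IsOpenEmbedding (incl h) :=
  Opens.isOpenEmbedding_of_le (leOfHom h)

lemma isOpenMap_incl {V U : Opens X} (h : V ⟶ U) : IsOpenMap (incl h) :=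
  (isOpenEmbedding_incl h).isOpenMap

lemma isExt_comp {U V W : Opens X} (f : U ⟶ V) (g : V ⟶ W) (M : Mod (ringOn R U))
    {S : Opens (sp W)} (s : ((extZero R g).obj ((extZero R f).obj M)).val.obj (op S)) :
    IsExt (W := S) (f ≫ g) M (sec f M (sec g _ s)) := by
  intro x hx hxU
  by_cases hxV : x.1 ∈ V
  · obtain ⟨T, hT, hxT, e⟩ := isExt_sec f M (sec g _ s) ⟨x.1, hxV⟩ hx hxU
    have hle : (Opens.map (incl g)).obj ((isOpenMap_incl g).functor.obj T) ≤ T := by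
      rintro y ⟨z, hz, e⟩
      have : z = y := Subtype.ext congr(($e).1)
      exact this ▸ hz
    have hle' : (isOpenMap_incl g).functor.obj T ≤ S := by
      rintro _ ⟨y, hy, rfl⟩
      exact hT hy
    refine ⟨(isOpenMap_incl g).functor.obj T, hle', ⟨_, hxT, rfl⟩, ?_⟩
    refine (res_res M (W := (Opens.map (incl f)).obj ((Opens.map (incl g)).obj
      ((isOpenMap_incl g).functor.obj T))) (W' := (Opens.map (incl f)).obj T) (fun y hy ↦ hle hy)
      (fun y hy ↦ hT hy) _).symm.trans ?_
    exact (congrArg (res M (fun y hy ↦ hle hy)) e).trans (res_zero M _)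
  · obtain ⟨T, hT, hxT, e⟩ := isExt_sec g _ s x hx hxV
    exact ⟨T, hT, hxT, congr(sec f M $e)⟩

lemma isExt_comp_left {U V W : Opens X} (f : U ⟶ V) (g : V ⟶ W) (M : Mod (ringOn R U))
    {S : Opens (sp W)} (s : ((extZero R (f ≫ g)).obj M).val.obj (op S)) :
    IsExt (W := (Opens.map (incl g)).obj S) f M (sec (f ≫ g) M s) := by
  intro x hx hxU
  obtain ⟨T, hT, hxT, e⟩ := isExt_sec _ M s (incl g x) hx hxU
  exact ⟨(Opens.map (incl g)).obj T, fun y hy ↦ hT hy, hxT, e⟩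

/-- The isomorphism `(j ∘ i)_! M ≅ j_! i_! M`. -/
def extZeroCompApp {U V W : Opens X} (f : U ⟶ V) (g : V ⟶ W) (M : Mod (ringOn R U)) :
    (extZero R (f ≫ g)).obj M ≅ (extZero R g).obj ((extZero R f).obj M) :=
  isoMk (fun S ↦
      { toFun s := mkSec g _ (mkSec f M (sec (f ≫ g) M s) (isExt_comp_left f g M s)) (by
          intro x hx hxV
          obtain ⟨T, hT, hxT, e⟩ := isExt_sec _ M s x hx (fun hxU ↦ hxV (f.le hxU))
          exact ⟨T, hT, hxT, sec_injective _ _ e⟩)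
        invFun s := mkSec (f ≫ g) M (sec f M (sec g _ s)) (isExt_comp f g M s)
        map_add' _ _ := rfl
        map_smul' a s := by
          refine sec_injective _ _ (sec_injective _ _ ?_)
          refine (sec_smul _ M a s).trans ?_
          rw [ringRes_comp]
          rfl
        left_inv _ := rfl
        right_inv _ := rfl })
      (fun _ _ _ _ ↦ rfl)

variable (R)

/-- `j_! ≅ 𝟭` for `j = id`. -/
def extZeroId (U : Opens X) : extZero R (𝟙 U) ≅ 𝟭 _ :=
  NatIso.ofComponents (extZeroIdApp U) (fun _ ↦ rfl)

/-- `(j ∘ i)_! ≅ j_! ∘ i_!`. -/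
def extZeroComp {U V W : Opens X} (f : U ⟶ V) (g : V ⟶ W) :
    extZero R (f ≫ g) ≅ extZero R f ⋙ extZero R g :=
  NatIso.ofComponents (extZeroCompApp f g) (fun _ ↦ rfl)

/-- The covariant pseudofunctor `U ↦ Mod(R|_U)`, with the functors `j_!`. -/
def extZeroPseudofunctor : Pseudofunctor (LocallyDiscrete (Opens X)) Cat.{u, u + 1} :=
  LocallyDiscrete.mkPseudofunctor
    (fun U ↦ Cat.of (Mod (ringOn R U)))
    (fun h ↦ (extZero R h).toCatHom)
    (fun U ↦ Cat.Hom.isoMk (extZeroId R U))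
    (fun f g ↦ Cat.Hom.isoMk (extZeroComp R f g))
    (by
      intro b₀ b₁ b₂ b₃ f g h
      ext M
      exact hom_ext fun W s ↦ rfl)
    (by
      intro b₀ b₁ f
      ext M
      exact hom_ext fun W s ↦ rfl)
    (by
      intro b₀ b₁ f
      ext M
      exact hom_ext fun W s ↦ rfl)

end Zero

section Psh

variable {C : Type u} [Category.{v} C] (E : Pseudofunctor (LocallyDiscrete C) Cat.{v', u'})

/-- Restriction of presheaves on `E(U)` along `E(V) → E(U)`. -/
abbrev pshMap {U V : Cᵒᵖ} (f : U ⟶ V) :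
    ((E.obj ⟨U.unop⟩ : Type _)ᵒᵖ ⥤ Type v') ⥤ ((E.obj ⟨V.unop⟩ : Type _)ᵒᵖ ⥤ Type v') :=
  (Functor.whiskeringLeft _ _ _).obj (E.map f.unop.toLoc).toFunctor.op

def pshId (U : Cᵒᵖ) : pshMap E (𝟙 U) ≅ 𝟭 _ :=
  (Functor.whiskeringLeft _ _ (Type v')).mapIso
    (NatIso.op (Cat.Hom.toNatIso (E.mapId ⟨U.unop⟩))).symm

def pshComp {U V W : Cᵒᵖ} (f : U ⟶ V) (g : V ⟶ W) :
    pshMap E (f ≫ g) ≅ pshMap E f ⋙ pshMap E g :=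
  (Functor.whiskeringLeft _ _ (Type v')).mapIso
    (NatIso.op (Cat.Hom.toNatIso (E.mapComp g.unop.toLoc f.unop.toLoc))).symm

lemma eqToHom_pshMap {U V : Cᵒᵖ} {f f' : U ⟶ V} (e : f = f')
    (F : (E.obj ⟨U.unop⟩ : Type _)ᵒᵖ ⥤ Type v') (H : (E.obj ⟨V.unop⟩ : Type _)ᵒᵖ)
    (η : f'.unop.toLoc ⟶ f.unop.toLoc) (p : (pshMap E f).toCatHom = (pshMap E f').toCatHom) :
    NatTrans.app ((eqToHom p).toNatTrans.app F : (pshMap E f).obj F ⟶ (pshMap E f').obj F) H =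
      F.map ((E.map₂ η).toNatTrans.app H.unop).op := by
  subst e
  obtain rfl : η = 𝟙 _ := Subsingleton.elim _ _
  rw [E.map₂_id]
  exact (F.map_id _).symm


lemma map_op_comp₄ {D : Type u'} [Category.{v'} D] (F : Dᵒᵖ ⥤ Type v') {a b c d e : D}
    (x₁ : a ⟶ b) (x₂ : b ⟶ c) (x₄ : c ⟶ d) (x₅ : d ⟶ e) :
    F.map x₅.op ≫ F.map x₄.op ≫ 𝟙 _ ≫ F.map x₂.op ≫ F.map x₁.op =
      F.map (x₁ ≫ x₂ ≫ 𝟙 _ ≫ x₄ ≫ x₅).op := by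
  simp

lemma map_op_comp₂ {D : Type u'} [Category.{v'} D] (F : Dᵒᵖ ⥤ Type v') {a b c : D}
    (x₁ : a ⟶ b) (x₂ : b ⟶ c) :
    F.map x₂.op ≫ F.map x₁.op ≫ 𝟙 _ = F.map (𝟙 _ ≫ x₁ ≫ x₂).op := by
  simp

/-- The pseudofunctor `U ↦ E(U)^∨` of presheaves of sets on the categories `E(U)`. -/
def pshPseudofunctor : Pseudofunctor (LocallyDiscrete Cᵒᵖ) Cat.{max u' v', max u' v' (v' + 1)} :=
  LocallyDiscrete.mkPseudofunctor
    (fun U ↦ Cat.of ((E.obj ⟨U.unop⟩ : Type _)ᵒᵖ ⥤ Type v'))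
    (fun f ↦ (pshMap E f).toCatHom)
    (fun U ↦ Cat.Hom.isoMk (pshId E U))
    (fun f g ↦ Cat.Hom.isoMk (pshComp E f g))
    (by
      intro b₀ b₁ b₂ b₃ f g h
      ext F : 3
      refine NatTrans.ext (funext fun H ↦ ?_)
      refine Eq.trans ?_ (eqToHom_pshMap E (Category.assoc f g h) F H
        (Bicategory.associator h.unop.toLoc g.unop.toLoc f.unop.toLoc).hom _).symm
      refine Eq.trans ?_ (congrArg (fun η ↦ F.map (η.toNatTrans.app H.unop).op)
        (E.map₂_associator h.unop.toLoc g.unop.toLoc f.unop.toLoc)).symm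
      exact map_op_comp₄ F _ _ _ _)
    (by
      intro b₀ b₁ f
      ext F : 3
      refine NatTrans.ext (funext fun H ↦ ?_)
      refine Eq.trans ?_ (eqToHom_pshMap E (Category.id_comp f) F H
        (Bicategory.rightUnitor f.unop.toLoc).inv _).symm
      have e : E.map₂ (Bicategory.rightUnitor f.unop.toLoc).inv =
          (Bicategory.rightUnitor (E.map f.unop.toLoc)).inv ≫
            Bicategory.whiskerLeft _ (E.mapId _).inv ≫ (E.mapComp _ _).inv := by
        rw [← cancel_mono (E.map₂ (Bicategory.rightUnitor f.unop.toLoc).hom), ← E.map₂_comp,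
          Iso.inv_hom_id, E.map₂_id, E.map₂_right_unitor]
        simp
      refine Eq.trans ?_ (congrArg (fun η ↦ F.map (η.toNatTrans.app H.unop).op) e).symm
      exact map_op_comp₂ F _ _)
    (by
      intro b₀ b₁ f
      ext F : 3
      refine NatTrans.ext (funext fun H ↦ ?_)
      refine Eq.trans ?_ (eqToHom_pshMap E (Category.comp_id f) F H
        (Bicategory.leftUnitor f.unop.toLoc).inv _).symm
      have e : E.map₂ (Bicategory.leftUnitor f.unop.toLoc).inv =
          (Bicategory.leftUnitor (E.map f.unop.toLoc)).inv ≫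
            Bicategory.whiskerRight (E.mapId _).inv _ ≫ (E.mapComp _ _).inv := by
        rw [← cancel_mono (E.map₂ (Bicategory.leftUnitor f.unop.toLoc).hom), ← E.map₂_comp,
          Iso.inv_hom_id, E.map₂_id, E.map₂_left_unitor]
        simp
      refine Eq.trans ?_ (congrArg (fun η ↦ F.map (η.toNatTrans.app H.unop).op) e).symm
      exact map_op_comp₂ F _ _)
end Psh

section Adj

variable {X : TopCat.{u}} (R : Sheaf (Opens.grothendieckTopology X) RingCat.{u})

/-- An open subset of `V`, as an open subset of `U`. -/
abbrev image {V U : Opens X} (h : V ⟶ U) (W : Opens (sp V)) : Opens (sp U) :=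
  (isOpenMap_incl h).functor.obj W

/-- The preimage in `V` of an open subset of `U`. -/
abbrev preim {V U : Opens X} (h : V ⟶ U) (W : Opens (sp U)) : Opens (sp V) :=
  (Opens.map (incl h)).obj W

instance isContinuous_image {V U : Opens X} (h : V ⟶ U) :
    (isOpenMap_incl h).functor.IsContinuous (Opens.grothendieckTopology (sp V))
      (Opens.grothendieckTopology (sp U)) :=
  (isOpenEmbedding_incl h).functor_isContinuous

/-- The identification of `R|_V` with the restriction of `R|_U` to `V`. -/
def ringToRestr {V U : Opens X} (h : V ⟶ U) :
    ringOn R V ⟶ ((isOpenMap_incl h).functor.sheafPushforwardContinuous RingCat.{u}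
      (Opens.grothendieckTopology (sp V)) (Opens.grothendieckTopology (sp U))).obj
        (ringOn R U) where
  hom :=
    { app W := R.obj.map (homOfLE (by
        rintro _ ⟨_, ⟨y, hy, rfl⟩, rfl⟩
        exact ⟨y, hy, rfl⟩)).op
      naturality {W W'} f := by
        refine (R.obj.map_comp _ _).symm.trans (Eq.trans ?_ (R.obj.map_comp _ _))
        rfl }

/-- The restriction functor `j⁻¹ : M ↦ M|_V` for the inclusion `j : V → U`. -/
def restr {V U : Opens X} (h : V ⟶ U) : Mod (ringOn R U) ⥤ Mod (ringOn R V) :=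
  SheafOfModules.pushforward (ringToRestr R h)

variable {R} {V U : Opens X} (h : V ⟶ U)

/-- The restriction map `R(W) → R(j(W))`, which is an isomorphism. -/
def ringImg {W : Opens (sp V)} (a : (ringOn R V).obj.obj (op W)) :
    (ringOn R U).obj.obj (op (image h W)) :=
  (ringToRestr R h).hom.app (op W) a

/-- A section of `G` over `j(W)`, as a section of `G|_V` over `W`. -/
def toRestr (G : Mod (ringOn R U)) {W : Opens (sp V)} (s : G.val.obj (op (image h W))) :
    ((restr R h).obj G).val.obj (op W) := s

/-- A section of `G|_V` over `W`, as a section of `G` over `j(W)`. -/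
def ofRestr (G : Mod (ringOn R U)) {W : Opens (sp V)} (s : ((restr R h).obj G).val.obj (op W)) :
    G.val.obj (op (image h W)) := s

lemma image_mono {W W' : Opens (sp V)} (hW : W ≤ W') : image h W ≤ image h W' :=
  leOfHom ((isOpenMap_incl h).functor.map (homOfLE hW))

lemma preim_image {W : Opens (sp V)} : preim h (image h W) ≤ W := by
  rintro y ⟨z, hz, e⟩
  have : z = y := (isOpenEmbedding_incl h).injective e
  exact this ▸ hz

lemma le_preim_image {W : Opens (sp V)} : W ≤ preim h (image h W) := fun y hy ↦ ⟨y, hy, rfl⟩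

lemma image_preim {W : Opens (sp U)} : image h (preim h W) ≤ W := by
  rintro _ ⟨z, hz, rfl⟩
  exact hz

lemma preim_mono {W W' : Opens (sp U)} (hW : W ≤ W') : preim h W ≤ preim h W' := fun _ hx ↦ hW hx

lemma mem_image_preim {W : Opens (sp U)} {x : sp U} (hx : x ∈ W) (hxV : x.1 ∈ V) :
    x ∈ image h (preim h W) := ⟨⟨x.1, hxV⟩, hx, rfl⟩

lemma mem_of_mem_image {W : Opens (sp V)} {x : sp U} (hx : x ∈ image h W) : x.1 ∈ V := by
  obtain ⟨y, -, rfl⟩ := hx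
  exact y.2

variable (G : Mod (ringOn R U))

lemma ofRestr_res {W W' : Opens (sp V)} (hW : W ≤ W')
    (s : ((restr R h).obj G).val.obj (op W')) :
    ofRestr h G (res _ hW s) = res G (image_mono h hW) (ofRestr h G s) := rfl

lemma ofRestr_smul {W : Opens (sp V)} (a : (ringOn R V).obj.obj (op W))
    (s : ((restr R h).obj G).val.obj (op W)) :
    ofRestr h G (a • s) = ringImg h a • ofRestr h G s := rfl

lemma ofRestr_add {W : Opens (sp V)} 
    (s t : ((restr R h).obj G).val.obj (op W)) :
    ofRestr h G (s + t) = ofRestr h G s + ofRestr h G t := rfl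

lemma ringRes_ringImg {W : Opens (sp V)} (a : (ringOn R V).obj.obj (op W)) :
    ringRes h (ringImg h a) = (ringOn R V).obj.map (homOfLE (preim_image h (W := W))).op a :=
  (congr($(R.obj.map_comp _ _) a) : _).symm

lemma ringImg_ringRes {W : Opens (sp U)} (a : (ringOn R U).obj.obj (op W)) :
    ringImg h (ringRes h a) = (ringOn R U).obj.map (homOfLE (image_preim h (W := W))).op a :=
  (congr($(R.obj.map_comp _ _) a) : _).symm

variable (M : Mod (ringOn R V))

variable {M} in
lemma ofRestr_app_res (φ : M ⟶ (restr R h).obj G) {W W' : Opens (sp V)} (hW : W ≤ W')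
    (s : M.val.obj (op W')) :
    res G (image_mono h hW) (ofRestr h G (φ.val.app (op W') s)) =
      ofRestr h G (φ.val.app (op W) (res M hW s)) := by
  rw [app_res, ofRestr_res]

/-- A section of `M` over `W`, as a section of `j_! M` over `j(W)`. -/
def extSec {W : Opens (sp V)} (s : M.val.obj (op W)) :
    ((extZero R h).obj M).val.obj (op (image h W)) :=
  mkSec h M (res M (preim_image h) s) (fun _ hx hxV ↦ (hxV (mem_of_mem_image h hx)).elim)

/-- The unit `M → (j_! M)|_V` of the adjunction between extension by zero and restriction. -/
def unit : M ⟶ (restr R h).obj ((extZero R h).obj M) where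
  val :=
    { app W := ModuleCat.ofHom
        (Y := ((restr R h).obj ((extZero R h).obj M)).val.obj W)
        { toFun s := toRestr h _ (extSec h M (W := W.unop) s)
          map_add' s t := sec_injective h M (res_add M (preim_image h) s t)
          map_smul' a s := by
            refine sec_injective h M ?_
            refine (res_smul M (preim_image h) a s).trans ?_
            rw [← ringRes_ringImg]
            rfl }
      naturality {W W'} f := by
        ext s
        refine sec_injective h M ?_
        refine (res_res M (preim_image h) (leOfHom f.unop) s).trans ?_
        exact (res_res M _ _ s).symm }

lemma unit_naturality {M N : Mod (ringOn R V)} (f : M ⟶ N) :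
    f ≫ unit h N = unit h M ≫ (restr R h).map ((extZero R h).map f) := by
  refine hom_ext fun W s ↦ sec_injective h N ?_
  exact (app_res f _ s).symm

/-- The adjunction map `Hom(j_! M, G) → Hom(M, G|_V)`. -/
def adjHom (ψ : (extZero R h).obj M ⟶ G) : M ⟶ (restr R h).obj G :=
  unit h M ≫ (restr R h).map ψ

lemma adjHom_apply (ψ : (extZero R h).obj M ⟶ G) {W : Opens (sp V)} (s : M.val.obj (op W)) :
    ofRestr h G ((adjHom h G M ψ).val.app (op W) s) =
      ψ.val.app (op (image h W)) (extSec h M s) := rfl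

lemma extSec_sec {W : Opens (sp U)} (s : ((extZero R h).obj M).val.obj (op W)) :
    extSec h M (sec h M s) = res _ (image_preim h) s := by
  refine sec_injective h M ?_
  rfl

lemma adjHom_injective : Function.Injective (adjHom h G M) := by
  intro ψ ψ' e
  refine hom_ext fun W s ↦ sec_ext _ _ _ fun x hx ↦ ?_
  by_cases hxV : x.1 ∈ V
  · refine ⟨image h (preim h W), image_preim h, mem_image_preim h hx hxV, ?_⟩
    rw [← app_res, ← app_res, ← extSec_sec, ← adjHom_apply, ← adjHom_apply, e]
  · obtain ⟨W', hW', hxW', e'⟩ := isExt_sec h M s x hx hxV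
    have e'' : res _ hW' s = 0 := sec_injective h M e'
    exact ⟨W', hW', hxW', by rw [← app_res, ← app_res, e'', map_zero, map_zero]⟩

/-- The condition characterizing the image of a section under the morphism adjoint to `φ`. -/
def IsAdj (φ : M ⟶ (restr R h).obj G) {W : Opens (sp U)}
    (s : ((extZero R h).obj M).val.obj (op W)) (t : G.val.obj (op W)) : Prop :=
  res G (image_preim h) t = ofRestr h G (φ.val.app (op (preim h W)) (sec h M s)) ∧
    ∀ (W' : Opens (sp U)) (hW : W' ≤ W), res _ hW s = 0 → res G hW t = 0

variable {h G M}

lemma IsAdj.unique {φ : M ⟶ (restr R h).obj G} {W : Opens (sp U)}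
    {s : ((extZero R h).obj M).val.obj (op W)} {t t' : G.val.obj (op W)}
    (ht : IsAdj h G M φ s t) (ht' : IsAdj h G M φ s t') : t = t' := by
  refine sec_ext _ _ _ fun x hx ↦ ?_
  by_cases hxV : x.1 ∈ V
  · exact ⟨image h (preim h W), image_preim h, mem_image_preim h hx hxV, ht.1.trans ht'.1.symm⟩
  · obtain ⟨W', hW', hxW', e'⟩ := isExt_sec h M s x hx hxV
    have e'' : res _ hW' s = 0 := sec_injective h M e'
    exact ⟨W', hW', hxW', by rw [ht.2 W' hW' e'', ht'.2 W' hW' e'']⟩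

lemma IsAdj.add {φ : M ⟶ (restr R h).obj G} {W : Opens (sp U)}
    {s s' : ((extZero R h).obj M).val.obj (op W)} {t t' : G.val.obj (op W)}
    (ht : IsAdj h G M φ s t) (ht' : IsAdj h G M φ s' t') :
    IsAdj h G M φ (s + s') (t + t') := by
  refine ⟨?_, fun W' hW e ↦ ?_⟩
  · rw [res_add, ht.1, ht'.1, sec_add, map_add, ofRestr_add]
  · refine sec_ext _ _ _ fun x hx ↦ ?_
    by_cases hxV : x.1 ∈ V
    · have hle : image h (preim h W') ≤ image h (preim h W) := image_mono h (preim_mono h hW)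
      refine ⟨image h (preim h W'), image_preim h, mem_image_preim h hx hxV, ?_⟩
      have e1 : res M (preim_mono h hW) (sec h M (s + s')) = 0 :=
        congr(sec h M $e)
      rw [res_res, ← res_res G hle (image_preim h), res_add, ht.1, ht'.1, ← ofRestr_add, ← map_add,
        ← sec_add, ofRestr_app_res h G φ (preim_mono h hW), e1, map_zero, res_zero]
      rfl
    · obtain ⟨W₁, hW₁, hx₁, e₁⟩ := isExt_sec h M s x (hW hx) hxV
      obtain ⟨W₂, hW₂, hx₂, e₂⟩ := isExt_sec h M s' x (hW hx) hxV
      have h₁ := ht.2 W₁ hW₁ (sec_injective h M e₁)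
      have h₂ := ht'.2 W₂ hW₂ (sec_injective h M e₂)
      refine ⟨W' ⊓ (W₁ ⊓ W₂), inf_le_left, ⟨hx, hx₁, hx₂⟩, ?_⟩
      rw [res_res, res_zero, res_add,
        ← res_res G (inf_le_right.trans inf_le_left : W' ⊓ (W₁ ⊓ W₂) ≤ W₁) hW₁, h₁,
        ← res_res G (inf_le_right.trans inf_le_right : W' ⊓ (W₁ ⊓ W₂) ≤ W₂) hW₂, h₂,
        res_zero, res_zero, add_zero]

lemma IsAdj.smul {φ : M ⟶ (restr R h).obj G} {W : Opens (sp U)}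
    {s : ((extZero R h).obj M).val.obj (op W)} {t : G.val.obj (op W)}
    (a : (ringOn R U).obj.obj (op W))
    (ht : IsAdj h G M φ s t)  :
    IsAdj h G M φ (a • s) (a • t) := by
  refine ⟨?_, fun W' hW e ↦ ?_⟩
  · rw [res_smul, ht.1, sec_smul, map_smul, ofRestr_smul, ringImg_ringRes]
  · refine sec_ext _ _ _ fun x hx ↦ ?_
    by_cases hxV : x.1 ∈ V
    · have hle : image h (preim h W') ≤ image h (preim h W) := image_mono h (preim_mono h hW)
      refine ⟨image h (preim h W'), image_preim h, mem_image_preim h hx hxV, ?_⟩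
      have e1 : res M (preim_mono h hW) (sec h M (a • s)) = 0 :=
        congr(sec h M $e)
      rw [res_res, ← res_res G hle (image_preim h), res_smul, ht.1, ← ringImg_ringRes,
        ← ofRestr_smul, ← map_smul,
        ← sec_smul, ofRestr_app_res h G φ (preim_mono h hW), e1, map_zero, res_zero]
      rfl
    · obtain ⟨W₁, hW₁, hx₁, e₁⟩ := isExt_sec h M s x (hW hx) hxV
      have h₁ := ht.2 W₁ hW₁ (sec_injective h M e₁)
      refine ⟨W' ⊓ W₁, inf_le_left, ⟨hx, hx₁⟩, ?_⟩
      rw [res_res, res_zero, res_smul,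
        ← res_res G (inf_le_right : W' ⊓ W₁ ≤ W₁) hW₁, h₁, res_zero, smul_zero]

lemma IsAdj.res {φ : M ⟶ (restr R h).obj G} {W W' : Opens (sp U)} (hW : W' ≤ W)
    {s : ((extZero R h).obj M).val.obj (op W)} {t : G.val.obj (op W)}
    (ht : IsAdj h G M φ s t) :
    IsAdj h G M φ (res _ hW s) (KSInd.res G hW t) := by
  refine ⟨?_, fun W₁ hW₁ e ↦ ?_⟩
  · have hle : image h (preim h W') ≤ image h (preim h W) := image_mono h (preim_mono h hW)
    rw [res_res, ← res_res G hle (image_preim h), ht.1, sec_res,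
      ofRestr_app_res h G φ (preim_mono h hW)]
  · rw [res_res] at e ⊢
    exact ht.2 _ _ e

lemma IsAdj.exists (φ : M ⟶ (restr R h).obj G) {W : Opens (sp U)}
    (s : ((extZero R h).obj M).val.obj (op W)) : ∃ t, IsAdj h G M φ s t := by
  let t₀ : G.val.obj (op (image h (preim h W))) :=
    ofRestr h G (φ.val.app (op (preim h W)) (sec h M s))
  have key (W' : Opens (sp U)) (hW : W' ≤ W) (e : KSInd.res _ hW s = 0) :
      KSInd.res G (inf_le_left : image h (preim h W) ⊓ W' ≤ _) t₀ = 0 := by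
    have hle : image h (preim h W) ⊓ W' ≤ image h (preim h W') := by
      rintro _ ⟨⟨y, hy, rfl⟩, hy'⟩
      exact ⟨y, hy', rfl⟩
    have hle' : preim h W' ≤ preim h W := fun _ hy ↦ hW hy
    have e1 : KSInd.res M hle' (sec h M s) = 0 := congr(sec h M $e)
    rw [← res_res G hle (image_mono h hle')]
    have : KSInd.res G (image_mono h hle') t₀ = 0 := by
      rw [← ofRestr_res h G hle', ← app_res, e1, map_zero]
      rfl
    rw [this, res_zero]
  let ι := Option {W' : Opens (sp U) // ∃ hW : W' ≤ W, KSInd.res _ hW s = 0}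
  obtain ⟨t, ht⟩ := sec_glue G (ι := ι)
    (fun i ↦ i.elim (image h (preim h W)) Subtype.val) W
    (by
      rintro (_ | ⟨W', hW, e⟩)
      · exact image_preim h
      · exact hW)
    (by
      intro x hx
      by_cases hxV : x.1 ∈ V
      · exact ⟨none, mem_image_preim h hx hxV⟩
      · obtain ⟨W', hW', hxW', e'⟩ := isExt_sec h M s x hx hxV
        exact ⟨some ⟨W', hW', sec_injective h M e'⟩, hxW'⟩)
    (fun i ↦ match i with
      | none => t₀
      | some _ => 0)
    (by
      rintro (_ | ⟨W', hW, e⟩) (_ | ⟨W₁, hW₁, e₁⟩)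
      · rfl
      · refine (key _ hW₁ e₁).trans ?_
        exact (res_zero G _).symm
      · have := key _ hW e
        refine (res_zero G _).trans ?_
        have hh := congrArg (KSInd.res G (W := W' ⊓ image h (preim h W))
          (W' := image h (preim h W) ⊓ W') (le_of_eq (inf_comm _ _))) this
        rw [res_res, res_zero] at hh
        exact hh.symm
      · exact (res_zero G _).trans (res_zero G _).symm)
  exact ⟨t, ht none, fun W' hW e ↦ ht (some ⟨W', hW, e⟩)⟩

variable (h G M)

lemma adjHom_surjective : Function.Surjective (adjHom h G M) := by
  intro φ
  choose t ht using fun (W : Opens (sp U)) (s : ((extZero R h).obj M).val.obj (op W)) ↦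
    IsAdj.exists φ s
  let ψ : (extZero R h).obj M ⟶ G :=
    { val :=
        { app W := ModuleCat.ofHom
            { toFun s := t W.unop s
              map_add' s s' := (ht _ _).unique ((ht _ s).add (ht _ s'))
              map_smul' a s := (ht _ _).unique ((ht _ s).smul a) }
          naturality {W W'} f := by
            ext s
            exact (ht _ _).unique ((ht _ s).res (leOfHom f.unop)) } }
  refine ⟨ψ, hom_ext fun W s ↦ ?_⟩
  have h1 := (ht _ (extSec h M s)).1
  have h2 := (congrArg (res G (image_mono h (le_preim_image h (W := W)))) h1)
  rw [res_res, res_self] at h2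
  refine h2.trans ?_
  rw [ofRestr_app_res h G φ (le_preim_image h (W := W))]
  have : res M (le_preim_image h (W := W)) (sec h M (extSec h M s)) = s := by
    refine (res_res M _ _ _).trans (res_self M _ _)
  rw [this]
  rfl

end Adj

section Supp

variable {Y : TopCat.{u}} {R : Sheaf (Opens.grothendieckTopology Y) RingCat.{u}}

lemma isClosed_supp (M : Mod R) : IsClosed (supp M) :=
  isClosed_compl_iff.2 (isOpen_biUnion fun W _ ↦ W.2)

lemma supp_subset {M : Mod R} {K : Set Y} (hK : IsClosed K)
    (hM : ∀ (W : Opens Y) (_ : Disjoint (W : Set Y) K) (s : M.val.obj (op W)), s = 0) :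
    supp M ⊆ K := by
  intro x hx
  by_contra hxK
  refine hx (Set.mem_biUnion (x := (⟨Kᶜ, hK.isOpen_compl⟩ : Opens Y)) ?_ hxK)
  intro W' hW'
  have h := hM W' (Set.disjoint_left.2 fun y hy ↦ hW' hy)
  exact ⟨fun s t ↦ (h s).trans (h t).symm⟩

lemma vanishesAt_of_notMem_supp {M : Mod R} {x : Y} (hx : x ∉ supp M) {W : Opens Y} (hxW : x ∈ W)
    (s : M.val.obj (op W)) : VanishesAt M s x := by
  obtain ⟨W', hW', hxW'⟩ := Set.mem_iUnion₂.1 (Set.notMem_compl_iff.1 hx)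
  exact ⟨W' ⊓ W, inf_le_right, ⟨hxW', hxW⟩, (hW' _ inf_le_left).elim _ _⟩

lemma hasCompactSupport_of_subset {M : Mod R} {K : Set Y} (hK : IsCompact K) (h : supp M ⊆ K) :
    HasCompactSupport M := hK.of_isClosed_subset (isClosed_supp M) h

/-- The inclusion `M_S → M_S'` for `S ⊆ S'`. -/
def cutLE (M : Mod R) {S S' : Opens Y} (hS : S ≤ S') : cut M S ⟶ cut M S' where
  val :=
    { app W := ModuleCat.ofHom (Submodule.inclusion (p := (cutSub M S).obj W)
        (p' := (cutSub M S').obj W) (fun _ hs x hx hxS ↦ hs x hx fun hxS' ↦ hxS (hS hxS')))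
      naturality _ := rfl }

/-- A morphism `N → M` factors through `M_S` if the image of each section of `N` vanishes
outside `S`. -/
def cutLift {M N : Mod R} (S : Opens Y) (f : N ⟶ M)
    (hf : ∀ (W : Opens Y) (s : N.val.obj (op W)), ∀ x ∈ W, x ∉ S →
      VanishesAt M (f.val.app (op W) s) x) : N ⟶ cut M S where
  val :=
    { app W := ModuleCat.ofHom (Y := (cut M S).val.obj W)
        ((f.val.app W).hom.codRestrict ((cutSub M S).obj W) (fun s ↦ hf W.unop s))
      naturality g := by
        ext s
        exact Subtype.ext (PresheafOfModules.naturality_apply f.val g s) }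

variable (R) in
/-- The category `Mod_c(R)` of sheaves of modules with compact support. -/
abbrev Modc := (HasCompactSupport (R := R)).FullSubcategory

end Supp

section Restr

variable {X : TopCat.{u}} {R : Sheaf (Opens.grothendieckTopology X) RingCat.{u}}
  {V U : Opens X} (h : V ⟶ U)

lemma extZero_vanishesAt {M : Mod (ringOn R V)} {W : Opens (sp U)}
    (s : ((extZero R h).obj M).val.obj (op W)) {x : sp U} (hx : x ∈ W)
    (hxM : x ∉ incl h '' supp M) : VanishesAt _ s x := by
  by_cases hxV : x.1 ∈ V
  · have hx' : (⟨x.1, hxV⟩ : sp V) ∉ supp M := fun hh ↦ hxM ⟨_, hh, rfl⟩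
    obtain ⟨W', hW', hxW', e⟩ := vanishesAt_of_notMem_supp hx' (W := preim h W) hx (sec h M s)
    refine ⟨image h W', (image_mono h hW').trans (image_preim h), ⟨_, hxW', rfl⟩,
      sec_injective h M ?_⟩
    refine (res_res M (preim_image h) hW' _).symm.trans ?_
    exact (congrArg (res M (preim_image h)) e).trans (res_zero M _)
  · obtain ⟨W', hW', hxW', e'⟩ := isExt_sec h M s x hx hxV
    exact ⟨W', hW', hxW', sec_injective h M e'⟩

lemma extZero_hasCompactSupport [T2Space X] {M : Mod (ringOn R V)} (hM : HasCompactSupport M) :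
    HasCompactSupport ((extZero R h).obj M) := by
  have hK : IsCompact (incl h '' supp M) := IsCompact.image hM (incl h).hom.continuous
  have : T2Space (sp U) := inferInstanceAs (T2Space U)
  refine hasCompactSupport_of_subset hK (supp_subset hK.isClosed fun W hW s ↦ ?_)
  refine sec_ext _ _ _ fun x hx ↦ ?_
  obtain ⟨W', hW', hxW', e⟩ := extZero_vanishesAt h s hx fun hh ↦ Set.disjoint_left.1 hW hx hh
  exact ⟨W', hW', hxW', e.trans (res_zero _ _).symm⟩

/-- The relatively compact open subsets `W ⊂⊂ V` of `V`. -/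
abbrev RelCompact (V : Opens X) := {W : Opens (sp V) // IsCompact (closure (W : Set (sp V)))}

instance (V : Opens X) : Nonempty (RelCompact V) := ⟨⟨⊥, by simp⟩⟩

instance (V : Opens X) : IsDirectedOrder (RelCompact V) where
  directed a b := ⟨⟨a.1 ⊔ b.1, by
    rw [Opens.coe_sup, closure_union]
    exact a.2.union b.2⟩, le_sup_left (a := a.1), le_sup_right (b := b.1)⟩

instance (V : Opens X) : IsFiltered (RelCompact V) := isFiltered_of_directed_le_nonempty _

lemma restr_cut_hasCompactSupport (M : Mod (ringOn R U)) (W : RelCompact V) :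
    HasCompactSupport ((restr R h).obj (cut M (image h W.1))) := by
  refine hasCompactSupport_of_subset W.2 (supp_subset isClosed_closure fun W' hW' s ↦ ?_)
  refine Subtype.ext (sec_ext M (W := image h W') _ _ fun x hx ↦ ?_)
  obtain ⟨W₁, hW₁, hx₁, e⟩ := s.2 x hx (by
    obtain ⟨y, hy, rfl⟩ := hx
    rintro ⟨z, hz, e⟩
    obtain rfl : z = y := (isOpenEmbedding_incl h).injective e
    exact Set.disjoint_left.1 hW' hy (subset_closure hz))
  exact ⟨W₁, hW₁, hx₁, e.trans (res_zero M _).symm⟩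

/-- The functor `(M, W) ↦ (M_W)|_V` from `Mod_c(R|_U)` and relatively compact open subsets of `V`,
to `Mod_c(R|_V)`. -/
def restrCut : Modc (ringOn R U) × RelCompact V ⥤ Modc (ringOn R V) where
  obj p := ⟨(restr R h).obj (cut p.1.obj (image h p.2.1)), restr_cut_hasCompactSupport h _ _⟩
  map f := ObjectProperty.homMk ((restr R h).map
    (cutLE _ (image_mono h (leOfHom f.2)) ≫ cutMap _ f.1.hom))
  map_id _ := ObjectProperty.hom_ext _ (hom_ext fun _ _ ↦ rfl)
  map_comp _ _ := ObjectProperty.hom_ext _ (hom_ext fun _ _ ↦ rfl)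

lemma adjHom_comp {M : Mod (ringOn R V)} {G G' : Mod (ringOn R U)}
    (ψ : (extZero R h).obj M ⟶ G) (g : G ⟶ G') :
    adjHom h G' M (ψ ≫ g) = adjHom h G M ψ ≫ (restr R h).map g := by
  simp [adjHom]

lemma comp_adjHom {M M' : Mod (ringOn R V)} {G : Mod (ringOn R U)} (f : M' ⟶ M)
    (ψ : (extZero R h).obj M ⟶ G) :
    adjHom h G M' ((extZero R h).map f ≫ ψ) = f ≫ adjHom h G M ψ := by
  rw [adjHom, Functor.map_comp, ← Category.assoc, ← unit_naturality, Category.assoc, adjHom]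

/-- The bijection `Hom(j_! M, G) ≃ Hom(M, G|_V)`. -/
def adjEquiv (M : Mod (ringOn R V)) (G : Mod (ringOn R U)) :
    ((extZero R h).obj M ⟶ G) ≃ (M ⟶ (restr R h).obj G) :=
  Equiv.ofBijective (adjHom h G M) ⟨adjHom_injective h G M, adjHom_surjective h G M⟩

variable (R) in
/-- The functor `j_! : Mod_c(R|_V) ⥤ Mod_c(R|_U)`. -/
def extZeroc [T2Space X] : Modc (ringOn R V) ⥤ Modc (ringOn R U) :=
  ObjectProperty.lift _ (ObjectProperty.ι _ ⋙ extZero R h)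
    (fun M ↦ extZero_hasCompactSupport h M.2)

lemma adjEquiv_symm_comp {M : Mod (ringOn R V)} {G G' : Mod (ringOn R U)}
    (φ : M ⟶ (restr R h).obj G) (g : G ⟶ G') :
    (adjEquiv h M G).symm φ ≫ g = (adjEquiv h M G').symm (φ ≫ (restr R h).map g) := by
  apply (adjEquiv h M G').injective
  rw [Equiv.apply_symm_apply]
  refine (adjHom_comp h _ g).trans ?_
  congr 1
  exact (adjEquiv h M G).apply_symm_apply φ

lemma comp_adjEquiv_symm {M M' : Mod (ringOn R V)} {G : Mod (ringOn R U)} (f : M' ⟶ M)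
    (φ : M ⟶ (restr R h).obj G) :
    (extZero R h).map f ≫ (adjEquiv h M G).symm φ = (adjEquiv h M' G).symm (f ≫ φ) := by
  apply (adjEquiv h M' G).injective
  rw [Equiv.apply_symm_apply]
  refine (comp_adjHom h f _).trans ?_
  congr 1
  exact (adjEquiv h M G).apply_symm_apply φ

variable [T2Space X] {F : (Modc (ringOn R U))ᵒᵖ ⥤ Type u}

/-- The canonical map `(F_i)_W|_V → F ∘ j_!` for `F = indlim F_i`, which sends a morphism
`H → (F_i)_W|_V` to the element given by the adjoint of `H → (F_i)_W|_V → F_i|_V`. -/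
def restrPresentationι {I : Type u} [SmallCategory I] (D : I ⥤ Modc (ringOn R U))
    (ι : D ⋙ yoneda ⟶ (Functor.const I).obj F) :
    (D.prod (𝟭 (RelCompact V)) ⋙ restrCut h) ⋙ yoneda ⟶
      (Functor.const (I × RelCompact V)).obj ((extZeroc R h).op ⋙ F) where
  app p :=
    { app H := ↾fun f ↦ (ι.app p.1).app (op ((extZeroc R h).obj H.unop))
        (ObjectProperty.homMk ((adjEquiv h _ _).symm
          (f.hom ≫ (restr R h).map (cutι (D.obj p.1).obj (image h p.2.1)))))
      naturality H H' g := by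
        ext f
        refine Eq.trans ?_ (congr($((ι.app p.1).naturality ((extZeroc R h).map g.unop).op) _))
        refine congrArg ((ι.app p.1).app (op ((extZeroc R h).obj H'.unop)))
          (ObjectProperty.hom_ext _ ?_)
        refine Eq.trans ?_ (comp_adjEquiv_symm h g.unop.hom _).symm
        simp
        rfl }
  naturality p q a := by
    ext H f
    have h1 := congr(($(ι.naturality a.1)).app (op ((extZeroc R h).obj H.unop))
      (ObjectProperty.homMk ((adjEquiv h _ _).symm
          (f.hom ≫ (restr R h).map (cutι (D.obj p.1).obj (image h p.2.1))))))
    refine Eq.trans ?_ h1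
    refine congrArg ((ι.app q.1).app (op ((extZeroc R h).obj H.unop)))
      (ObjectProperty.hom_ext _ ?_)
    refine Eq.trans ?_ (adjEquiv_symm_comp h _ _).symm
    refine congrArg (adjEquiv h _ (D.obj q.1).obj).symm ?_
    refine hom_ext fun _ _ ↦ rfl

lemma isColimit_restrPresentation [LocallyCompactSpace X] {I : Type u} [SmallCategory I]
    [IsFiltered I] (D : I ⥤ Modc (ringOn R U))
    (ι : D ⋙ yoneda ⟶ (Functor.const I).obj F) (hι : IsColimit (Cocone.mk F ι)) :
    Nonempty (IsColimit (Cocone.mk _ (restrPresentationι h D ι))) := by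
  have hι' (H : (Modc (ringOn R U))ᵒᵖ) := isColimitOfPreserves ((evaluation _ _).obj H) hι
  refine ⟨evaluationJointlyReflectsColimits _ fun H ↦
    Types.FilteredColimit.isColimitOf' _ _ (fun x ↦ ?_) (fun p f g e ↦ ?_)⟩
  · obtain ⟨i, ψ, hψ⟩ := Types.jointly_surjective_of_isColimit
      (hι' (op ((extZeroc R h).obj H.unop))) x
    have : LocallyCompactSpace (sp V) := V.2.locallyCompactSpace
    obtain ⟨K, hK, hK'⟩ := exists_compact_superset (show IsCompact (supp H.unop.obj) from H.unop.2)
    have : T2Space (sp V) := inferInstanceAs (T2Space V)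
    let W : RelCompact V := ⟨⟨interior K, isOpen_interior⟩,
      hK.of_isClosed_subset isClosed_closure (hK.isClosed.closure_interior_subset)⟩
    let ψ' : (extZero R h).obj H.unop.obj ⟶ cut (D.obj i).obj (image h W.1) :=
      cutLift _ ψ.hom fun W' s x hx hxW ↦ by
        refine (extZero_vanishesAt h s hx ?_).map ψ.hom
        rintro ⟨y, hy, rfl⟩
        exact hxW ⟨y, hK' hy, rfl⟩
    let f := adjEquiv h _ _ ψ'
    have hf : f ≫ (restr R h).map (cutι (D.obj i).obj (image h W.1)) = adjEquiv h _ _ ψ.hom :=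
      (adjHom_comp h ψ' (cutι (D.obj i).obj (image h W.1))).symm
    refine ⟨(i, W), ObjectProperty.homMk f, ?_⟩
    refine hψ.symm.trans ?_
    refine congrArg ((ι.app i).app (op ((extZeroc R h).obj H.unop)))
      (ObjectProperty.hom_ext _ ?_)
    refine Eq.trans ?_ (congrArg (adjEquiv h _ (D.obj i).obj).symm hf.symm)
    exact ((adjEquiv h _ (D.obj i).obj).symm_apply_apply ψ.hom).symm
  · obtain ⟨j, a, ha⟩ := (Types.FilteredColimit.isColimit_eq_iff'
      (hι' (op ((extZeroc R h).obj H.unop))) _ _).1 e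
    refine ⟨(j, p.2), (a, 𝟙 _), ObjectProperty.hom_ext _ ?_⟩
    have h1 := (adjEquiv_symm_comp h _ _).symm.trans
      ((congrArg InducedCategory.Hom.hom ha).trans (adjEquiv_symm_comp h _ _))
    have h2 := (adjEquiv h _ _).symm.injective h1
    exact hom_ext fun W s ↦ Subtype.ext congr($(congr(($h2).val.app (op W))) s)

end Restr

section Ind

variable {X : TopCat.{u}} (R : Sheaf (Opens.grothendieckTopology X) RingCat.{u})

/-- The adjunction between extension by zero and restriction. -/
def extZeroAdj {V U : Opens X} (h : V ⟶ U) : extZero R h ⊣ restr R h :=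
  Adjunction.mkOfHomEquiv
    { homEquiv M G := adjEquiv h M G
      homEquiv_naturality_left_symm f g := (comp_adjEquiv_symm h f g).symm
      homEquiv_naturality_right f g := adjHom_comp h f g }

/-- Sheaves of modules with compact support, as a property of objects of `U ↦ Mod(R|_U)`. -/
def compactSupportProperty : (extZeroPseudofunctor R).ObjectProperty where
  prop U := HasCompactSupport (R := ringOn R U.as)

instance [T2Space X] : (compactSupportProperty R).IsClosedUnderMapObj where
  map_obj hM f := extZero_hasCompactSupport f.as hM

/-- The covariant pseudofunctor `U ↦ Mod_c(R|_U)`, with the functors `j_!`. -/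
def extZerocPseudofunctor [T2Space X] :
    Pseudofunctor (LocallyDiscrete (Opens X)) Cat.{u, u + 1} :=
  (compactSupportProperty R).fullsubcategory

/-- The ind-objects, as a property of the objects of the pseudofunctor `U ↦ E(U)^∨`. -/
def indProperty {C : Type u} [Category.{v} C] (E : Pseudofunctor (LocallyDiscrete C) Cat.{v', u'}) :
    (pshPseudofunctor E).ObjectProperty where
  prop U := fun F : (E.obj ⟨U.as.unop⟩ : Type _)ᵒᵖ ⥤ Type v' ↦ IsIndObject F

variable {R} in
lemma isIndObject_restrc [T2Space X] [LocallyCompactSpace X] {V U : Opens X} (h : V ⟶ U)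
    {F : (Modc (ringOn R U))ᵒᵖ ⥤ Type u} (hF : IsIndObject F) :
    IsIndObject ((extZeroc R h).op ⋙ F) := by
  obtain ⟨⟨P⟩⟩ := hF
  exact ⟨⟨{ I := P.I × RelCompact V
            F := P.F.prod (𝟭 (RelCompact V)) ⋙ restrCut h
            ι := restrPresentationι h P.F P.ι
            isColimit := (isColimit_restrPresentation h P.F P.ι P.isColimit).some }⟩⟩

variable {R} in
lemma isIndObject_restr {V U : Opens X} (h : V ⟶ U)
    {F : (Mod (ringOn R U))ᵒᵖ ⥤ Type u} (hF : IsIndObject F) :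
    IsIndObject ((extZero R h).op ⋙ F) := by
  obtain ⟨⟨P⟩⟩ := hF
  let e := (extZeroAdj R h).compYonedaIso
  exact ⟨⟨IndObjectPresentation.ofCocone (F := P.F ⋙ restr R h)
    ((Cocone.precompose (Functor.isoWhiskerLeft P.F e).hom).obj
      (((Functor.whiskeringLeft _ _ _).obj (extZero R h).op).mapCocone P.cocone))
    ((IsColimit.precomposeHomEquiv _ _).symm (isColimitOfPreserves _ P.coconeIsColimit))⟩⟩

instance [T2Space X] [LocallyCompactSpace X] :
    (indProperty (extZerocPseudofunctor R)).IsClosedUnderMapObj where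
  map_obj hM f := isIndObject_restrc f.as.unop hM

instance : (indProperty (extZeroPseudofunctor R)).IsClosedUnderMapObj where
  map_obj hM f := isIndObject_restr f.as.unop hM

/-- The pseudofunctor `U ↦ I(R|_U) = Ind(Mod_c(R|_U))` of ind-sheaves, where
`Ind(C) ⊆ C^∨` is the full subcategory of ind-objects. The restriction functor
`F ↦ F|_V` for `j : V → U` is `F ↦ F ∘ j_!`; if `F = indlim F_i`, it is `indlim (F_i)_W|_V`, where the
ind-limit is over `i` and `W ⊂⊂ V`, see `isColimit_restrPresentation`. -/
def indSheaves [T2Space X] [LocallyCompactSpace X] :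
    Pseudofunctor (LocallyDiscrete (Opens X)ᵒᵖ) Cat.{u + 1, u + 1} :=
  (indProperty (extZerocPseudofunctor R)).fullsubcategory

/-- The pseudofunctor `U ↦ Ind(Mod(R|_U))`. The restriction functor `F ↦ F|_V` for `j : V → U` is
`F ↦ F ∘ j_!`; if `F = indlim F_i`, it is `indlim F_i|_V` by adjunction, see `isIndObject_restr`. -/
def indModules : Pseudofunctor (LocallyDiscrete (Opens X)ᵒᵖ) Cat.{u + 1, u + 1} :=
  (indProperty (extZeroPseudofunctor R)).fullsubcategory

end Ind

section Const

variable (k : Type u) [Field k] (X : TopCat.{u})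

instance preservesLimits_forget₂ : PreservesLimits (forget₂ (CommAlgCat.{u} k) CommRingCat.{u}) :=
  preservesLimits_of_natIso (F := (commAlgCatEquivUnder (CommRingCat.of k)).functor ⋙
    Under.forget (CommRingCat.of k)) (Iso.refl _)

instance preservesLimits_forget : PreservesLimits (forget (CommAlgCat.{u} k)) :=
  preservesLimits_of_natIso (F := forget₂ (CommAlgCat.{u} k) CommRingCat.{u} ⋙
    forget CommRingCat.{u}) (Iso.refl _)

instance hasSheafCompose_forget₂ : (Opens.grothendieckTopology X).HasSheafCompose
    (forget₂ (CommAlgCat.{u} k) CommRingCat.{u} ⋙ forget₂ CommRingCat RingCat.{u}) :=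
  hasSheafCompose_of_preservesLimitsOfSize _

variable {k X} in
/-- The sheaf of rings underlying a sheaf of commutative `k`-algebras. -/
def toRing (A : Sheaf (Opens.grothendieckTopology X) (CommAlgCat.{u} k)) :
    Sheaf (Opens.grothendieckTopology X) RingCat.{u} :=
  (sheafCompose _ (forget₂ (CommAlgCat.{u} k) CommRingCat.{u} ⋙
    forget₂ CommRingCat RingCat.{u})).obj A

/-- The presheaf of locally constant functions with values in `k`. -/
def locConst : (Opens X)ᵒᵖ ⥤ CommAlgCat.{u} k where
  obj U := CommAlgCat.of k (LocallyConstant U.unop k)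
  map {U V} f := CommAlgCat.ofHom
    (LocallyConstant.comapₐ k (ContinuousMap.inclusion (leOfHom f.unop)))

/-- The constant sheaf `k_X`: the sheaf of locally constant functions with values in `k`. -/
def constSheaf : Sheaf (Opens.grothendieckTopology X) (CommAlgCat.{u} k) where
  obj := locConst k X
  property := by
    refine (TopCat.Presheaf.isSheaf_iff_isSheafUniqueGluing (X := X) (F := locConst k X)).2 ?_
    intro ι U s hs
    let s' (i : ι) : LocallyConstant (U i) k := s i
    have hs' (i j) (x : X) (hi : x ∈ U i) (hj : x ∈ U j) :
        s' i ⟨x, hi⟩ = s' j ⟨x, hj⟩ :=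
      DFunLike.congr_fun (F := LocallyConstant (U i ⊓ U j : Opens X) k) (hs i j) ⟨x, hi, hj⟩
    choose i hi using fun x : (iSup U : Opens X) ↦ Opens.mem_iSup.1 x.2
    have hloc : IsLocallyConstant fun x : (iSup U : Opens X) ↦
        s' (i x) ⟨x.1, hi x⟩ := by
      rw [IsLocallyConstant.iff_eventually_eq]
      intro x
      have h1 := (s' (i x)).isLocallyConstant.eventually_eq
        ⟨x.1, hi x⟩
      rw [nhds_subtype_eq_comap, Filter.eventually_comap] at h1
      rw [nhds_subtype_eq_comap, Filter.eventually_comap]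
      filter_upwards [h1, (U (i x)).2.mem_nhds (hi x)] with y hy hyU z hz
      subst hz
      exact (hs' _ _ _ _ _).trans (hy ⟨z.1, hyU⟩ rfl)
    refine ⟨(⟨_, hloc⟩ : LocallyConstant (iSup U : Opens X) k), fun j ↦ ?_, fun t ht ↦ ?_⟩
    · refine LocallyConstant.ext (Y := k) fun x ↦ ?_
      exact hs' _ _ _ _ _
    · refine LocallyConstant.ext (Y := k) fun x ↦ ?_
      exact DFunLike.congr_fun (F := LocallyConstant (U (i x)) k) (ht (i x)) ⟨x.1, hi x⟩

end Const

/-- The ind-object `indlim D_i`, as a presheaf of sets. -/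
def indLim {C : Type v} [Category.{u} C] {I : Type u} [SmallCategory I] (D : I ⥤ C) :
    Cᵒᵖ ⥤ Type u :=
  colimit (D ⋙ yoneda)

end KSInd

end

noncomputable section

namespace KSInd

/-! ### Isomorphisms, monomorphisms and supports of sheaves of modules. -/

section SheafHom

variable {Y : TopCat.{u}} {R : Sheaf (Opens.grothendieckTopology Y) RingCat.{u}}

/-! The stack property rests on compactness of supports. If `H` has compact support, finitely many
open sets `W_k` of any suitable covering suffice to cover `supp H`, and `H` is then the colimit of
the finite diagram of the `H_{W_k}` and `H_{W_k ∩ W_l}`. An ind-object `F` is a filtered colimit of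
representable functors, and filtered colimits commute with finite limits of sets, so an element of
`F(H)` is the same as a compatible family of elements of the `F(H_{W_k})` (`eq_of_cut`,
`exists_of_cut`). If the closure of `W` lies in a member `U_i` of the covering, then `H_W` has
compact support in `U_i` and comes by `j_!` from `Mod_c` of `U_i` (`essImage_extZeroc`). Hence
morphisms of ind-sheaves are determined by their restrictions to the `U_i`, and compatible ones glue
(`exists_natTrans_of_suppIn`).

To glue objects `F_i`, let `F(H)` be the set of compatible families of elements of the `F_i(H_W)`,
where the closure of `W` lies in `U_i`. The functor `F` is left exact because `H ↦ H_W` preserves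
finite colimits (`preservesFiniteLimits_glued`), so its category of elements is filtered. Only
smallness remains (`isIndObject_of_small`). Given `p ∈ F(H)`, the sheaf `H` is an epimorphic image
of a finite sum of sheaves `H_{W_j}`, and each of these maps to a member of a small family carrying
the restriction of `p`. Pushing out, `H` maps to a quotient of a finite sum of members of that
family, and the quotients of a given sheaf form a small family (`exists_small_quotients`). So `F` is
an ind-object.

The formula for `F|_V` follows from the adjunction between `j_!` and restriction: a morphism from
`j_! H` to `F_i` factors through `(F_i)_W` for some `W ⊂⊂ V`, since `H` has compact support.

Without the support condition even separatedness fails. On the real line put `G = “lim” k /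
k_{(-n,n)}`. The projection from `k` to `G` vanishes on every `(-n,n)`, but it is not zero since no
`k_{(-n,n)} → k` is an epimorphism (`not_isStack_indModules`). -/

lemma comp_app {M N P : Mod R} (f : M ⟶ N) (g : N ⟶ P) (W : Opens Y)
    (s : M.val.obj (op W)) :
    (f ≫ g).val.app (op W) s = g.val.app (op W) (f.val.app (op W) s) := rfl

lemma isIso_of_bijective {M N : Mod R} (f : M ⟶ N)
    (hf : ∀ W : Opens Y, Function.Bijective (f.val.app (op W))) : IsIso f := by
  let e : M ≅ N := isoMk (fun W ↦ LinearEquiv.ofBijective (f.val.app (op W)).hom (hf W))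
    (fun W W' h s ↦ app_res f h s)
  exact (inferInstance : IsIso e.hom)

lemma bijective_of_isIso {M N : Mod R} (f : M ⟶ N) [IsIso f] (W : Opens Y) :
    Function.Bijective (f.val.app (op W)) := by
  refine Function.bijective_iff_has_inverse.2 ⟨(inv f).val.app (op W), fun s ↦ ?_, fun s ↦ ?_⟩
  · rw [← comp_app, IsIso.hom_inv_id]
    rfl
  · rw [← comp_app, IsIso.inv_hom_id]
    rfl

lemma mono_of_injective {M N : Mod R} (f : M ⟶ N)
    (hf : ∀ W : Opens Y, Function.Injective (f.val.app (op W))) : Mono f where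
  right_cancellation g g' e := hom_ext fun W s ↦ hf W (by rw [← comp_app, e, comp_app])

instance mono_cutι (M : Mod R) (S : Opens Y) : Mono (cutι M S) :=
  mono_of_injective _ fun _ ↦ Subtype.val_injective

lemma supp_mono {M N : Mod R} (f : M ⟶ N)
    (hf : ∀ W : Opens Y, Function.Injective (f.val.app (op W))) : supp M ⊆ supp N := by
  refine Set.compl_subset_compl.2 (Set.biUnion_subset_biUnion_left fun W hW W' hW' ↦ ?_)
  have := hW W' hW'
  exact (hf W').subsingleton

lemma supp_eq_of_iso {M N : Mod R} (e : M ≅ N) : supp M = supp N :=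
  (supp_mono e.hom fun W ↦ (bijective_of_isIso _ W).1).antisymm
    (supp_mono e.inv fun W ↦ (bijective_of_isIso _ W).1)

lemma eq_zero_of_disjoint_supp (M : Mod R) {W : Opens Y} (hW : Disjoint (W : Set Y) (supp M))
    (s : M.val.obj (op W)) : s = 0 := by
  refine sec_ext _ _ _ fun x hx ↦ ?_
  obtain ⟨W', hW', hxW', e⟩ := vanishesAt_of_notMem_supp (Set.disjoint_left.1 hW hx) hx s
  exact ⟨W', hW', hxW', e.trans (res_zero _ _).symm⟩

lemma supp_cut_subset (M : Mod R) (S : Opens Y) : supp (cut M S) ⊆ closure (S : Set Y) ∩ supp M := by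
  refine Set.subset_inter (supp_subset isClosed_closure fun W hW s ↦ ?_)
    (supp_mono (cutι M S) fun _ ↦ Subtype.val_injective)
  refine sec_ext _ _ _ fun x hx ↦ ?_
  obtain ⟨W', hW', hxW', e⟩ := s.2 x hx fun h ↦ Set.disjoint_left.1 hW hx (subset_closure h)
  exact ⟨W', hW', hxW', Subtype.ext (e.trans (res_zero M _).symm)⟩

/-- Used to identify `j_! (M|_V)` with `M_V`. -/
lemma isIso_cutLift {M N : Mod R} (S : Opens Y) (f : N ⟶ M)
    (hf : ∀ (W : Opens Y) (s : N.val.obj (op W)), ∀ x ∈ W, x ∉ S →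
      VanishesAt M (f.val.app (op W) s) x)
    (hinj : ∀ W : Opens Y, Function.Injective (f.val.app (op W)))
    (hsurj : ∀ (W : Opens Y) (t : M.val.obj (op W)), (∀ x ∈ W, x ∉ S → VanishesAt M t x) →
      ∃ s, f.val.app (op W) s = t) : IsIso (cutLift S f hf) := by
  refine isIso_of_bijective _ fun W ↦ ⟨fun s t e ↦ hinj W congr(($e).1), fun t ↦ ?_⟩
  obtain ⟨s, hs⟩ := hsurj W t.1 t.2
  exact ⟨s, Subtype.ext hs⟩

lemma isIso_cutι {M : Mod R} {S : Opens Y} (h : supp M ⊆ S) : IsIso (cutι M S) :=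
  isIso_of_bijective _ fun _ ↦ ⟨Subtype.val_injective, fun s ↦
    ⟨⟨s, fun _ hx hxS ↦ vanishesAt_of_notMem_supp (fun hh ↦ hxS (h hh)) hx s⟩, rfl⟩⟩

/-- The functor `M ↦ M_S`. -/
def cutFunctor (S : Opens Y) : Mod R ⥤ Mod R where
  obj M := cut M S
  map f := cutMap S f

end SheafHom

/-! ### Restriction, direct image and extension by zero: adjunctions and full faithfulness. -/

section Restriction

variable {X : TopCat.{u}} {R : Sheaf (Opens.grothendieckTopology X) RingCat.{u}}
  {V U : Opens X} (h : V ⟶ U)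

variable (R) in
/-- The adjunction between restriction and direct image. -/
def restrDirectAdj : restr R h ⊣ direct R h :=
  SheafOfModules.pushforwardPushforwardAdj (isOpenMap_incl h).adjunction (ringToRestr R h)
    (ringToDirect R h)
    (by
      refine NatTrans.ext (funext fun W ↦ ?_)
      exact R.obj.map_comp
        (homOfLE (by rintro _ ⟨y, hy, rfl⟩; exact ⟨incl h y, hy, rfl⟩) :
          V.isOpenEmbedding.functor.obj (preim h W.unop) ⟶
            U.isOpenEmbedding.functor.obj W.unop).op
        (homOfLE (by rintro _ ⟨_, ⟨y, hy, rfl⟩, rfl⟩; exact ⟨y, hy, rfl⟩) :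
          U.isOpenEmbedding.functor.obj (image h (preim h W.unop)) ⟶
            V.isOpenEmbedding.functor.obj (preim h W.unop)).op)
    (by
      refine NatTrans.ext (funext fun W ↦ ?_)
      refine Eq.trans (congrArg (fun g ↦ R.obj.map _ ≫ g) (R.obj.map_comp _ _).symm) ?_
      exact (R.obj.map_comp _ _).symm.trans (R.obj.map_id _))

lemma unit_eq (M : Mod (ringOn R V)) : (extZeroAdj R h).unit.app M = unit h M := by
  rw [extZeroAdj, Adjunction.mkOfHomEquiv_unit_app]
  change unit h M ≫ (restr R h).map (𝟙 _) = _
  rw [CategoryTheory.Functor.map_id, Category.comp_id]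

/-- Over subsets of `V` the vanishing condition that defines `j_! M` is void, so restricting `j_! M`
to `V` gives back `M`. This makes `j_!` fully faithful. -/
instance isIso_unit (M : Mod (ringOn R V)) : IsIso (unit h M) := by
  refine isIso_of_bijective _ fun W ↦ ⟨fun s t e ↦ ?_, fun t ↦ ?_⟩
  · have e1 := congrArg (res M (le_preim_image h (W := W)))
      (congrArg (sec h M (W := image h W)) e)
    refine (Eq.trans ?_ e1).trans ?_
    · exact ((res_res M _ _ _).trans (res_self M _ _)).symm
    · exact (res_res M _ _ _).trans (res_self M _ _)
  · refine ⟨res M (le_preim_image h (W := W)) (sec h M (W := image h W) t), ?_⟩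
    refine sec_injective h M ?_
    exact (res_res M _ _ _).trans (res_self M _ _)

instance isIso_extZeroAdj_unit : IsIso (extZeroAdj R h).unit := by
  have (M : Mod (ringOn R V)) : IsIso ((extZeroAdj R h).unit.app M) := by
    rw [unit_eq]
    exact isIso_unit h M
  exact NatIso.isIso_of_isIso_app _

/-- The functor `j_!` is fully faithful. -/
def extZeroFullyFaithful : (extZero R h).FullyFaithful :=
  (extZeroAdj R h).fullyFaithfulLOfIsIsoUnit

variable (M : Mod (ringOn R U))

/-- The counit `j_! (M|_V) → M`. -/
def counit : (extZero R h).obj ((restr R h).obj M) ⟶ M := (extZeroAdj R h).counit.app M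

lemma counit_extSec {W : Opens (sp V)} (s : ((restr R h).obj M).val.obj (op W)) :
    (counit h M).val.app (op (image h W))
      (extSec h ((restr R h).obj M) s) = ofRestr h M s := by
  have e := (extZeroAdj R h).right_triangle_components M
  rw [unit_eq] at e
  exact congr(($e).val.app (op W) s)

/-- Over subsets of `V` the counit is the identity on sections; this determines it, because sections
of `j_! (M|_V)` are determined there. -/
lemma res_counit {W : Opens (sp U)} (s : ((extZero R h).obj ((restr R h).obj M)).val.obj (op W)) :
    res M (image_preim h) ((counit h M).val.app (op W) s) =
      ofRestr h M (sec h _ s) := by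
  rw [← counit_extSec, extSec_sec, app_res]

lemma counit_injective (W : Opens (sp U)) :
    Function.Injective ((counit h M).val.app (op W)) := fun s t e ↦ by
  refine sec_injective h _ ?_
  exact (res_counit h M s).symm.trans ((congrArg _ e).trans (res_counit h M t))

lemma counit_vanishesAt (W : Opens (sp U))
    (s : ((extZero R h).obj ((restr R h).obj M)).val.obj (op W)) (x : sp U) (hx : x ∈ W)
    (hxV : x ∉ sub h) : VanishesAt M ((counit h M).val.app (op W) s) x := by
  obtain ⟨W', hW', hxW', e⟩ := isExt_sec h _ s x hx hxV
  have e' : res _ hW' s = 0 := sec_injective h _ e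
  exact ⟨W', hW', hxW', by rw [← app_res, e', map_zero]⟩

lemma exists_counit_eq (W : Opens (sp U)) (t : M.val.obj (op W))
    (ht : ∀ x ∈ W, x ∉ sub h → VanishesAt M t x) :
    ∃ s, (counit h M).val.app (op W) s = t := by
  -- The preimage of `t` is its restriction to `V ∩ W`. Near points of `W` outside `V` both `t` and
  -- this section vanish, so there is nothing else to compare.
  let s₀ : ((restr R h).obj M).val.obj (op (preim h W)) := toRestr h M (res M (image_preim h) t)
  refine ⟨mkSec h ((restr R h).obj M) (W := W) s₀ ?_, sec_ext _ _ _ fun x hx ↦ ?_⟩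
  · intro x hx hxV
    obtain ⟨W', hW', hxW', e⟩ := ht x hx hxV
    refine ⟨W', hW', hxW', ?_⟩
    refine (res_res M (W := image h (preim h W')) (W' := image h (preim h W))
      (image_mono h (preim_mono h hW')) (image_preim h) t).trans ?_
    refine (res_res M (image_preim h) hW' t).symm.trans ?_
    rw [e]
    exact res_zero M _
  · by_cases hxV : x ∈ sub h
    · exact ⟨_, image_preim h, mem_image_preim h hx hxV, res_counit h M _⟩
    · obtain ⟨W₁, hW₁, hx₁, e₁⟩ := ht x hx hxV
      obtain ⟨W₂, hW₂, hx₂, e₂⟩ := counit_vanishesAt h M W (mkSec h ((restr R h).obj M) (W := W) s₀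
        (by
          intro x hx hxV
          obtain ⟨W', hW', hxW', e⟩ := ht x hx hxV
          refine ⟨W', hW', hxW', ?_⟩
          refine (res_res M (W := image h (preim h W')) (W' := image h (preim h W))
            (image_mono h (preim_mono h hW')) (image_preim h) t).trans ?_
          refine (res_res M (image_preim h) hW' t).symm.trans ?_
          rw [e]
          exact res_zero M _)) x hx hxV
      refine ⟨W₁ ⊓ W₂, inf_le_left.trans hW₁, ⟨hx₁, hx₂⟩, ?_⟩
      rw [← res_res M inf_le_right hW₂, e₂, ← res_res M inf_le_left hW₁, e₁, res_zero, res_zero]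

/-- The functor `M ↦ M_V` is isomorphic to `M ↦ j_! (M|_V)`. -/
def restrExtZeroIso : restr R h ⋙ extZero R h ≅ cutFunctor (sub h) :=
  NatIso.ofComponents
    (fun M ↦ by
      have := isIso_cutLift (sub h) (counit h M) (counit_vanishesAt h M)
        (counit_injective h M) (exists_counit_eq h M)
      exact @asIso _ _ _ _ (cutLift (sub h) (counit h M) (counit_vanishesAt h M)) this)
    (fun {M N} f ↦ by
      refine (cancel_mono (cutι N (sub h))).1 ?_
      exact (extZeroAdj R h).counit.naturality f)

/-- Both `M ↦ M|_V` and `j_!` are left adjoints, hence so is `M ↦ M_V`. The point is that it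
commutes with colimits. -/
instance isLeftAdjoint_cutFunctor_sub : (cutFunctor (R := ringOn R U) (sub h)).IsLeftAdjoint :=
  ((restrDirectAdj R h).comp (extZeroAdj R h)).ofNatIsoLeft (restrExtZeroIso h) |>.isLeftAdjoint 

end Restriction

/-! ### Compact supports: finite colimits in `Mod_c` and the essential image of `j_!`. -/

section CompactSupport

variable {X : TopCat.{u}} {R : Sheaf (Opens.grothendieckTopology X) RingCat.{u}} {U : Opens X}

/-- Lets the results on inclusions of open subsets of `X` be applied to an arbitrary open set of the
space `sp U`. -/
lemma exists_sub_eq (W : Opens (sp U)) : ∃ (V : Opens X) (h : V ⟶ U), sub h = W := by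
  refine ⟨U.isOpenEmbedding.functor.obj W, homOfLE ?_, ?_⟩
  · rintro _ ⟨x, -, rfl⟩
    exact x.2
  · ext x
    refine ⟨?_, fun hx ↦ ⟨x, hx, rfl⟩⟩
    rintro ⟨y, hy, e⟩
    obtain rfl : y = x := Subtype.ext e
    exact hy

instance isLeftAdjoint_cutFunctor (W : Opens (sp U)) :
    (cutFunctor (R := ringOn R U) W).IsLeftAdjoint := by
  obtain ⟨V, h, rfl⟩ := exists_sub_eq W
  exact isLeftAdjoint_cutFunctor_sub h

/-- With `V` the complement of `K`, the unit `M → j_* (M|_V)` is killed by every `f j`, hence is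
zero, and so `M|_V = 0`. It serves for colimits in `Mod_c`, and again on the real line to see that
an inclusion is not an epimorphism. -/
lemma supp_subset_of_jointly_epi {M : Mod (ringOn R U)} {J : Type*} {D : J → Mod (ringOn R U)}
    (f : ∀ j, D j ⟶ M)
    (hf : ∀ {N : Mod (ringOn R U)} (g g' : M ⟶ N), (∀ j, f j ≫ g = f j ≫ g') → g = g')
    {K : Set (sp U)} (hK : IsClosed K) (hD : ∀ j, supp (D j) ⊆ K) : supp M ⊆ K := by
  obtain ⟨V, h, hV⟩ := exists_sub_eq (U := U) ⟨Kᶜ, hK.isOpen_compl⟩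
  let η : M ⟶ (direct R h).obj ((restr R h).obj M) := (restrDirectAdj R h).unit.app M
  have hη : η = 0 := by
    refine hf _ _ fun j ↦ hom_ext fun W s ↦ ?_
    change res M (image_preim h (W := W)) ((f j).val.app (op W) s) = 0
    rw [← app_res, eq_zero_of_disjoint_supp (D j) (W := image h (preim h W)) ?_ (res _ _ _), map_zero]
    refine Set.disjoint_left.2 fun x hx hxD ↦ ?_
    have : x ∈ sub h := mem_of_mem_image h hx
    rw [hV] at this
    exact this (hD j hxD)
  refine supp_subset hK fun W hW s ↦ sec_ext _ _ _ fun x hx ↦ ?_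
  have hxV : x ∈ sub h := by
    rw [hV]
    exact Set.disjoint_left.1 hW hx
  refine ⟨image h (preim h W), image_preim h, mem_image_preim h hx hxV, ?_⟩
  rw [res_zero]
  exact congr(($hη).val.app (op W) s)

lemma supp_restr_subset {V : Opens X} (h : V ⟶ U) (M : Mod (ringOn R U)) :
    supp ((restr R h).obj M) ⊆ incl h ⁻¹' supp M := by
  refine supp_subset ((isClosed_supp M).preimage (incl h).hom.continuous) fun W hW s ↦ ?_
  refine eq_zero_of_disjoint_supp M (W := image h W) ?_ s
  refine Set.disjoint_left.2 ?_
  rintro _ ⟨x, hx, rfl⟩ hxM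
  exact Set.disjoint_left.1 hW hx hxM

lemma isIso_counit {V : Opens X} (h : V ⟶ U) {M : Mod (ringOn R U)} (hV : supp M ⊆ sub h) : IsIso (counit h M) :=
  isIso_of_bijective _ fun W ↦ ⟨counit_injective h M W, fun t ↦ exists_counit_eq h M W t
    fun _ hx hxV ↦ vanishesAt_of_notMem_supp (fun hh ↦ hxV (hV hh)) hx t⟩

lemma restr_hasCompactSupport {V : Opens X} (h : V ⟶ U) {M : Mod (ringOn R U)} (hM : HasCompactSupport M)
    (hV : supp M ⊆ sub h) : HasCompactSupport ((restr R h).obj M) := by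
  refine hasCompactSupport_of_subset ?_ (supp_restr_subset h M)
  refine (isOpenEmbedding_incl h).isInducing.isCompact_preimage' hM ?_
  exact fun x hx ↦ ⟨⟨x.1, hV hx⟩, rfl⟩

/-- The functor `M ↦ M_W` on sheaves of modules with compact support. -/
def cutc (W : Opens (sp U)) : Modc (ringOn R U) ⥤ Modc (ringOn R U) :=
  ObjectProperty.lift _ (ObjectProperty.ι _ ⋙ cutFunctor W) fun M ↦
    hasCompactSupport_of_subset M.2
      ((supp_cut_subset M.obj W).trans Set.inter_subset_right)

/-- The inclusion `M_W → M`. -/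
def cutcι (W : Opens (sp U)) : cutc (R := R) W ⟶ 𝟭 _ where
  app M := ObjectProperty.homMk (cutι M.obj W)

/-- The inclusion `M_W → M_W'` for `W ≤ W'`. -/
def cutcLE {W W' : Opens (sp U)} (hW : W ≤ W') : cutc (R := R) W ⟶ cutc W' where
  app M := ObjectProperty.homMk (cutLE M.obj hW)

lemma isIso_cutcι {W : Opens (sp U)} {M : Modc (ringOn R U)} (h : supp M.obj ⊆ W) :
    IsIso ((cutcι W).app M) := by
  have : IsIso ((ObjectProperty.ι _).map ((cutcι W).app M)) := isIso_cutι h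
  exact isIso_of_reflects_iso ((cutcι W).app M) (ObjectProperty.ι _)

lemma isIso_cutcLE {W W' : Opens (sp U)} (hW : W ≤ W') {M : Modc (ringOn R U)}
    (h : supp M.obj ∩ W' ⊆ W) : IsIso ((cutcLE hW).app M) := by
  have : IsIso (cutLE M.obj hW) := isIso_of_bijective _ fun T ↦
    ⟨fun s t e ↦ Subtype.ext congr(($e).1), fun s ↦ ⟨⟨s.1, fun x hx hxW ↦ ?_⟩, rfl⟩⟩
  · have : IsIso ((ObjectProperty.ι _).map ((cutcLE hW).app M)) := this
    exact isIso_of_reflects_iso ((cutcLE hW).app M) (ObjectProperty.ι _)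
  · by_cases hxW' : x ∈ W'
    · exact vanishesAt_of_notMem_supp (fun hh ↦ hxW (h ⟨hh, hxW'⟩)) hx _
    · exact s.2 x hx hxW'

variable [T2Space X]

instance : T2Space (sp U) := inferInstanceAs (T2Space U)

/-- The support of a finite colimit lies in the union of the supports of the terms, a finite union
of compact sets. -/
instance isClosedUnderColimits_hasCompactSupport (J : Type) [SmallCategory J] [FinCategory J] :
    (HasCompactSupport (R := ringOn R U)).IsClosedUnderColimitsOfShape J where
  colimitsOfShape_le M := by
    rintro ⟨p⟩
    have hK : IsCompact (⋃ j, supp (p.diag.obj j)) := isCompact_iUnion fun j ↦ p.prop_diag_obj j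
    refine hasCompactSupport_of_subset hK (supp_subset_of_jointly_epi p.ι.app ?_ hK.isClosed
      (Set.subset_iUnion fun j ↦ supp (p.diag.obj j)))
    exact fun g g' e ↦ p.isColimit.hom_ext e

instance : HasFiniteColimits (Modc (ringOn R U)) where
  out _ _ _ := inferInstance

instance : PreservesFiniteColimits (ObjectProperty.ι (HasCompactSupport (R := ringOn R U))) where
  preservesFiniteColimits _ _ _ :=
    preservesColimitOfShape_of_createsColimitsOfShape_and_hasColimitsOfShape _

/-- Inherited from `cutFunctor W`, a left adjoint, because the inclusion of `Mod_c` preserves and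
reflects finite colimits. -/
instance (W : Opens (sp U)) : PreservesFiniteColimits (cutc (R := R) W) where
  preservesFiniteColimits J _ _ := by
    have : PreservesColimitsOfShape J (cutc W ⋙ ObjectProperty.ι (HasCompactSupport (R := ringOn R U))) :=
      inferInstanceAs (PreservesColimitsOfShape J
        (ObjectProperty.ι (HasCompactSupport (R := ringOn R U)) ⋙ cutFunctor W))
    exact preservesColimitsOfShape_of_reflects_of_preserves (cutc W)
      (ObjectProperty.ι (HasCompactSupport (R := ringOn R U)))

variable {V : Opens X} (h : V ⟶ U)

variable (R) in
/-- The functor `j_!` on sheaves of modules with compact support is fully faithful. -/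
def extZerocFullyFaithful : (extZeroc R h).FullyFaithful :=
  ((ObjectProperty.fullyFaithfulι _).comp (extZeroFullyFaithful (R := R) h)).ofCompFaithful
    (G := ObjectProperty.ι _)

instance : (extZeroc R h).Full := (extZerocFullyFaithful R h).full

instance : (extZeroc R h).Faithful := (extZerocFullyFaithful R h).faithful

/-- Compactness matters here: the image of `supp M` is compact, hence closed in `U`, so no support
is added on the boundary of `V`. -/
lemma supp_extZero_subset {M : Mod (ringOn R V)} (hM : HasCompactSupport M) :
    supp ((extZero R h).obj M) ⊆ sub h := by
  have hK : IsCompact (incl h '' supp M) := IsCompact.image hM (incl h).hom.continuous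
  refine (supp_subset hK.isClosed fun W hW s ↦ ?_ : _ ⊆ incl h '' supp M).trans ?_
  · refine sec_ext _ _ _ fun x hx ↦ ?_
    obtain ⟨W', hW', hxW', e⟩ := extZero_vanishesAt h s hx fun hh ↦ Set.disjoint_left.1 hW hx hh
    exact ⟨W', hW', hxW', e.trans (res_zero _ _).symm⟩
  · rintro _ ⟨x, -, rfl⟩
    exact x.2

/-- If `supp M` lies in `V`, the counit `j_! (M|_V) → M` is an isomorphism and `M|_V` again has
compact support. Through this equivalence, ind-sheaves on `V` become presheaves on the sheaves over
`U` supported in `V`. -/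
lemma essImage_extZeroc (M : Modc (ringOn R U)) :
    (extZeroc R h).essImage M ↔ supp M.obj ⊆ sub h := by
  refine ⟨?_, fun hM ↦ ?_⟩
  · rintro ⟨N, ⟨e⟩⟩
    have := supp_eq_of_iso ((ObjectProperty.ι _).mapIso e)
    exact this.symm.subset.trans (supp_extZero_subset h N.2)
  · have := isIso_counit h hM
    exact ⟨⟨_, restr_hasCompactSupport h M.2 hM⟩,
      ⟨(ObjectProperty.fullyFaithfulι _).preimageIso (@asIso _ _ _ _ (counit h M.obj) this)⟩⟩

end CompactSupport

/-! ### Gluing morphisms `M_{W k} → N` along a covering of the support of `M`. -/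

section Glue

variable {Y : TopCat.{u}} {R : Sheaf (Opens.grothendieckTopology Y) RingCat.{u}}
  {M N : Mod R} {κ : Type*} {W : κ → Opens Y}

/-- A section of `M` over an open subset of `S`, as a section of `M_S`. -/
def cutMk (M : Mod R) {S T : Opens Y} (h : T ≤ S) (s : M.val.obj (op T)) :
    (cut M S).val.obj (op T) := ⟨s, fun _ hx hxS ↦ (hxS (h hx)).elim⟩

/-- The two cases match the two clauses of `IsGlued`: locally a section either lives on some `W k`
or vanishes. -/
lemma exists_mem_or_exists_res_eq_zero (hW : supp M ⊆ ⋃ k, (W k : Set Y)) {T : Opens Y}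
    (s : M.val.obj (op T)) {x : Y} (hx : x ∈ T) :
    (∃ k, x ∈ W k) ∨ ∃ (T' : Opens Y) (h : T' ≤ T), x ∈ T' ∧ res M h s = 0 := by
  by_cases hxM : x ∈ supp M
  · exact Or.inl (Set.mem_iUnion.1 (hW hxM))
  · exact Or.inr (vanishesAt_of_notMem_supp hxM hx s)

lemma hom_ext_of_cut (hW : supp M ⊆ ⋃ k, (W k : Set Y)) {f g : M ⟶ N}
    (h : ∀ k, cutι M (W k) ≫ f = cutι M (W k) ≫ g) : f = g := by
  refine hom_ext fun T s ↦ sec_ext _ _ _ fun x hx ↦ ?_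
  obtain ⟨k, hk⟩ | ⟨T', hT', hxT', e⟩ := exists_mem_or_exists_res_eq_zero hW s hx
  · refine ⟨T ⊓ W k, inf_le_left, ⟨hx, hk⟩, ?_⟩
    rw [← app_res, ← app_res]
    exact congr(($(h k)).val.app (op (T ⊓ W k)) (cutMk M inf_le_right (res M inf_le_left s)))
  · exact ⟨T', hT', hxT', by rw [← app_res, ← app_res, e, map_zero, map_zero]⟩

/-- The condition characterizing the image of a section of `M` under the morphism obtained by
gluing morphisms `M_{W k} → N`. -/
structure IsGlued (f : ∀ k, cut M (W k) ⟶ N) {T : Opens Y} (s : M.val.obj (op T))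
    (t : N.val.obj (op T)) : Prop where
  res_eq : ∀ (k : κ) (T' : Opens Y) (hT : T' ≤ T) (hk : T' ≤ W k),
    res N hT t = (f k).val.app (op T') (cutMk M hk (res M hT s))
  res_eq_zero : ∀ (T' : Opens Y) (hT : T' ≤ T), res M hT s = 0 → res N hT t = 0

namespace IsGlued

variable {f : ∀ k, cut M (W k) ⟶ N} {T : Opens Y}

lemma unique (hW : supp M ⊆ ⋃ k, (W k : Set Y)) {s : M.val.obj (op T)} {t t' : N.val.obj (op T)}
    (h : IsGlued f s t) (h' : IsGlued f s t') : t = t' := by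
  refine sec_ext _ _ _ fun x hx ↦ ?_
  obtain ⟨k, hk⟩ | ⟨T', hT', hxT', e⟩ := exists_mem_or_exists_res_eq_zero hW s hx
  · exact ⟨T ⊓ W k, inf_le_left, ⟨hx, hk⟩, by
      rw [h.res_eq k _ _ inf_le_right, h'.res_eq k _ _ inf_le_right]⟩
  · exact ⟨T', hT', hxT', by rw [h.res_eq_zero _ _ e, h'.res_eq_zero _ _ e]⟩

lemma restrict {s : M.val.obj (op T)} {t : N.val.obj (op T)} (h : IsGlued f s t) {T' : Opens Y}
    (hT : T' ≤ T) : IsGlued f (res M hT s) (res N hT t) where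
  res_eq k T'' hT' hk := by
    rw [res_res, h.res_eq k _ _ hk, res_res]
  res_eq_zero T'' hT' e := by
    rw [res_res] at e ⊢
    exact h.res_eq_zero _ _ e

/-- Both clauses are equalities between sections of the sheaf `N`, hence can be checked locally.
This reduces existence of the glued section to small open sets. -/
lemma of_locally {s : M.val.obj (op T)} {t : N.val.obj (op T)}
    (h : ∀ x ∈ T, ∃ (T' : Opens Y) (hT : T' ≤ T), x ∈ T' ∧ IsGlued f (res M hT s) (res N hT t)) :
    IsGlued f s t where
  res_eq k T' hT hk := by
    refine sec_ext _ _ _ fun x hx ↦ ?_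
    obtain ⟨T₁, hT₁, hx₁, h₁⟩ := h x (hT hx)
    refine ⟨T' ⊓ T₁, inf_le_left, ⟨hx, hx₁⟩, ?_⟩
    have := h₁.res_eq k (T' ⊓ T₁) inf_le_right (inf_le_left.trans hk)
    rw [res_res] at this
    rw [res_res, this, ← app_res]
    congr 1
    exact Subtype.ext ((res_res M _ _ _).trans (res_res M _ _ _).symm)
  res_eq_zero T' hT e := by
    refine sec_ext _ _ _ fun x hx ↦ ?_
    obtain ⟨T₁, hT₁, hx₁, h₁⟩ := h x (hT hx)
    refine ⟨T' ⊓ T₁, inf_le_left, ⟨hx, hx₁⟩, ?_⟩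
    have := h₁.res_eq_zero (T' ⊓ T₁) inf_le_right
      (by rw [res_res, ← res_res M inf_le_left hT, e, res_zero])
    rw [res_res] at this
    rw [res_res, this, res_zero]

lemma exists_locally (hW : supp M ⊆ ⋃ k, (W k : Set Y))
    (hf : ∀ k l, cutLE M (inf_le_left : W k ⊓ W l ≤ W k) ≫ f k = cutLE M inf_le_right ≫ f l)
    (s : M.val.obj (op T)) {x : Y} (hx : x ∈ T) :
    ∃ (T' : Opens Y) (hT : T' ≤ T) (t : N.val.obj (op T')), x ∈ T' ∧ IsGlued f (res M hT s) t := by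
  obtain ⟨k, hk⟩ | ⟨T', hT', hxT', e⟩ := exists_mem_or_exists_res_eq_zero hW s hx
  · refine ⟨T ⊓ W k, inf_le_left,
      (f k).val.app (op (T ⊓ W k)) (cutMk M inf_le_right (res M inf_le_left s)), ⟨hx, hk⟩,
      fun l T' hT hl ↦ ?_, fun T' hT e ↦ ?_⟩
    · rw [← app_res]
      exact congr(($(hf k l)).val.app (op T')
        (cutMk M (le_inf (hT.trans inf_le_right) hl) (res M hT (res M inf_le_left s))))
    · rw [← app_res]
      have : res (cut M (W k)) hT
        (cutMk M (inf_le_right : T ⊓ W k ≤ _) (res M inf_le_left s)) = 0 := Subtype.ext e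
      rw [this, map_zero]
  · refine ⟨T', hT', 0, hxT', fun k T'' hT hk ↦ ?_, fun T'' hT _ ↦ res_zero N _⟩
    have : cutMk M hk (res M hT (res M hT' s)) = 0 := Subtype.ext (by
      rw [e]
      exact res_zero M hT)
    rw [this, map_zero, res_zero]

/-- The local solutions agree on overlaps by `unique`, so the sheaf property of `N` glues them. -/
lemma exists_of_compatible (hW : supp M ⊆ ⋃ k, (W k : Set Y))
    (hf : ∀ k l, cutLE M (inf_le_left : W k ⊓ W l ≤ W k) ≫ f k = cutLE M inf_le_right ≫ f l)
    (s : M.val.obj (op T)) : ∃ t, IsGlued f s t := by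
  choose T' hT t hx ht using fun x : T ↦ exists_locally hW hf s x.2
  obtain ⟨t', ht'⟩ := sec_glue N T' T hT (fun x hxT ↦ ⟨⟨x, hxT⟩, hx _⟩) t fun x y ↦ by
    have h₁ := (ht x).restrict (inf_le_left : T' x ⊓ T' y ≤ _)
    have h₂ := (ht y).restrict (inf_le_right : T' x ⊓ T' y ≤ _)
    rw [res_res] at h₁ h₂
    exact h₁.unique hW h₂
  exact ⟨t', of_locally fun x hxT ↦ ⟨T' ⟨x, hxT⟩, hT _, hx _, by
    rw [ht']
    exact ht _⟩⟩

lemma add {s s' : M.val.obj (op T)} {t t' : N.val.obj (op T)}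
    (hW : supp M ⊆ ⋃ k, (W k : Set Y)) (h : IsGlued f s t) (h' : IsGlued f s' t')
    {t'' : N.val.obj (op T)} (h'' : IsGlued f (s + s') t'') : t'' = t + t' := by
  refine sec_ext _ _ _ fun x hx ↦ ?_
  obtain ⟨k, hk⟩ | ⟨T₁, hT₁, hx₁, e₁⟩ := exists_mem_or_exists_res_eq_zero hW s hx
  · refine ⟨T ⊓ W k, inf_le_left, ⟨hx, hk⟩, ?_⟩
    rw [res_add, h.res_eq k _ _ inf_le_right, h'.res_eq k _ _ inf_le_right,
      h''.res_eq k _ _ inf_le_right, ← map_add]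
    congr 1
    exact Subtype.ext (res_add M _ _ _)
  · refine ⟨T₁, hT₁, hx₁, ?_⟩
    have h₁ := h''.restrict hT₁
    have h₂ := h'.restrict hT₁
    rw [res_add, e₁, zero_add] at h₁
    rw [res_add, h.res_eq_zero _ _ e₁, zero_add]
    exact h₁.unique hW h₂

lemma smul {s : M.val.obj (op T)} {t : N.val.obj (op T)} (a : R.obj.obj (op T))
    (hW : supp M ⊆ ⋃ k, (W k : Set Y)) (h : IsGlued f s t)
    {t' : N.val.obj (op T)} (h' : IsGlued f (a • s) t') : t' = a • t := by
  refine sec_ext _ _ _ fun x hx ↦ ?_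
  obtain ⟨k, hk⟩ | ⟨T₁, hT₁, hx₁, e₁⟩ := exists_mem_or_exists_res_eq_zero hW s hx
  · refine ⟨T ⊓ W k, inf_le_left, ⟨hx, hk⟩, ?_⟩
    rw [res_smul, h.res_eq k _ _ inf_le_right, h'.res_eq k _ _ inf_le_right, ← map_smul]
    congr 1
    exact Subtype.ext (res_smul M _ _ _)
  · refine ⟨T₁, hT₁, hx₁, ?_⟩
    rw [res_smul, h.res_eq_zero _ _ e₁, smul_zero,
      h'.res_eq_zero _ _ (by rw [res_smul, e₁, smul_zero])]

end IsGlued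

/-- Compatible morphisms `M_{W k} → N` glue to a morphism `M → N` if the `W k` cover the
support of `M`. -/
lemma exists_hom_of_cut (hW : supp M ⊆ ⋃ k, (W k : Set Y)) (f : ∀ k, cut M (W k) ⟶ N)
    (hf : ∀ k l, cutLE M (inf_le_left : W k ⊓ W l ≤ W k) ≫ f k = cutLE M inf_le_right ≫ f l) :
    ∃ g : M ⟶ N, ∀ k, cutι M (W k) ≫ g = f k := by
  -- Since the image is unique, the choice is automatically additive, linear and compatible with
  -- restriction.
  choose t ht using fun (T : Opens Y) (s : M.val.obj (op T)) ↦
    IsGlued.exists_of_compatible hW hf s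
  let g : M ⟶ N :=
    { val :=
        { app T := ModuleCat.ofHom
            { toFun s := t T.unop s
              map_add' s s' := (ht _ s).add hW (ht _ s') (ht _ _)
              map_smul' a s := (ht _ s).smul a hW (ht _ _) }
          naturality {T T'} i := by
            ext s
            exact (ht _ _).unique hW ((ht _ s).restrict (leOfHom i.unop)) } }
  refine ⟨g, fun k ↦ hom_ext fun T s ↦ sec_ext _ _ _ fun x hx ↦ ?_⟩
  by_cases hk : x ∈ W k
  · refine ⟨T ⊓ W k, inf_le_left, ⟨hx, hk⟩, ?_⟩
    rw [← app_res (f k)]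
    exact (ht T s.1).res_eq k _ _ inf_le_right
  · obtain ⟨T', hT', hxT', e⟩ := s.2 x hx hk
    have e' : res (cut M (W k)) hT' s = 0 := Subtype.ext e
    exact ⟨T', hT', hxT', by rw [← app_res, ← app_res, e', map_zero, map_zero]⟩

end Glue

/-! ### Smallness of the family of quotients of a sheaf. -/

section Quotients

variable {X : TopCat.{u}} {R : Sheaf (Opens.grothendieckTopology X) RingCat.{u}} {U : Opens X}

/-- In the abelian category of sheaves of modules an epimorphism is the cokernel of its kernel, and
vanishing on the kernel is tested on sections. -/
lemma exists_desc_of_epi {B Q Q' : Mod (ringOn R U)} (p : B ⟶ Q) [Epi p] (p' : B ⟶ Q')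
    (h : ∀ (W : Opens (sp U)) (s : B.val.obj (op W)),
      p.val.app (op W) s = 0 → p'.val.app (op W) s = 0) : ∃ d : Q ⟶ Q', p ≫ d = p' := by
  refine ⟨Abelian.epiDesc p p' (hom_ext fun W s ↦ ?_), Abelian.comp_epiDesc _ _ _⟩
  refine h W _ ?_
  exact congr(($(kernel.condition p)).val.app (op W) s)

/-- The quotients of a given sheaf of modules with compact support form an essentially small
family. -/
lemma exists_small_quotients [T2Space X] (B : Modc (ringOn R U)) :
    ∃ (ι : Type u) (Q : ι → Modc (ringOn R U)) (π : ∀ i, B ⟶ Q i),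
      ∀ (Q' : Modc (ringOn R U)) (p : B ⟶ Q') [Epi p], ∃ (i : ι) (e : Q i ≅ Q'),
        π i ≫ e.hom = p := by
  let ker {Q : Modc (ringOn R U)} (p : B ⟶ Q) (W : Opens (sp U)) : Set (B.obj.val.obj (op W)) :=
    {s | p.hom.val.app (op W) s = 0}
  -- A quotient is recorded by the sections that it kills, and families of sets of sections of `B`
  -- form a type in universe `u`.
  let ι := {K : ∀ W : Opens (sp U), Set (B.obj.val.obj (op W)) //
    ∃ (Q : Modc (ringOn R U)) (p : B ⟶ Q), Epi p ∧ ker p = K}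
  choose Q π hπ hker using fun i : ι ↦ i.2
  refine ⟨ι, Q, π, fun Q' p hp ↦ ?_⟩
  let i : ι := ⟨ker p, Q', p, hp, rfl⟩
  -- An epimorphism of `Mod_c` remains one in `Mod`, because the inclusion preserves finite
  -- colimits.
  have h₁ : Epi p.hom := inferInstanceAs (Epi ((ObjectProperty.ι _).map p))
  have h₂ : Epi (π i).hom := by
    have := hπ i
    exact inferInstanceAs (Epi ((ObjectProperty.ι _).map (π i)))
  have h (W : Opens (sp U)) (s : B.obj.val.obj (op W)) :
      p.hom.val.app (op W) s = 0 ↔ (π i).hom.val.app (op W) s = 0 :=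
    Set.ext_iff.1 (congrFun (hker i).symm W) s
  obtain ⟨d, hd⟩ := exists_desc_of_epi p.hom (π i).hom fun W s ↦ (h W s).1
  obtain ⟨d', hd'⟩ := exists_desc_of_epi (π i).hom p.hom fun W s ↦ (h W s).2
  refine ⟨i, ⟨ObjectProperty.homMk d', ObjectProperty.homMk d, ?_, ?_⟩, ?_⟩
  · refine ObjectProperty.hom_ext _ ((cancel_epi (π i).hom).1 ?_)
    exact (by rw [reassoc_of% hd', hd, Category.comp_id] : (π i).hom ≫ d' ≫ d = (π i).hom ≫ 𝟙 _)
  · refine ObjectProperty.hom_ext _ ((cancel_epi p.hom).1 ?_)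
    exact (by rw [reassoc_of% hd, hd', Category.comp_id] : p.hom ≫ d ≫ d' = p.hom ≫ 𝟙 _)
  · exact ObjectProperty.hom_ext _ hd'

end Quotients

/-! ### Left exactness of ind-objects, and a smallness criterion for being one. -/

section IndObjects

lemma map_map {C : Type*} [Category* C] (F : Cᵒᵖ ⥤ Type v') {A B D : C} (f : A ⟶ B) (g : B ⟶ D)
    (x : F.obj (op D)) : F.map f.op (F.map g.op x) = F.map (f ≫ g).op x :=
  congr($(F.map_comp g.op f.op) x).symm

lemma map_id_apply {C : Type*} [Category* C] (F : Cᵒᵖ ⥤ Type v') {A : C}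
    (x : F.obj (op A)) : F.map (𝟙 A).op x = x :=
  congr($(F.map_id _) x)

/-- The left exactness of a presheaf which preserves limits of a given shape, in terms of elements. -/
lemma existsUnique_of_isColimit {C : Type*} [Category* C] {J : Type*} [Category* J]
    (F : Cᵒᵖ ⥤ Type v') {K : J ⥤ C} [PreservesLimit K.op F] {c : Cocone K} (hc : IsColimit c)
    (s : ∀ j, F.obj (op (K.obj j)))
    (hs : ∀ {j j' : J} (a : j ⟶ j'), F.map (K.map a).op (s j') = s j) :
    ∃! x : F.obj (op c.pt), ∀ j, F.map (c.ι.app j).op x = s j := by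
  obtain ⟨x, hx, hx'⟩ := (Types.isLimit_iff _).1 ⟨isLimitOfPreserves F hc.op⟩ (fun j ↦ s j.unop)
    (fun {j j'} a ↦ hs a.unop)
  exact ⟨x, fun j ↦ hx (op j), fun y hy ↦ hx' y fun j ↦ hy j.unop⟩

/-- This is the functor `H ↦ colim_i Hom(H, D i)`: each `Hom(-, D i)` preserves limits, and filtered
colimits of sets commute with finite limits. -/
instance preservesFiniteLimits_flip_comp_colim {C : Type*} [Category.{v} C] {I : Type v}
    [SmallCategory I] [IsFiltered I] (D : I ⥤ C) :
    PreservesFiniteLimits ((D ⋙ yoneda).flip ⋙ colim) := by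
  have : PreservesFiniteLimits ((D ⋙ yoneda).flip) := ⟨fun J _ _ ↦
    preservesLimitsOfShape_of_evaluation _ _ fun i ↦
      inferInstanceAs (PreservesLimitsOfShape J (yoneda.obj (D.obj i)))⟩
  exact comp_preservesFiniteLimits _ _

lemma preservesFiniteLimits_of_isIndObject {C : Type*} [Category.{v} C] {F : Cᵒᵖ ⥤ Type v}
    (hF : IsIndObject F) : PreservesFiniteLimits F := by
  obtain ⟨⟨P⟩⟩ := hF
  exact preservesFiniteLimits_of_natIso ((colimitIsoFlipCompColim _).symm ≪≫
    (colimit.isColimit (P.F ⋙ yoneda)).coconePointUniqueUpToIso P.coconeIsColimit)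

/-- An ind-object has a small weakly terminal family of elements. -/
lemma exists_small_weakly_terminal {C : Type*} [Category.{v} C] {F : Cᵒᵖ ⥤ Type v}
    (hF : IsIndObject F) : ∃ (κ : Type v) (A : κ → C) (a : ∀ k, F.obj (op (A k))),
      ∀ (H : C) (p : F.obj (op H)), ∃ (k : κ) (g : H ⟶ A k), F.map g.op (a k) = p := by
  obtain ⟨⟨P⟩⟩ := hF
  -- The family consists of the objects `F_i` of a presentation, with the classes of their
  -- identities.
  refine ⟨P.I, P.F.obj, fun i ↦ (P.ι.app i).app _ (𝟙 _), fun H p ↦ ?_⟩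
  obtain ⟨i, g, hg⟩ := Types.jointly_surjective_of_isColimit
    (isColimitOfPreserves ((evaluation _ _).obj (op H)) P.coconeIsColimit) p
  refine ⟨i, g, Eq.trans ?_ hg⟩
  refine (congr($((P.ι.app i).naturality g.op) (𝟙 _)) : _).symm.trans ?_
  exact congrArg ((P.ι.app i).app (op H)) (Category.comp_id g)

/-- A presheaf which preserves finite limits is an ind-object if its elements are covered by
elements of a small family, and if quotients are small. -/
lemma isIndObject_of_small {C : Type*} [Category.{v} C] [HasFiniteColimits C] {F : Cᵒᵖ ⥤ Type v}
    [PreservesFiniteLimits F]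
    (hC : ∀ B : C, ∃ (ι : Type v) (Q : ι → C) (π : ∀ i, B ⟶ Q i),
      ∀ (Q' : C) (p : B ⟶ Q') [Epi p], ∃ (i : ι) (e : Q i ≅ Q'), π i ≫ e.hom = p)
    {κ : Type v} (A : κ → C) (a : ∀ k, F.obj (op (A k)))
    (hF : ∀ (H : C) (p : F.obj (op H)), ∃ (n : ℕ) (Z : Fin n → C) (z : ∀ j, Z j ⟶ H),
      (∀ (N : C) (g g' : H ⟶ N), (∀ j, z j ≫ g = z j ≫ g') → g = g') ∧
        ∀ j, ∃ (k : κ) (g : Z j ⟶ A k), F.map g.op (a k) = F.map (z j).op p) :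
    IsIndObject F := by
  -- Left exactness makes the category of elements filtered; what remains is a small weakly terminal
  -- family in it.
  have : IsFiltered (CostructuredArrow yoneda F) :=
    isFiltered_costructuredArrow_yoneda_of_preservesFiniteLimits F
  choose ι Q π hπ using hC
  let B {n : ℕ} (g : Fin n → κ) : C := ∐ fun j ↦ A (g j)
  -- The candidates are elements of `F` on the listed quotients of finite sums of the `A k`; they
  -- form a small family.
  let T : (Σ (n : ℕ) (g : Fin n → κ) (i : ι (B g)), F.obj (op (Q (B g) i))) →
      CostructuredArrow yoneda F := fun t ↦ CostructuredArrow.mk (yonedaEquiv.symm t.2.2.2)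
  have : FinallySmall.{v} (CostructuredArrow yoneda F) := by
    refine finallySmall_of_small_weakly_terminal_set (Set.range T) fun x ↦ ?_
    let H : C := x.left
    let p : F.obj (op H) := yonedaEquiv x.hom
    obtain ⟨n, Z, z, hz, h⟩ := hF H p
    choose k g hg using h
    -- The sum `∐ Z` maps epimorphically to `H` by `z'`, and by `m` to the finite sum `B k` of
    -- members of the family.
    let z' : ∐ Z ⟶ H := Sigma.desc z
    let m : ∐ Z ⟶ B k := Sigma.desc fun j ↦ g j ≫ Sigma.ι (fun j ↦ A (k j)) j
    have : Epi z' := ⟨fun a b e ↦ hz _ a b fun j ↦ by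
      simpa [z'] using congr(Sigma.ι Z j ≫ $e)⟩
    obtain ⟨b, hb, -⟩ := existsUnique_of_isColimit F (coproductIsCoproduct fun j ↦ A (k j))
      (fun j ↦ a (k j.as)) (by
        rintro ⟨j⟩ ⟨j'⟩ ⟨⟨e⟩⟩
        obtain rfl : j = j' := e
        exact congr($(F.map_id _) _))
    -- As `F` turns the finite sum `∐ Z` into a product, it is enough to compare `b` and `p` on each
    -- `Z j`, where both give the restriction of `p`.
    have hzm : F.map m.op b = F.map z'.op p := by
      obtain ⟨y, -, hy⟩ := existsUnique_of_isColimit F (coproductIsCoproduct Z)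
        (fun j ↦ F.map (z j.as).op p) (by
          rintro ⟨j⟩ ⟨j'⟩ ⟨⟨e⟩⟩
          obtain rfl : j = j' := e
          exact congr($(F.map_id _) _))
      refine (hy _ ?_).trans (hy _ ?_).symm
      · rintro ⟨j⟩
        refine Eq.trans ?_ (hg j)
        rw [← hb ⟨j⟩]
        simp only [map_map]
        congr 3
        simp [m]
      · rintro ⟨j⟩
        simp only [map_map]
        congr 3
        simp [z']
    -- Since `p` and `b` agree on `∐ Z`, left exactness gives an element `q` on the pushout that
    -- restricts to both.
    obtain ⟨q, hq, -⟩ := existsUnique_of_isColimit F (pushoutIsPushout z' m)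
      (fun j ↦ match j with
        | none => F.map z'.op p
        | some WalkingPair.left => p
        | some WalkingPair.right => b) (by
        rintro _ _ (_ | _ | _)
        · exact congr($(F.map_id _) _)
        · rfl
        · exact hzm)
    have hq₁ : F.map (pushout.inl z' m).op q = p := hq WalkingSpan.left
    -- The map `B k → pushout` is a pushout of the epimorphism `z'`, so the pushout is isomorphic to
    -- one of the listed quotients of `B k`.
    obtain ⟨i, e, he⟩ := hπ (B k) _ (pushout.inr z' m)
    refine ⟨_, ⟨⟨n, k, i, F.map e.hom.op q⟩, rfl⟩,
      ⟨CostructuredArrow.homMk (pushout.inl z' m ≫ e.inv) ?_⟩⟩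
    apply yonedaEquiv.injective
    refine Eq.trans ?_ hq₁
    refine (yonedaEquiv_naturality (yonedaEquiv.symm (F.map e.hom.op q)) _).symm.trans ?_
    rw [Equiv.apply_symm_apply]
    refine (map_map F _ _ q).trans ?_
    exact congrArg (fun g : H ⟶ pushout z' m ↦ F.map g.op q)
      (by simp : (pushout.inl z' m ≫ e.inv) ≫ e.hom = pushout.inl z' m)
  exact isIndObject_of_isFiltered_of_finallySmall F

end IndObjects

/-! ### Calculus of elements of an ind-object, with finitely many elements or equations treated at
one common stage. -/

section Presentation

variable {C : Type*} [Category.{v} C] {F : Cᵒᵖ ⥤ Type v} (P : IndObjectPresentation F)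

/-- The element of `F(H)` given by a morphism `H → F_i`, for `F = indlim F_i`. -/
def indElem {i : P.I} {H : C} (f : H ⟶ P.F.obj i) : F.obj (op H) := (P.ι.app i).app (op H) f

lemma map_indElem {i : P.I} {H H' : C} (g : H' ⟶ H) (f : H ⟶ P.F.obj i) :
    F.map g.op (indElem P f) = indElem P (g ≫ f) :=
  (congr($((P.ι.app i).naturality g.op) f) : _).symm

lemma indElem_comp_map {i j : P.I} {H : C} (f : H ⟶ P.F.obj i) (a : i ⟶ j) :
    indElem P (f ≫ P.F.map a) = indElem P f :=
  congr(($(P.ι.naturality a)).app (op H) f)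

lemma exists_indElem {H : C} (x : F.obj (op H)) :
    ∃ (i : P.I) (f : H ⟶ P.F.obj i), indElem P f = x :=
  Types.jointly_surjective_of_isColimit
    (isColimitOfPreserves ((evaluation _ _).obj (op H)) P.coconeIsColimit) x

lemma exists_of_indElem_eq {i : P.I} {H : C} {f g : H ⟶ P.F.obj i}
    (h : indElem P f = indElem P g) : ∃ (j : P.I) (a : i ⟶ j), f ≫ P.F.map a = g ≫ P.F.map a :=
  (Types.FilteredColimit.isColimit_eq_iff'
    (isColimitOfPreserves ((evaluation _ _).obj (op H)) P.coconeIsColimit) f g).1 h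

lemma exists_common_target {I : Type*} [Category* I] [IsFiltered I] {κ : Type*} [Finite κ] (i : I)
    {j : κ → I} (a : ∀ k, i ⟶ j k) :
    ∃ (l : I) (b : i ⟶ l) (c : ∀ k, j k ⟶ l), ∀ k, a k ≫ c k = b := by
  have := Fintype.ofFinite κ
  classical
  -- The wide span makes all the composites `i → j k → l` equal, which an upper bound of the `j k`
  -- alone would not do.
  obtain ⟨s⟩ := IsFiltered.cocone_nonempty (WidePushoutShape.wideSpan i j a)
  exact ⟨s.pt, s.ι.app none, fun k ↦ s.ι.app (some k), fun k ↦ s.w (WidePushoutShape.Hom.init k)⟩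

lemma exists_common_indElem {κ : Type*} [Finite κ] {H : κ → C} (x : ∀ k, F.obj (op (H k))) :
    ∃ (i : P.I) (f : ∀ k, H k ⟶ P.F.obj i), ∀ k, indElem P (f k) = x k := by
  classical
  have := Fintype.ofFinite κ
  choose i f hf using fun k ↦ exists_indElem P (x k)
  obtain ⟨j, hj⟩ := IsFiltered.sup_objs_exists (Finset.univ.image i)
  let a (k : κ) : i k ⟶ j := (hj (Finset.mem_image_of_mem i (Finset.mem_univ k))).some
  exact ⟨j, fun k ↦ f k ≫ P.F.map (a k), fun k ↦ (indElem_comp_map P _ _).trans (hf k)⟩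

lemma exists_of_indElem_eq_family {κ : Type*} [Finite κ] {i : P.I} {H : κ → C}
    {f g : ∀ k, H k ⟶ P.F.obj i} (h : ∀ k, indElem P (f k) = indElem P (g k)) :
    ∃ (j : P.I) (a : i ⟶ j), ∀ k, f k ≫ P.F.map a = g k ≫ P.F.map a := by
  choose j a ha using fun k ↦ exists_of_indElem_eq P (h k)
  obtain ⟨l, b, c, hc⟩ := exists_common_target i a
  exact ⟨l, b, fun k ↦ by rw [← hc k, P.F.map_comp, reassoc_of% ha k]⟩

end Presentation

/-! ### Ind-objects satisfy the sheaf condition for finite coverings of the support. -/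

section SheafCondition

variable {X : TopCat.{u}} {R : Sheaf (Opens.grothendieckTopology X) RingCat.{u}} {U : Opens X}
  {F : (Modc (ringOn R U))ᵒᵖ ⥤ Type u} {κ : Type*} {W : κ → Opens (sp U)}
  {H : Modc (ringOn R U)}

lemma modc_hom_ext_of_cut {N : Modc (ringOn R U)} (hW : supp H.obj ⊆ ⋃ k, (W k : Set (sp U)))
    {f g : H ⟶ N} (h : ∀ k, (cutcι (W k)).app H ≫ f = (cutcι (W k)).app H ≫ g) : f = g :=
  ObjectProperty.hom_ext _ (hom_ext_of_cut hW fun k ↦ congr(($(h k)).hom))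

lemma modc_exists_hom_of_cut {N : Modc (ringOn R U)} (hW : supp H.obj ⊆ ⋃ k, (W k : Set (sp U)))
    (f : ∀ k, (cutc (W k)).obj H ⟶ N)
    (hf : ∀ k l, (cutcLE (inf_le_left : W k ⊓ W l ≤ W k)).app H ≫ f k =
      (cutcLE inf_le_right).app H ≫ f l) :
    ∃ g : H ⟶ N, ∀ k, (cutcι (W k)).app H ≫ g = f k := by
  obtain ⟨g, hg⟩ := exists_hom_of_cut hW (fun k ↦ (f k).hom) fun k l ↦ congr(($(hf k l)).hom)
  exact ⟨ObjectProperty.homMk g, fun k ↦ ObjectProperty.hom_ext _ (hg k)⟩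

variable [Finite κ]

/-- Finitely many equalities in a filtered colimit hold at a common stage `F_j`, where morphisms
from `H` are determined by their restrictions to the `H_{W k}`. Finiteness of `κ` is essential. -/
lemma eq_of_cut (hF : IsIndObject F) (hW : supp H.obj ⊆ ⋃ k, (W k : Set (sp U)))
    {x y : F.obj (op H)}
    (h : ∀ k, F.map ((cutcι (W k)).app H).op x = F.map ((cutcι (W k)).app H).op y) : x = y := by
  obtain ⟨⟨P⟩⟩ := hF
  obtain ⟨i, f, hf⟩ := exists_common_indElem P (H := fun _ : Bool ↦ H) fun b ↦ cond b x y
  obtain rfl : indElem P (f true) = x := hf true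
  obtain rfl : indElem P (f false) = y := hf false
  simp only [map_indElem] at h
  obtain ⟨j, a, ha⟩ := exists_of_indElem_eq_family P h
  rw [← indElem_comp_map P _ a, ← indElem_comp_map P (f false) a]
  congr 1
  exact modc_hom_ext_of_cut hW fun k ↦ by simpa using ha k

/-- The `x k` and their compatibilities are all realized at one stage `F_j`, where genuine morphisms
`H_{W k} → F_j` glue to `H → F_j`. -/
lemma exists_of_cut (hF : IsIndObject F) (hW : supp H.obj ⊆ ⋃ k, (W k : Set (sp U)))
    (x : ∀ k, F.obj (op ((cutc (W k)).obj H)))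
    (hx : ∀ k l, F.map ((cutcLE (inf_le_left : W k ⊓ W l ≤ W k)).app H).op (x k) =
      F.map ((cutcLE inf_le_right).app H).op (x l)) :
    ∃ y : F.obj (op H), ∀ k, F.map ((cutcι (W k)).app H).op y = x k := by
  obtain ⟨⟨P⟩⟩ := hF
  obtain ⟨i, f, hf⟩ := exists_common_indElem P x
  simp only [← hf, map_indElem] at hx
  obtain ⟨j, a, ha⟩ := exists_of_indElem_eq_family P
    (κ := κ × κ) (H := fun p ↦ (cutc (W p.1 ⊓ W p.2)).obj H) fun p ↦ hx p.1 p.2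
  obtain ⟨g, hg⟩ := modc_exists_hom_of_cut hW (fun k ↦ f k ≫ P.F.map a) fun k l ↦ by
    simpa using ha (k, l)
  refine ⟨indElem P g, fun k ↦ ?_⟩
  rw [map_indElem, hg, indElem_comp_map, hf]

end SheafCondition

/-! ### Gluing presheaves given on the sheaves supported in the members of a covering. -/

section Gluing

variable {X : TopCat.{u}} {R : Sheaf (Opens.grothendieckTopology X) RingCat.{u}} {S : Opens X}

variable (R) in
/-- The sheaves of modules with compact support contained in `V`. -/
def suppIn (V : Opens (sp S)) : ObjectProperty (Modc (ringOn R S)) := fun H ↦ supp H.obj ⊆ V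

/-- The open subsets whose closure is contained in `V`. -/
abbrev WellInside (V : Opens (sp S)) := {W : Opens (sp S) // closure (W : Set (sp S)) ⊆ V}

lemma suppIn_cutc (V : Opens (sp S)) (W : WellInside V) (H : Modc (ringOn R S)) :
    suppIn R V ((cutc W.1).obj H) :=
  (supp_cut_subset H.obj W.1).trans (Set.inter_subset_left.trans W.2)

lemma suppIn.cutc {V : Opens (sp S)} {H : Modc (ringOn R S)} (hH : suppIn R V H)
    (W : Opens (sp S)) : suppIn R V ((cutc W).obj H) :=
  (supp_cut_subset H.obj W).trans (Set.inter_subset_right.trans hH)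

lemma WellInside.suppIn {V Z : Opens (sp S)} (W : WellInside V) (h : Z ≤ W.1)
    (H : Modc (ringOn R S)) : suppIn R V ((KSInd.cutc Z).obj H) :=
  suppIn_cutc V ⟨Z, (closure_mono h).trans W.2⟩ H

/-- An open subset of an open subset well inside `V`. -/
def WellInside.ofLE {V Z : Opens (sp S)} (W : WellInside V) (h : Z ≤ W.1) : WellInside V :=
  ⟨Z, (closure_mono h).trans W.2⟩

lemma exists_wellInside [T2Space X] [LocallyCompactSpace X] {V : Opens (sp S)}
    {K : Set (sp S)} (hK : IsCompact K) (h : K ⊆ V) :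
    ∃ W : WellInside V, K ⊆ W.1 := by
  have : LocallyCompactSpace (sp S) := S.2.locallyCompactSpace
  obtain ⟨W, hW, hKW, hWV, -⟩ := exists_open_between_and_isCompact_closure hK V.2 h
  exact ⟨⟨⟨W, hW⟩, hWV⟩, hKW⟩

/-- Local compactness shrinks the covering to open sets well inside its members, and compactness of
`K` leaves finitely many. This lets the finite sheaf condition handle arbitrary coverings. -/
lemma exists_finite_cover [T2Space X] [LocallyCompactSpace X] {ι : Type*} {V : ι → Opens (sp S)}
    (hV : ∀ x, ∃ i, x ∈ V i) {K : Set (sp S)} (hK : IsCompact K) :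
    ∃ (n : ℕ) (i : Fin n → ι) (W : ∀ j, WellInside (V (i j))), K ⊆ ⋃ j, ((W j).1 : Set (sp S)) := by
  choose i hi using hV
  choose W hW using fun x : sp S ↦ exists_wellInside (isCompact_singleton (x := x))
    (Set.singleton_subset_iff.2 (hi x))
  obtain ⟨t, ht⟩ := hK.elim_finite_subcover (fun x ↦ ((W x).1 : Set (sp S))) (fun x ↦ (W x).1.2)
    fun x _ ↦ Set.mem_iUnion.2 ⟨x, hW x rfl⟩
  refine ⟨_, fun j ↦ i (t.equivFin.symm j).1, fun j ↦ W (t.equivFin.symm j).1, ht.trans ?_⟩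
  refine Set.iUnion₂_subset fun x hx ↦ ?_
  refine Set.subset_iUnion_of_subset (t.equivFin ⟨x, hx⟩) ?_
  exact (congrArg (fun z : t ↦ ((W z).1 : Set (sp S)))
    (t.equivFin.symm_apply_apply ⟨x, hx⟩)).symm.subset

/-- A family of presheaves `F_i` on the categories of sheaves with compact support in `V i`,
identified on the sheaves with support in several `V i`. -/
structure GluingData (R : Sheaf (Opens.grothendieckTopology X) RingCat.{u}) {ι : Type u}
    (V : ι → Opens (sp S)) where
  psh (i : ι) : (suppIn R (V i)).FullSubcategoryᵒᵖ ⥤ Type u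
  τ {i k : ι} {H : Modc (ringOn R S)} (hi : suppIn R (V i) H) (hk : suppIn R (V k) H)
    (p : (psh i).obj (op ⟨H, hi⟩)) : (psh k).obj (op ⟨H, hk⟩)
  τ_naturality {i k : ι} {H H' : Modc (ringOn R S)} (hi : suppIn R (V i) H)
    (hk : suppIn R (V k) H) (hi' : suppIn R (V i) H') (hk' : suppIn R (V k) H')
    (g : H' ⟶ H) (p : (psh i).obj (op ⟨H, hi⟩)) :
    τ hi' hk' ((psh i).map (Quiver.Hom.op (X := ⟨H', hi'⟩) (Y := ⟨H, hi⟩)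
      (ObjectProperty.homMk g)) p) = (psh k).map (Quiver.Hom.op (X := ⟨H', hk'⟩) (Y := ⟨H, hk⟩)
      (ObjectProperty.homMk g)) (τ hi hk p)
  τ_self {i : ι} {H : Modc (ringOn R S)} (hi : suppIn R (V i) H)
    (p : (psh i).obj (op ⟨H, hi⟩)) : τ hi hi p = p
  τ_comp {i k l : ι} {H : Modc (ringOn R S)} (hi : suppIn R (V i) H) (hk : suppIn R (V k) H)
    (hl : suppIn R (V l) H) (p : (psh i).obj (op ⟨H, hi⟩)) : τ hk hl (τ hi hk p) = τ hi hl p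

namespace GluingData

variable {ι : Type u} {V : ι → Opens (sp S)} (D : GluingData R V)

/-- The restriction maps of the presheaf `F_i`. -/
def map {i : ι} {H H' : Modc (ringOn R S)} (hi : suppIn R (V i) H) (hi' : suppIn R (V i) H')
    (g : H' ⟶ H) (p : (D.psh i).obj (op ⟨H, hi⟩)) : (D.psh i).obj (op ⟨H', hi'⟩) :=
  (D.psh i).map (Quiver.Hom.op (X := ⟨H', hi'⟩) (Y := ⟨H, hi⟩) (ObjectProperty.homMk g)) p

lemma map_comp {i : ι} {H H' H'' : Modc (ringOn R S)} (hi : suppIn R (V i) H)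
    (hi' : suppIn R (V i) H') (hi'' : suppIn R (V i) H'')
    (g : H' ⟶ H) (g' : H'' ⟶ H') (p : (D.psh i).obj (op ⟨H, hi⟩)) :
    D.map hi' hi'' g' (D.map hi hi' g p) = D.map hi hi'' (g' ≫ g) p :=
  map_map (D.psh i) _ _ p

lemma map_id {i : ι} {H : Modc (ringOn R S)} (hi : suppIn R (V i) H)
    (p : (D.psh i).obj (op ⟨H, hi⟩)) : D.map hi hi (𝟙 H) p = p :=
  map_id_apply (D.psh i) p

lemma map_injective {i : ι} {H H' : Modc (ringOn R S)} (hi : suppIn R (V i) H)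
    (hi' : suppIn R (V i) H') (g : H' ⟶ H) [IsIso g] :
    Function.Injective (D.map hi hi' g) := by
  refine Function.LeftInverse.injective (g := D.map hi' hi (inv g)) fun p ↦ ?_
  rw [map_comp, IsIso.inv_hom_id, map_id]

lemma τ_map {i k : ι} {H H' : Modc (ringOn R S)} (hi : suppIn R (V i) H)
    (hk : suppIn R (V k) H) (hi' : suppIn R (V i) H') (hk' : suppIn R (V k) H')
    (g : H' ⟶ H) (p : (D.psh i).obj (op ⟨H, hi⟩)) :
    D.τ hi' hk' (D.map hi hi' g p) = D.map hk hk' g (D.τ hi hk p) :=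
  D.τ_naturality hi hk hi' hk' g p

/-- The functor `M ↦ M_W` with values in sheaves with compact support in `V`. -/
def cutIn {V : Opens (sp S)} (W : WellInside V) :
    Modc (ringOn R S) ⥤ (suppIn R V).FullSubcategory :=
  ObjectProperty.lift _ (cutc W.1) (suppIn_cutc V W)

/-- The elements of the glued presheaf. -/
@[ext]
structure Sections (H : Modc (ringOn R S)) where
  -- The support of `H_W` lies in the closure of `W`; taking `W` well inside `V i` puts `H_W` in the
  -- domain of `psh i` for every `H`.
  val (i : ι) (W : WellInside (V i)) : (D.psh i).obj (op ⟨(cutc W.1).obj H, suppIn_cutc _ W H⟩)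
  compat {i k : ι} (W : WellInside (V i)) (W' : WellInside (V k)) (Z : Opens (sp S))
    (h : Z ≤ W.1) (h' : Z ≤ W'.1) :
    D.τ (W.suppIn h H) (W'.suppIn h' H)
      (D.map (suppIn_cutc _ W H) (W.suppIn h H) ((cutcLE h).app H) (val i W)) =
    D.map (suppIn_cutc _ W' H) (W'.suppIn h' H) ((cutcLE h').app H) (val k W')

/-- The glued presheaf. -/
def glued : (Modc (ringOn R S))ᵒᵖ ⥤ Type u where
  obj H := D.Sections H.unop
  map {H H'} g := ↾fun x ↦
    { val i W := D.map (suppIn_cutc _ W _) (suppIn_cutc _ W _) ((cutc W.1).map g.unop) (x.val i W)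
      compat {i k} W W' Z h h' := by
        have e := congrArg (D.map (W'.suppIn h' _) (W'.suppIn h' _)
          ((cutc Z).map g.unop)) (x.compat W W' Z h h')
        rw [← D.τ_map (W.suppIn h _) (W'.suppIn h' _) (W.suppIn h _) (W'.suppIn h' _), map_comp,
          map_comp] at e
        rw [map_comp, map_comp]
        exact e }
  map_id H := by
    ext : 2
    refine funext fun x ↦ Sections.ext (funext fun i ↦ funext fun W ↦ ?_)
    refine Eq.trans ?_ (D.map_id _ _)
    exact congr(D.map _ _ $((cutc W.1).map_id _) _)
  map_comp {H H' H''} g g' := by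
    ext : 2
    refine funext fun x ↦ Sections.ext (funext fun i ↦ funext fun W ↦ ?_)
    refine Eq.trans ?_ (D.map_comp _ _ _ _ _ _).symm
    exact congr(D.map _ _ $((cutc W.1).map_comp _ _) _)

/-- The map from `F_i(H)` to the elements of the glued presheaf. -/
def toSections {i : ι} {H : Modc (ringOn R S)} (hi : suppIn R (V i) H)
    (p : (D.psh i).obj (op ⟨H, hi⟩)) : D.Sections H where
  val k W := D.τ (hi.cutc W.1) (suppIn_cutc _ W H) (D.map hi (hi.cutc W.1) ((cutcι W.1).app H) p)
  compat {k l} W W' Z h h' := by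
    rw [← D.τ_map (hi.cutc W.1) (suppIn_cutc _ W H) (hi.cutc Z) (W.suppIn h H),
      ← D.τ_map (hi.cutc W'.1) (suppIn_cutc _ W' H) (hi.cutc Z) (W'.suppIn h' H), τ_comp,
      map_comp, map_comp]
    rfl

lemma map_toSections {i : ι} {H H' : Modc (ringOn R S)} (hi : suppIn R (V i) H)
    (hi' : suppIn R (V i) H') (g : H' ⟶ H) (p : (D.psh i).obj (op ⟨H, hi⟩)) :
    D.glued.map g.op (D.toSections hi p) = D.toSections hi' (D.map hi hi' g p) := by
  refine Sections.ext (funext fun k ↦ funext fun W ↦ ?_)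
  refine (D.τ_map (hi.cutc W.1) _ (hi'.cutc W.1) _ ((cutc W.1).map g) _).symm.trans ?_
  refine congrArg (D.τ _ _) ?_
  rw [map_comp, map_comp, (cutcι W.1).naturality g]
  rfl

lemma toSections_τ {i k : ι} {H : Modc (ringOn R S)} (hi : suppIn R (V i) H)
    (hk : suppIn R (V k) H) (p : (D.psh i).obj (op ⟨H, hi⟩)) :
    D.toSections hk (D.τ hi hk p) = D.toSections hi p := by
  refine Sections.ext (funext fun l ↦ funext fun W ↦ ?_)
  change D.τ _ _ (D.map _ _ _ _) = D.τ _ _ (D.map _ _ _ _)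
  rw [← D.τ_map hi hk (hi.cutc W.1), τ_comp]

lemma toSections_val_self {i : ι} {H : Modc (ringOn R S)} (hi : suppIn R (V i) H)
    (p : (D.psh i).obj (op ⟨H, hi⟩)) (W : WellInside (V i)) :
    (D.toSections hi p).val i W = D.map hi (suppIn_cutc _ W H) ((cutcι W.1).app H) p :=
  D.τ_self _ _

/-- The glued presheaf preserves finite limits. -/
lemma preservesFiniteLimits_glued
    (hD : ∀ i (W : WellInside (V i)), PreservesFiniteLimits ((cutIn W).op ⋙ D.psh i)) :
    PreservesFiniteLimits D.glued where
  preservesFiniteLimits J _ _ := ⟨fun {K} ↦ ⟨fun {c} hc ↦ by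
    -- Limits are computed separately in each component `(i, W)`.
    have key {i : ι} (W : WellInside (V i))
        (s : ∀ j, ((cutIn W).op ⋙ D.psh i).obj (K.obj j))
        (hs : ∀ {j j'} (a : j ⟶ j'), ((cutIn W).op ⋙ D.psh i).map (K.map a) (s j) = s j') :
        ∃! x : ((cutIn W).op ⋙ D.psh i).obj c.pt,
          ∀ j, ((cutIn W).op ⋙ D.psh i).map (c.π.app j) x = s j := by
      have := hD i W
      exact (Types.isLimit_iff _).1 ⟨isLimitOfPreserves ((cutIn W).op ⋙ D.psh i) hc⟩ s hs
    refine (Types.isLimit_iff _).2 fun s hs ↦ ?_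
    let s' (j) : D.Sections (K.obj j).unop := s j
    have hs' {j j'} (a : j ⟶ j') {i : ι} (W : WellInside (V i)) :
        ((cutIn W).op ⋙ D.psh i).map (K.map a) ((s' j).val i W) = (s' j').val i W :=
      congr(Sections.val $(hs a) i W)
    choose x hx hx' using fun i (W : WellInside (V i)) ↦
      key W (fun j ↦ (s' j).val i W) (fun a ↦ hs' a W)
    refine ⟨(⟨x, fun {i k} W W' Z h h' ↦ ?_⟩ : D.Sections c.pt.unop), fun j ↦ ?_, fun y hy ↦ ?_⟩
    -- Compatibility of the componentwise solutions: both sides solve the same limit problem for `Z`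
    -- and `k`, whose solution is unique.
    · obtain ⟨z, -, hz⟩ := key (W'.ofLE h') (fun j ↦ D.map (suppIn_cutc _ W' _)
        (W'.suppIn h' _) ((cutcLE h').app _) ((s' j).val k W')) (fun {j j'} a ↦ by
          refine Eq.trans ?_ (congrArg _ (hs' a W'))
          refine (D.map_comp _ _ _ _ _ _).trans (Eq.trans ?_ (D.map_comp _ _ _ _ _ _).symm)
          rfl)
      refine (hz _ fun j ↦ ?_).trans (hz _ fun j ↦ ?_).symm
      · refine Eq.trans ?_ ((s' j).compat W W' Z h h')
        refine (D.τ_map (W.suppIn h _) (W'.suppIn h' _)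
          (W.suppIn h _) (W'.suppIn h' _)
          ((cutc Z).map (c.π.app j).unop) _).symm.trans ?_
        refine congrArg (D.τ _ _) ?_
        refine Eq.trans ?_ (congrArg _ (hx i W j))
        refine (D.map_comp _ _ _ _ _ _).trans (Eq.trans ?_ (D.map_comp _ _ _ _ _ _).symm)
        rfl
      · refine Eq.trans ?_ (congrArg _ (hx k W' j))
        refine (D.map_comp _ _ _ _ _ _).trans (Eq.trans ?_ (D.map_comp _ _ _ _ _ _).symm)
        rfl
    · exact Sections.ext (funext fun i ↦ funext fun W ↦ hx i W j)
    · exact Sections.ext (funext fun i ↦ funext fun W ↦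
        hx' i W _ fun j ↦ congr(Sections.val $(hy j) i W))⟩⟩

variable [T2Space X] [LocallyCompactSpace X]

/-- Choose `W` well inside `V i` and containing the compact set `supp H`. Then `H_W = H`, and the
component `(i, W)` of a section determines all the others by `compat`. So the glued presheaf extends
each given one. -/
lemma toSections_bijective {i : ι} {H : Modc (ringOn R S)} (hi : suppIn R (V i) H) :
    Function.Bijective (D.toSections hi) := by
  obtain ⟨W, hW⟩ := exists_wellInside H.2 hi
  have : IsIso ((cutcι W.1).app H) := isIso_cutcι hW
  refine ⟨fun p q e ↦ ?_, fun x ↦ ?_⟩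
  · refine D.map_injective hi (suppIn_cutc _ W H) ((cutcι W.1).app H) ?_
    rw [← toSections_val_self, ← toSections_val_self, e]
  · refine ⟨D.map (suppIn_cutc _ W H) hi (inv ((cutcι W.1).app H)) (x.val i W),
      Sections.ext (funext fun k ↦ funext fun W' ↦ ?_)⟩
    -- As `supp H` lies in `W`, nothing is lost in passing from `H_{W'}` to `H_{W' ∩ W}`, where
    -- components can be compared.
    have : IsIso ((cutcLE (inf_le_left : W'.1 ⊓ W.1 ≤ W'.1)).app H) :=
      isIso_cutcLE _ fun y hy ↦ ⟨hy.2, hW hy.1⟩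
    refine D.map_injective (suppIn_cutc _ W' H) (W'.suppIn inf_le_left H)
      ((cutcLE (inf_le_left : W'.1 ⊓ W.1 ≤ W'.1)).app H) ?_
    rw [← x.compat W W' _ inf_le_right inf_le_left]
    change D.map _ _ _ (D.τ _ _ _) = _
    rw [← D.τ_map (hi.cutc W'.1) (suppIn_cutc _ W' H) (hi.cutc _) (W'.suppIn inf_le_left H),
      map_comp, map_comp]
    refine congr(D.τ _ _ (D.map _ _ $(?_) _))
    exact (IsIso.comp_inv_eq _).2 rfl

/-- The glued presheaf is an ind-object. -/
lemma isIndObject_glued (hV : ∀ x, ∃ i, x ∈ V i)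
    (hD : ∀ i (W : WellInside (V i)), PreservesFiniteLimits ((cutIn W).op ⋙ D.psh i))
    (hD' : ∀ i, ∃ (κ : Type u) (A : κ → (suppIn R (V i)).FullSubcategory)
      (a : ∀ k, (D.psh i).obj (op (A k))), ∀ (H : (suppIn R (V i)).FullSubcategory)
      (p : (D.psh i).obj (op H)), ∃ (k : κ) (g : H ⟶ A k), (D.psh i).map g.op (a k) = p) :
    IsIndObject D.glued := by
  have := D.preservesFiniteLimits_glued hD
  choose κ A a ha using hD'
  refine isIndObject_of_small exists_small_quotients (κ := Σ i, κ i) (fun k ↦ (A k.1 k.2).obj)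
    (fun k ↦ D.toSections (A k.1 k.2).2 (a k.1 k.2)) fun H p ↦ ?_
  -- The `H_{W j}` jointly cover `H`, and each lies in the domain of some `psh (i j)`, where the
  -- given weakly terminal family applies.
  obtain ⟨n, i, W, hW⟩ := exists_finite_cover hV H.2
  refine ⟨n, fun j ↦ (cutc (W j).1).obj H, fun j ↦ (cutcι (W j).1).app H,
    fun N g g' e ↦ modc_hom_ext_of_cut hW e, fun j ↦ ?_⟩
  obtain ⟨q, hq⟩ := (D.toSections_bijective (suppIn_cutc _ (W j) H)).2
    (D.glued.map ((cutcι (W j).1).app H).op p)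
  obtain ⟨k, g, hg⟩ := ha _ _ q
  refine ⟨⟨i j, k⟩, g.hom, ?_⟩
  rw [D.map_toSections (A (i j) k).2 (suppIn_cutc _ (W j) H)]
  exact (congrArg (D.toSections _) hg).trans hq

end GluingData

end Gluing

/-! ### Gluing morphisms of presheaves given on sheaves with support in the members of a covering.
-/

section HomGluing

variable {X : TopCat.{u}} [T2Space X] [LocallyCompactSpace X]
  {R : Sheaf (Opens.grothendieckTopology X) RingCat.{u}} {S : Opens X}
  {ι : Type*} {V : ι → Opens (sp S)} (hV : ∀ x, ∃ i, x ∈ V i)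
  {F G : (Modc (ringOn R S))ᵒᵖ ⥤ Type u} (hG : IsIndObject G)

include hV hG in
lemma eq_of_wellInside {H : Modc (ringOn R S)} {x y : G.obj (op H)}
    (h : ∀ i (W : WellInside (V i)),
      G.map ((cutcι W.1).app H).op x = G.map ((cutcι W.1).app H).op y) : x = y := by
  obtain ⟨n, i, W, hW⟩ := exists_finite_cover hV H.2
  exact eq_of_cut hG hW fun k ↦ h _ (W k)

include hV hG in
lemma natTrans_ext_of_suppIn {φ φ' : F ⟶ G}
    (h : ∀ i (H : Modc (ringOn R S)), suppIn R (V i) H → φ.app (op H) = φ'.app (op H)) :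
    φ = φ' := by
  ext H p
  refine eq_of_wellInside hV hG fun i W ↦ ?_
  refine (congr($(φ.naturality ((cutcι W.1).app H.unop).op) p) : _).symm.trans
    (Eq.trans ?_ congr($(φ'.naturality ((cutcι W.1).app H.unop).op) p))
  exact congr($(h i _ (suppIn_cutc _ W H.unop)) _)

include hV hG in
lemma exists_of_wellInside
    (φ : ∀ i (H : Modc (ringOn R S)), suppIn R (V i) H → F.obj (op H) → G.obj (op H))
    (hφ : ∀ i (H H' : Modc (ringOn R S)) (hi : suppIn R (V i) H) (hi' : suppIn R (V i) H')
      (g : H' ⟶ H) (p : F.obj (op H)), φ i H' hi' (F.map g.op p) = G.map g.op (φ i H hi p))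
    (hφ' : ∀ i k (H : Modc (ringOn R S)) (hi : suppIn R (V i) H) (hk : suppIn R (V k) H)
      (p : F.obj (op H)), φ i H hi p = φ k H hk p)
    (H : Modc (ringOn R S)) (p : F.obj (op H)) : ∃ q : G.obj (op H),
      ∀ i (W : WellInside (V i)), G.map ((cutcι W.1).app H).op q =
        φ i _ (suppIn_cutc _ W H) (F.map ((cutcι W.1).app H).op p) := by
  -- A sheaf `H'` that maps to `H_Z` and `H_{Z'}` compatibly over `H` sees the same value from `φ i`
  -- and `φ k`. This is used for overlaps of the chosen finite covering, and then to compare it with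
  -- an arbitrary `W'`.
  have key {H' : Modc (ringOn R S)} {Z Z' : Opens (sp S)} (i k : ι)
      (hZ : suppIn R (V i) ((cutc Z).obj H)) (hZ' : suppIn R (V k) ((cutc Z').obj H))
      (hi : suppIn R (V i) H') (hk : suppIn R (V k) H')
      (a : H' ⟶ (cutc Z).obj H) (b : H' ⟶ (cutc Z').obj H)
      (e : a ≫ (cutcι Z).app H = b ≫ (cutcι Z').app H) :
      G.map a.op (φ i _ hZ (F.map ((cutcι Z).app H).op p)) =
        G.map b.op (φ k _ hZ' (F.map ((cutcι Z').app H).op p)) := by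
    refine (hφ i _ _ hZ hi a _).symm.trans (Eq.trans ?_ (hφ k _ _ hZ' hk b _))
    refine (congrArg (φ i H' hi) ((map_map F a ((cutcι Z).app H) p).trans ?_)).trans
      (hφ' i k H' hi hk _)
    exact (congrArg (fun a ↦ F.map (Quiver.Hom.op a) p) e).trans (map_map F b _ p).symm
  obtain ⟨n, i, W, hW⟩ := exists_finite_cover hV H.2
  obtain ⟨q, hq⟩ := exists_of_cut hG hW
    (fun k ↦ φ (i k) _ (suppIn_cutc _ (W k) H) (F.map ((cutcι (W k).1).app H).op p))
    fun k l ↦ key (i k) (i l) (suppIn_cutc _ (W k) H) (suppIn_cutc _ (W l) H)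
      ((W k).suppIn inf_le_left H) ((W l).suppIn inf_le_right H) ((cutcLE inf_le_left).app H)
      ((cutcLE inf_le_right).app H) rfl
  refine ⟨q, fun l W' ↦ ?_⟩
  -- The equality on `H_{W'}` is tested on its pieces `(H_{W'})_{W k}`, where the definition of `q`
  -- applies.
  refine eq_of_cut hG (F := G) (H := (cutc W'.1).obj H) (W := fun k ↦ (W k).1)
    (((supp_cut_subset H.obj W'.1).trans Set.inter_subset_right).trans hW) fun k ↦ ?_
  have e : (cutc (W k).1).map ((cutcι W'.1).app H) ≫ (cutcι (W k).1).app H =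
    (cutcι (W k).1).app ((cutc W'.1).obj H) ≫ (cutcι W'.1).app H :=
    (cutcι (W k).1).naturality ((cutcι W'.1).app H)
  have hl := (suppIn_cutc _ W' H).cutc (W k).1
  have hk := suppIn_cutc _ (W k) ((cutc W'.1).obj H)
  refine Eq.trans ?_ (key (i k) l (suppIn_cutc _ (W k) H) (suppIn_cutc _ W' H) hk hl
    ((cutc (W k).1).map ((cutcι W'.1).app H)) _ e)
  refine (map_map G _ ((cutcι W'.1).app H) q).trans ?_
  refine (congrArg (fun a ↦ G.map (Quiver.Hom.op a) q) e.symm).trans ?_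
  exact (map_map G _ ((cutcι (W k).1).app H) q).symm.trans (congrArg _ (hq k))

include hV hG in
/-- Morphisms of presheaves, given locally, glue. -/
lemma exists_natTrans_of_suppIn
    (φ : ∀ i (H : Modc (ringOn R S)), suppIn R (V i) H → F.obj (op H) → G.obj (op H))
    (hφ : ∀ i (H H' : Modc (ringOn R S)) (hi : suppIn R (V i) H) (hi' : suppIn R (V i) H')
      (g : H' ⟶ H) (p : F.obj (op H)), φ i H' hi' (F.map g.op p) = G.map g.op (φ i H hi p))
    (hφ' : ∀ i k (H : Modc (ringOn R S)) (hi : suppIn R (V i) H) (hk : suppIn R (V k) H)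
      (p : F.obj (op H)), φ i H hi p = φ k H hk p) :
    ∃ ψ : F ⟶ G, ∀ i (H : Modc (ringOn R S)) (hi : suppIn R (V i) H) (p : F.obj (op H)),
      ψ.app (op H) p = φ i H hi p := by
  choose q hq using exists_of_wellInside hV hG φ hφ hφ'
  -- The value `q` is characterized by its restrictions, which gives both naturality and agreement
  -- with `φ`.
  have hq' {H : Modc (ringOn R S)} {p : F.obj (op H)} {y : G.obj (op H)}
      (hy : ∀ i (W : WellInside (V i)), G.map ((cutcι W.1).app H).op y =
        φ i _ (suppIn_cutc _ W H) (F.map ((cutcι W.1).app H).op p)) : q H p = y :=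
    eq_of_wellInside hV hG fun i W ↦ (hq H p i W).trans (hy i W).symm
  have hψ {H H' : Modc (ringOn R S)} (g : H' ⟶ H) (p : F.obj (op H)) :
      q H' (F.map g.op p) = G.map g.op (q H p) := by
    refine hq' fun i W ↦ ?_
    have e : (cutc W.1).map g ≫ (cutcι W.1).app H = (cutcι W.1).app H' ≫ g :=
      (cutcι W.1).naturality g
    refine (map_map G _ g _).trans ?_
    refine (congrArg (fun a ↦ G.map (Quiver.Hom.op a) (q H p)) e.symm).trans ?_
    refine (map_map G _ _ _).symm.trans ?_
    refine (congrArg _ (hq H p i W)).trans ?_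
    refine (hφ i _ _ (suppIn_cutc _ W H) (suppIn_cutc _ W H') _ _).symm.trans ?_
    refine congrArg (φ i _ _) ((map_map F _ _ p).trans ?_)
    exact (congrArg (fun a ↦ F.map (Quiver.Hom.op a) p) e).trans (map_map F _ g p).symm
  refine ⟨{ app H := ↾fun p ↦ q H.unop p, naturality H H' g := ?_ }, fun i H hi p ↦ ?_⟩
  · ext p
    exact hψ g.unop p
  · refine hq' fun k W ↦ ?_
    exact (hφ i H _ hi (hi.cutc W.1) _ p).symm.trans (hφ' _ _ _ _ _ _)

end HomGluing

/-! ### The coherence isomorphisms of the restriction functors, evaluated on objects. -/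

section Elements

variable {X : TopCat.{u}} [T2Space X]
  {R : Sheaf (Opens.grothendieckTopology X) RingCat.{u}}

variable (R) in
/-- The isomorphism `j_! i_! P ≅ (j ∘ i)_! P`. -/
def compIso {W V U : Opens X} (g : W ⟶ V) (f : V ⟶ U) (q : W ⟶ U) (P : Modc (ringOn R W)) :
    (extZeroc R f).obj ((extZeroc R g).obj P) ≅ (extZeroc R q).obj P :=
  (ObjectProperty.fullyFaithfulι _).preimageIso ((extZeroComp R g f).app P.obj).symm

lemma compIso_naturality {W V U : Opens X} (g : W ⟶ V) (f : V ⟶ U) (q : W ⟶ U)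
    {P P' : Modc (ringOn R W)} (a : P ⟶ P') :
    (extZeroc R f).map ((extZeroc R g).map a) ≫ (compIso R g f q P').hom =
      (compIso R g f q P).hom ≫ (extZeroc R q).map a := rfl

lemma compIso_assoc {W' W V U : Opens X} (h : W' ⟶ W) (g : W ⟶ V) (hg : W' ⟶ V) (f : V ⟶ U)
    (q : W ⟶ U) (q' : W' ⟶ U) (P : Modc (ringOn R W')) :
    (extZeroc R f).map (compIso R h g hg P).hom ≫ (compIso R hg f q' P).hom =
      (compIso R g f q _).hom ≫ (compIso R h q q' P).hom := rfl

variable [LocallyCompactSpace X]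

/-- The presheaf underlying an ind-sheaf. -/
def psh {U : Opens X} (M : (indSheaves R).obj ⟨op U⟩) : (Modc (ringOn R U))ᵒᵖ ⥤ Type u := M.obj

lemma isIndObject_psh {U : Opens X} (M : (indSheaves R).obj ⟨op U⟩) : IsIndObject (psh M) :=
  M.property

/-- The morphism of presheaves underlying a morphism of ind-sheaves. -/
def pshHom {U : Opens X} {M N : (indSheaves R).obj ⟨op U⟩} (a : M ⟶ N) : psh M ⟶ psh N := a.hom

/-- The restriction of ind-sheaves. -/
abbrev resInd {V U : Opens X} (f : V ⟶ U) (M : (indSheaves R).obj ⟨op U⟩) :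
    (indSheaves R).obj ⟨op V⟩ :=
  ((indSheaves R).map f.op.toLoc).toFunctor.obj M

/-- Translates the abstract coherence of `indSheaves` into the explicit isomorphism `j_! i_! P ≅ (j
∘ i)_! P`. The third arrow `q` is kept free, since arrows between open sets are unique. -/
lemma mapComp'_hom_app {W V U : Opens X} (g : W ⟶ V) (f : V ⟶ U) (q : W ⟶ U)
    (e : f.op.toLoc ≫ g.op.toLoc = q.op.toLoc) (M : (indSheaves R).obj ⟨op U⟩)
    (P : Modc (ringOn R W)) :
    (pshHom (((indSheaves R).mapComp' f.op.toLoc g.op.toLoc q.op.toLoc e).hom.toNatTrans.app M)).app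
      (op P) = (psh M).map (compIso R g f q P).hom.op := by
  obtain rfl : q = g ≫ f := Subsingleton.elim _ _
  have := Pseudofunctor.mapComp'_eq_mapComp (indSheaves R) f.op.toLoc g.op.toLoc
  exact congrArg (fun i ↦ (pshHom (i.hom.toNatTrans.app M)).app (op P)) this

lemma mapComp'_inv_app {W V U : Opens X} (g : W ⟶ V) (f : V ⟶ U) (q : W ⟶ U)
    (e : f.op.toLoc ≫ g.op.toLoc = q.op.toLoc) (M : (indSheaves R).obj ⟨op U⟩)
    (P : Modc (ringOn R W)) :
    (pshHom (((indSheaves R).mapComp' f.op.toLoc g.op.toLoc q.op.toLoc e).inv.toNatTrans.app M)).app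
      (op P) = (psh M).map (compIso R g f q P).inv.op := by
  obtain rfl : q = g ≫ f := Subsingleton.elim _ _
  have := Pseudofunctor.mapComp'_eq_mapComp (indSheaves R) f.op.toLoc g.op.toLoc
  exact congrArg (fun i ↦ (pshHom (i.inv.toNatTrans.app M)).app (op P)) this

end Elements

/-! ### Transport between sheaves on `U` and sheaves on `S` with compact support in `U`. -/

section Chart

variable {X : TopCat.{u}} [T2Space X] {R : Sheaf (Opens.grothendieckTopology X) RingCat.{u}}
  {S U : Opens X} (h : U ⟶ S)

/-- A sheaf with compact support in `U`, as a sheaf on `U`. -/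
def chartObj {H : Modc (ringOn R S)} (hH : suppIn R (sub h) H) : Modc (ringOn R U) :=
  Functor.essImage.witness ((essImage_extZeroc h H).2 hH)

/-- The canonical isomorphism `j_!(H|_U) ≅ H` for a sheaf `H` with compact support in `U`. -/
def chartIso {H : Modc (ringOn R S)} (hH : suppIn R (sub h) H) :
    (extZeroc R h).obj (chartObj h hH) ≅ H :=
  Functor.essImage.getIso ((essImage_extZeroc h H).2 hH)

/-- The morphism `H|_U → H'|_U` induced by a morphism `H → H'` of sheaves with compact support
in `U`. -/
def chartMap {H H' : Modc (ringOn R S)} (hH : suppIn R (sub h) H) (hH' : suppIn R (sub h) H')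
    (g : H ⟶ H') : chartObj h hH ⟶ chartObj h hH' :=
  (extZerocFullyFaithful R h).preimage ((chartIso h hH).hom ≫ g ≫ (chartIso h hH').inv)

lemma extZeroc_map_chartMap {H H' : Modc (ringOn R S)} (hH : suppIn R (sub h) H)
    (hH' : suppIn R (sub h) H') (g : H ⟶ H') :
    (extZeroc R h).map (chartMap h hH hH' g) =
      (chartIso h hH).hom ≫ g ≫ (chartIso h hH').inv :=
  (extZerocFullyFaithful R h).map_preimage _

variable (R) in
/-- The quasi-inverse `H ↦ H|_U` of `j_!`, on the sheaves with compact support in `U`. -/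
def chart : (suppIn R (sub h)).FullSubcategory ⥤ Modc (ringOn R U) where
  obj H := chartObj h H.2
  map {H H'} g := chartMap h H.2 H'.2 g.hom
  map_id H := (extZerocFullyFaithful R h).map_injective (by
    rw [extZeroc_map_chartMap]
    simp)
  map_comp g g' := (extZerocFullyFaithful R h).map_injective (by
    rw [Functor.map_comp, extZeroc_map_chartMap, extZeroc_map_chartMap, extZeroc_map_chartMap]
    simp)

variable {Y : Opens X} (g : Y ⟶ U) (q : Y ⟶ S) {Q : Modc (ringOn R Y)} {H : Modc (ringOn R S)}
  {A : Modc (ringOn R U)} (a : (extZeroc R h).obj A ≅ H)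

/-- The morphism `g_! Q → A` corresponding to a morphism `q_! Q → H`, where `h_! A ≅ H` and
`q = h ∘ g`. -/
def chartLift (φ : (extZeroc R q).obj Q ⟶ H) : (extZeroc R g).obj Q ⟶ A :=
  (extZerocFullyFaithful R h).preimage ((compIso R g h q Q).hom ≫ φ ≫ a.inv)

lemma extZeroc_map_chartLift (φ : (extZeroc R q).obj Q ⟶ H) :
    (extZeroc R h).map (chartLift h g q a φ) = (compIso R g h q Q).hom ≫ φ ≫ a.inv :=
  (extZerocFullyFaithful R h).map_preimage _

instance isIso_chartLift (φ : (extZeroc R q).obj Q ⟶ H) [IsIso φ] :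
    IsIso (chartLift h g q a φ) := by
  have : IsIso ((extZeroc R h).map (chartLift h g q a φ)) := by
    rw [extZeroc_map_chartLift]
    infer_instance
  exact isIso_of_reflects_iso _ (extZeroc R h)

lemma chartLift_comp {B : Modc (ringOn R U)} {K : Modc (ringOn R S)}
    (b : (extZeroc R h).obj B ≅ K) (φ : (extZeroc R q).obj Q ⟶ H) (k : H ⟶ K) (l : A ⟶ B)
    (e : (extZeroc R h).map l = a.hom ≫ k ≫ b.inv) :
    chartLift h g q a φ ≫ l = chartLift h g q b (φ ≫ k) :=
  (extZerocFullyFaithful R h).map_injective (by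
    rw [Functor.map_comp, extZeroc_map_chartLift, extZeroc_map_chartLift, e]
    simp)

lemma map_comp_chartLift {Q' : Modc (ringOn R Y)} (φ : (extZeroc R q).obj Q ⟶ H) (k : Q' ⟶ Q) :
    (extZeroc R g).map k ≫ chartLift h g q a φ =
      chartLift h g q a ((extZeroc R q).map k ≫ φ) :=
  (extZerocFullyFaithful R h).map_injective (by
    rw [Functor.map_comp, extZeroc_map_chartLift, extZeroc_map_chartLift]
    exact (Category.assoc _ _ _).symm.trans
      ((congrArg (· ≫ φ ≫ a.inv) (compIso_naturality g h q k)).trans (by simp)))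

/-- Compatibility of `chartLift` with a further restriction to `Z`, checked after applying the
faithful functor `h_!`. It is used to reduce all tests in `IsTransport` to a single one. -/
lemma compIso_comp_chartLift {Z : Opens X} (k : Z ⟶ Y) (gk : Z ⟶ U) (qk : Z ⟶ S)
    {P : Modc (ringOn R Z)} (φ : (extZeroc R qk).obj P ⟶ H) :
    (compIso R k g gk P).hom ≫ chartLift h gk qk a φ =
      chartLift h g q a ((compIso R k q qk P).hom ≫ φ) :=
  (extZerocFullyFaithful R h).map_injective (by
    rw [Functor.map_comp, extZeroc_map_chartLift, extZeroc_map_chartLift]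
    exact (Category.assoc _ _ _).symm.trans
      ((congrArg (· ≫ φ ≫ a.inv) (compIso_assoc k g gk h q qk P)).trans (by simp)))

lemma exists_isIso_hom {H : Modc (ringOn R S)} (hH : suppIn R (sub h) H) :
    ∃ (Q : Modc (ringOn R U)) (φ : (extZeroc R h).obj Q ⟶ H), IsIso φ :=
  ⟨_, (chartIso h hH).hom, inferInstance⟩

end Chart

/-! ### From a descent datum of ind-sheaves to gluing data. -/

section DescentHom

open Pseudofunctor.LocallyDiscreteOpToCat

variable {X : TopCat.{u}} [T2Space X] [LocallyCompactSpace X]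
  {R : Sheaf (Opens.grothendieckTopology X) RingCat.{u}} {S : Opens X} {ι : Type u}
  {U : ι → Opens X} {f : ∀ i, U i ⟶ S} (D : (indSheaves R).DescentData f)

/-- The descent isomorphism, evaluated at `Q`. -/
def dhom {Y : Opens X} (q : Y ⟶ S) {i k : ι} (f₁ : Y ⟶ U i) (f₂ : Y ⟶ U k) {Q : Modc (ringOn R Y)}
    (x : (psh (D.obj i)).obj (op ((extZeroc R f₁).obj Q))) :
    (psh (D.obj k)).obj (op ((extZeroc R f₂).obj Q)) :=
  (pshHom (D.hom q f₁ f₂ (Subsingleton.elim _ _) (Subsingleton.elim _ _))).app (op Q) x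

variable {Y : Opens X} (q : Y ⟶ S) {i k l : ι} (f₁ : Y ⟶ U i) (f₂ : Y ⟶ U k) (f₃ : Y ⟶ U l)
  {Q : Modc (ringOn R Y)}

lemma dhom_naturality {Q' : Modc (ringOn R Y)} (a : Q' ⟶ Q)
    (x : (psh (D.obj i)).obj (op ((extZeroc R f₁).obj Q))) :
    dhom D q f₁ f₂ ((psh (D.obj i)).map ((extZeroc R f₁).map a).op x) =
      (psh (D.obj k)).map ((extZeroc R f₂).map a).op (dhom D q f₁ f₂ x) :=
  congr($((pshHom (D.hom q f₁ f₂ (Subsingleton.elim _ _)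
    (Subsingleton.elim _ _))).naturality a.op) x)

lemma dhom_self (x : (psh (D.obj i)).obj (op ((extZeroc R f₁).obj Q))) :
    dhom D q f₁ f₁ x = x :=
  congr((pshHom $(D.hom_self q f₁ (Subsingleton.elim _ _))).app (op Q) x)

lemma dhom_dhom (x : (psh (D.obj i)).obj (op ((extZeroc R f₁).obj Q))) :
    dhom D q f₂ f₃ (dhom D q f₁ f₂ x) = dhom D q f₁ f₃ x :=
  congr((pshHom $(D.hom_comp q f₁ f₂ f₃ (Subsingleton.elim _ _) (Subsingleton.elim _ _)
    (Subsingleton.elim _ _))).app (op Q) x)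

/-- The compatibility of the descent isomorphisms with pullback from `Y` to `Z`, rewritten without
inverses by moving the coherence isomorphism to the other side. -/
lemma dhom_pull {Z : Opens X} (g : Z ⟶ Y) (q' : Z ⟶ S) (g₁ : Z ⟶ U i) (g₂ : Z ⟶ U k)
    {P : Modc (ringOn R Z)} (x : (psh (D.obj i)).obj (op ((extZeroc R g₁).obj P))) :
    (psh (D.obj k)).map (compIso R g f₂ g₂ P).hom.op (dhom D q' g₁ g₂ x) =
      dhom D q f₁ f₂ ((psh (D.obj i)).map (compIso R g f₁ g₁ P).hom.op x) := by
  have h := congr((pshHom $(D.pullHom_hom g q q' (Subsingleton.elim _ _) f₁ f₂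
    (Subsingleton.elim _ _) (Subsingleton.elim _ _) g₁ g₂ (Subsingleton.elim _ _)
    (Subsingleton.elim _ _))).app (op P) x)
  have h₁ := congr($(mapComp'_hom_app g f₁ g₁ rfl (D.obj i) P) x)
  have h₂ := mapComp'_inv_app g f₂ g₂ rfl (D.obj k) P
  have key : (psh (D.obj k)).map (compIso R g f₂ g₂ P).inv.op
      (dhom D q f₁ f₂ ((psh (D.obj i)).map (compIso R g f₁ g₁ P).hom.op x)) =
      dhom D q' g₁ g₂ x := by
    refine Eq.trans ?_ h
    refine (congr($h₂ _) : _).symm.trans ?_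
    exact congrArg (fun y ↦ (pshHom (((indSheaves R).mapComp' f₂.op.toLoc
      g.op.toLoc g₂.op.toLoc rfl).inv.toNatTrans.app (D.obj k))).app (op P)
      (dhom D q f₁ f₂ y)) h₁.symm
  refine (congrArg _ key.symm).trans ((map_map (psh (D.obj k)) _ _ _).trans ?_)
  refine Eq.trans ?_ (map_id_apply (psh (D.obj k)) _)
  exact congrArg (fun a ↦ (psh (D.obj k)).map (Quiver.Hom.op a)
    (dhom D q f₁ f₂ ((psh (D.obj i)).map (compIso R g f₁ g₁ P).hom.op x)))
      (compIso R g f₂ g₂ P).hom_inv_id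

/-- The relation between elements `p` of `F_i(H)` and `p'` of `F_k(H)`, for a sheaf `H` with
compact support in `U_i ∩ U_k`, which is induced by a descent datum `(F_i)`. -/
def IsTransport {H : Modc (ringOn R S)} {i k : ι} {A : Modc (ringOn R (U i))}
    {B : Modc (ringOn R (U k))} (a : (extZeroc R (f i)).obj A ≅ H)
    (b : (extZeroc R (f k)).obj B ≅ H) (p : (psh (D.obj i)).obj (op A))
    (p' : (psh (D.obj k)).obj (op B)) : Prop :=
  ∀ ⦃Y : Opens X⦄ (q : Y ⟶ S) (f₁ : Y ⟶ U i) (f₂ : Y ⟶ U k) (Q : Modc (ringOn R Y))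
    (φ : (extZeroc R q).obj Q ⟶ H),
    dhom D q f₁ f₂ ((psh (D.obj i)).map (chartLift (f i) f₁ q a φ).op p) =
      (psh (D.obj k)).map (chartLift (f k) f₂ q b φ).op p'

variable {D}

/-- One test suffices if it is an isomorphism over some `Y` containing `U i ∩ U k`: every other test
lives over a subset of `Y` and factors through it, because `q_!` is full. -/
lemma IsTransport.of_eq {H : Modc (ringOn R S)} {A : Modc (ringOn R (U i))}
    {B : Modc (ringOn R (U k))} {a : (extZeroc R (f i)).obj A ≅ H}
    {b : (extZeroc R (f k)).obj B ≅ H} {p : (psh (D.obj i)).obj (op A)}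
    {p' : (psh (D.obj k)).obj (op B)} (φ : (extZeroc R q).obj Q ⟶ H) [IsIso φ]
    (hY : U i ⊓ U k ≤ Y)
    (h : dhom D q f₁ f₂ ((psh (D.obj i)).map (chartLift (f i) f₁ q a φ).op p) =
      (psh (D.obj k)).map (chartLift (f k) f₂ q b φ).op p') : IsTransport D a b p p' := by
  intro Z q' g₁ g₂ P φ'
  let g : Z ⟶ Y := homOfLE ((le_inf (leOfHom g₁) (leOfHom g₂)).trans hY)
  let ψ : (extZeroc R g).obj P ⟶ Q :=
    -- This `ψ` is the morphism `g_! P → Q` through which the test `φ'` factors.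
    (extZerocFullyFaithful R q).preimage ((compIso R g q q' P).hom ≫ φ' ≫ inv φ)
  have hψ : (extZeroc R q).map ψ ≫ φ = (compIso R g q q' P).hom ≫ φ' := by
    simp [ψ, (extZerocFullyFaithful R q).map_preimage]
  have e₁ : (compIso R g f₁ g₁ P).hom ≫ chartLift (f i) g₁ q' a φ' =
      (extZeroc R f₁).map ψ ≫ chartLift (f i) f₁ q a φ := by
    rw [compIso_comp_chartLift (f i) f₁ q a, map_comp_chartLift, hψ]
  have e₂ : (compIso R g f₂ g₂ P).hom ≫ chartLift (f k) g₂ q' b φ' =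
      (extZeroc R f₂).map ψ ≫ chartLift (f k) f₂ q b φ := by
    rw [compIso_comp_chartLift (f k) f₂ q b, map_comp_chartLift, hψ]
  refine (((psh (D.obj k)).mapIso (compIso R g f₂ g₂ P).op).toEquiv).injective ?_
  refine (dhom_pull D q f₁ f₂ g q' g₁ g₂ _).trans ?_
  refine (congrArg (dhom D q f₁ f₂) ((map_map _ _ _ p).trans ((congrArg (fun c ↦
    (psh (D.obj i)).map (Quiver.Hom.op c) p) e₁).trans (map_map _ _ _ p).symm))).trans ?_
  refine (dhom_naturality D q f₁ f₂ ψ _).trans ((congrArg _ h).trans ?_)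
  exact (map_map _ _ _ p').trans ((congrArg (fun c ↦
    (psh (D.obj k)).map (Quiver.Hom.op c) p') e₂.symm).trans (map_map _ _ _ p').symm)

lemma map_injective_of_isIso {C : Type*} [Category* C] (F : Cᵒᵖ ⥤ Type v') {A B : C} (a : A ⟶ B)
    [IsIso a] : Function.Injective (F.map a.op) :=
  Function.LeftInverse.injective (g := F.map (inv a).op) fun p ↦ by
    rw [map_map, IsIso.inv_hom_id, map_id_apply]

/-- Over `Y = U i ∩ U k` the sheaf `H` itself is a test, as its support lies in `Y`. The descent
isomorphism for it then gives `p'`, and forces it. -/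
lemma existsUnique_isTransport {H : Modc (ringOn R S)} {A : Modc (ringOn R (U i))}
    {B : Modc (ringOn R (U k))} (a : (extZeroc R (f i)).obj A ≅ H)
    (b : (extZeroc R (f k)).obj B ≅ H) (hi : suppIn R (sub (f i)) H)
    (hk : suppIn R (sub (f k)) H) (p : (psh (D.obj i)).obj (op A)) :
    ∃! p' : (psh (D.obj k)).obj (op B), IsTransport D a b p p' := by
  let f₁ : U i ⊓ U k ⟶ U i := homOfLE inf_le_left
  let f₂ : U i ⊓ U k ⟶ U k := homOfLE inf_le_right
  obtain ⟨Q, φ, hφ⟩ := exists_isIso_hom (f₁ ≫ f i) (H := H) fun x hx ↦ ⟨hi hx, hk hx⟩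
  have hp : (psh (D.obj k)).map (chartLift (f k) f₂ _ b φ).op
      ((psh (D.obj k)).map (inv (chartLift (f k) f₂ _ b φ)).op
        (dhom D (f₁ ≫ f i) f₁ f₂ ((psh (D.obj i)).map (chartLift (f i) f₁ _ a φ).op p))) =
      dhom D (f₁ ≫ f i) f₁ f₂ ((psh (D.obj i)).map (chartLift (f i) f₁ _ a φ).op p) := by
    refine (map_map _ _ _ _).trans (Eq.trans ?_ (map_id_apply _ _))
    exact congrArg (fun c ↦ (psh (D.obj k)).map (Quiver.Hom.op c)
      (dhom D (f₁ ≫ f i) f₁ f₂ ((psh (D.obj i)).map (chartLift (f i) f₁ _ a φ).op p)))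
        (IsIso.hom_inv_id _)
  refine ⟨_, .of_eq (f₁ ≫ f i) f₁ f₂ φ le_rfl hp.symm, fun p' hp' ↦ ?_⟩
  exact map_injective_of_isIso _ (chartLift (f k) f₂ _ b φ)
    ((hp' (f₁ ≫ f i) f₁ f₂ Q φ).symm.trans hp.symm)

lemma IsTransport.map {H H' : Modc (ringOn R S)} {A A' : Modc (ringOn R (U i))}
    {B B' : Modc (ringOn R (U k))} {a : (extZeroc R (f i)).obj A ≅ H}
    {b : (extZeroc R (f k)).obj B ≅ H} {p : (psh (D.obj i)).obj (op A)}
    {p' : (psh (D.obj k)).obj (op B)} (h : IsTransport D a b p p')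
    (a' : (extZeroc R (f i)).obj A' ≅ H') (b' : (extZeroc R (f k)).obj B' ≅ H') (g : H' ⟶ H)
    {l : A' ⟶ A} {l' : B' ⟶ B} (hl : (extZeroc R (f i)).map l = a'.hom ≫ g ≫ a.inv)
    (hl' : (extZeroc R (f k)).map l' = b'.hom ≫ g ≫ b.inv) :
    IsTransport D a' b' ((psh (D.obj i)).map l.op p) ((psh (D.obj k)).map l'.op p') := by
  intro Z q' g₁ g₂ P φ
  rw [map_map, map_map, chartLift_comp (f i) g₁ q' a' a φ g l hl,
    chartLift_comp (f k) g₂ q' b' b φ g l' hl']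
  exact h q' g₁ g₂ P _

lemma IsTransport.refl {H : Modc (ringOn R S)} {A : Modc (ringOn R (U i))}
    (a : (extZeroc R (f i)).obj A ≅ H) (p : (psh (D.obj i)).obj (op A)) :
    IsTransport D a a p p := by
  intro Z q' g₁ g₂ P φ
  obtain rfl : g₁ = g₂ := Subsingleton.elim _ _
  exact dhom_self D q' g₁ _

lemma IsTransport.unique {H : Modc (ringOn R S)} {A : Modc (ringOn R (U i))}
    {B : Modc (ringOn R (U k))} {a : (extZeroc R (f i)).obj A ≅ H}
    {b : (extZeroc R (f k)).obj B ≅ H} (hi : suppIn R (sub (f i)) H)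
    (hk : suppIn R (sub (f k)) H) {p : (psh (D.obj i)).obj (op A)}
    {p' p'' : (psh (D.obj k)).obj (op B)} (h : IsTransport D a b p p')
    (h' : IsTransport D a b p p'') : p' = p'' :=
  (existsUnique_isTransport a b hi hk p).unique h h'

/-- The cocycle condition, tested on `H` viewed as a sheaf on the triple intersection. -/
lemma IsTransport.unique_of_comp {H : Modc (ringOn R S)} {A : Modc (ringOn R (U i))}
    {B : Modc (ringOn R (U k))} {C : Modc (ringOn R (U l))} {a : (extZeroc R (f i)).obj A ≅ H}
    {b : (extZeroc R (f k)).obj B ≅ H} {c : (extZeroc R (f l)).obj C ≅ H}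
    (hi : suppIn R (sub (f i)) H) (hk : suppIn R (sub (f k)) H) (hl : suppIn R (sub (f l)) H)
    {p : (psh (D.obj i)).obj (op A)} {p' : (psh (D.obj k)).obj (op B)}
    {p'' r : (psh (D.obj l)).obj (op C)} (h : IsTransport D a b p p')
    (h' : IsTransport D b c p' p'') (hr : IsTransport D a c p r) : p'' = r := by
  let f₁ : U i ⊓ U k ⊓ U l ⟶ U i := homOfLE (inf_le_left.trans inf_le_left)
  let f₂ : U i ⊓ U k ⊓ U l ⟶ U k := homOfLE (inf_le_left.trans inf_le_right)
  let f₃ : U i ⊓ U k ⊓ U l ⟶ U l := homOfLE inf_le_right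
  obtain ⟨Q, φ, hφ⟩ := exists_isIso_hom (f₁ ≫ f i) (H := H) fun x hx ↦ ⟨⟨hi hx, hk hx⟩, hl hx⟩
  refine map_injective_of_isIso _ (chartLift (f l) f₃ (f₁ ≫ f i) c φ) ?_
  refine (h' (f₁ ≫ f i) f₂ f₃ Q φ).symm.trans (Eq.trans ?_ (hr (f₁ ≫ f i) f₁ f₃ Q φ))
  rw [← h (f₁ ≫ f i) f₁ f₂ Q φ, dhom_dhom]

variable (D)

/-- The gluing data attached to a descent datum. -/
def gluingData : GluingData R (fun i ↦ sub (f i)) where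
  psh i := (chart R (f i)).op ⋙ psh (D.obj i)
  τ hi hk p := (existsUnique_isTransport (chartIso _ hi) (chartIso _ hk) hi hk p).choose
  τ_naturality hi hk hi' hk' g p := by
    refine IsTransport.unique hi' hk'
      (existsUnique_isTransport (chartIso _ hi') (chartIso _ hk') hi' hk' _).choose_spec.1 ?_
    exact (existsUnique_isTransport _ _ hi hk p).choose_spec.1.map _ _ g
      (extZeroc_map_chartMap _ _ _ _) (extZeroc_map_chartMap _ _ _ _)
  τ_self hi p := IsTransport.unique hi hi (existsUnique_isTransport (chartIso _ hi)
    (chartIso _ hi) hi hi p).choose_spec.1 (.refl _ _)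
  τ_comp hi hk hl p := IsTransport.unique_of_comp hi hk hl
    (existsUnique_isTransport (chartIso _ hi) (chartIso _ hk) hi hk p).choose_spec.1
    (existsUnique_isTransport (chartIso _ hk) (chartIso _ hl) hk hl _).choose_spec.1
    (existsUnique_isTransport (chartIso _ hi) (chartIso _ hl) hi hl p).choose_spec.1

lemma isTransport_τ {H : Modc (ringOn R S)} (hi : suppIn R (sub (f i)) H)
    (hk : suppIn R (sub (f k)) H) (p : (psh (D.obj i)).obj (op (chartObj (f i) hi))) :
    IsTransport D (chartIso _ hi) (chartIso _ hk) p ((gluingData D).τ hi hk p) :=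
  (existsUnique_isTransport (chartIso _ hi) (chartIso _ hk) hi hk p).choose_spec.1

end DescentHom

/-! ### Comparison of a sheaf `P` on `U` with the restriction of `j_! P`. -/

section ChartExt

variable {X : TopCat.{u}} [T2Space X] {R : Sheaf (Opens.grothendieckTopology X) RingCat.{u}}
  {S U : Opens X} (h : U ⟶ S)

lemma suppIn_extZeroc (P : Modc (ringOn R U)) : suppIn R (sub h) ((extZeroc R h).obj P) :=
  supp_extZero_subset h P.2

/-- The canonical morphism `(j_! P)|_U → P`, for a sheaf `P` on `U` with compact support. -/
def chartExt (P : Modc (ringOn R U)) : chartObj h (suppIn_extZeroc h P) ⟶ P :=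
  (extZerocFullyFaithful R h).preimage (chartIso h _).hom

lemma extZeroc_map_chartExt (P : Modc (ringOn R U)) :
    (extZeroc R h).map (chartExt h P) = (chartIso h (suppIn_extZeroc h P)).hom :=
  (extZerocFullyFaithful R h).map_preimage _

instance (P : Modc (ringOn R U)) : IsIso (chartExt h P) := by
  have : IsIso ((extZeroc R h).map (chartExt h P)) := by
    rw [extZeroc_map_chartExt]
    infer_instance
  exact isIso_of_reflects_iso _ (extZeroc R h)

lemma chartMap_comp_chartExt {P P' : Modc (ringOn R U)} (g : P' ⟶ P) :
    chartMap h (suppIn_extZeroc h P') (suppIn_extZeroc h P) ((extZeroc R h).map g) ≫ chartExt h P =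
      chartExt h P' ≫ g :=
  (extZerocFullyFaithful R h).map_injective (by
    rw [Functor.map_comp, extZeroc_map_chartMap, extZeroc_map_chartExt, Functor.map_comp,
      extZeroc_map_chartExt]
    simp)

lemma chartMap_comp_chartExt' {H : Modc (ringOn R S)} (hH : suppIn R (sub h) H)
    {P : Modc (ringOn R U)} (g : chartObj h hH ⟶ P) :
    chartMap h hH (suppIn_extZeroc h P) ((chartIso h hH).inv ≫ (extZeroc R h).map g) ≫
      chartExt h P = g :=
  (extZerocFullyFaithful R h).map_injective (by
    rw [Functor.map_comp, extZeroc_map_chartMap, extZeroc_map_chartExt]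
    simp)

lemma suppIn_extZeroc_comp {Y : Opens X} (g : Y ⟶ U) (q : Y ⟶ S) (Q : Modc (ringOn R Y)) :
    suppIn R (sub h) ((extZeroc R q).obj Q) :=
  (supp_extZero_subset q Q.2).trans fun _ hx ↦ leOfHom g hx

/-- The round trip through the chart is the identity on `g_! Q`. It cancels the auxiliary charts in
`toGlued_dhom`. -/
lemma chartLift_comp_chartExt {Y : Opens X} (g : Y ⟶ U) (q : Y ⟶ S) (Q : Modc (ringOn R Y)) :
    chartLift h g q (chartIso h (suppIn_extZeroc_comp h g q Q)) (𝟙 _) ≫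
      chartMap h (suppIn_extZeroc_comp h g q Q) (suppIn_extZeroc h _) (compIso R g h q Q).inv ≫
        chartExt h _ = 𝟙 _ :=
  (extZerocFullyFaithful R h).map_injective (by
    rw [Functor.map_comp, Functor.map_comp, extZeroc_map_chartMap, extZeroc_map_chartExt,
      extZeroc_map_chartLift]
    simp)

/-- Followed by the fully faithful `j_!`, this functor becomes `H ↦ H_W`, which preserves finite
colimits; `j_!` reflects them. -/
instance preservesFiniteColimits_cutIn_comp_chart (W : WellInside (sub h)) :
    PreservesFiniteColimits (GluingData.cutIn (R := R) W ⋙ chart R h) where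
  preservesFiniteColimits J _ _ := by
    let e : (GluingData.cutIn (R := R) W ⋙ chart R h) ⋙ extZeroc R h ≅ cutc W.1 :=
      NatIso.ofComponents (fun H ↦ chartIso h (suppIn_cutc _ W H)) fun g ↦ by
        refine (congrArg (· ≫ (chartIso h (suppIn_cutc _ W _)).hom)
          (extZeroc_map_chartMap h _ _ ((cutc W.1).map g))).trans ?_
        simp
        rfl
    have := preservesColimitsOfShape_of_natIso (J := J) e.symm
    exact preservesColimitsOfShape_of_reflects_of_preserves _ (extZeroc R h)

end ChartExt

/-! ### The glued ind-sheaf restricts to the given descent datum. -/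

section Effective

variable {X : TopCat.{u}} [T2Space X] [LocallyCompactSpace X]
  {R : Sheaf (Opens.grothendieckTopology X) RingCat.{u}} {S : Opens X} {ι : Type u}
  {U : ι → Opens X} {f : ∀ i, U i ⟶ S} (D : (indSheaves R).DescentData f)

lemma preservesFiniteLimits_gluingData (i : ι) (W : WellInside (sub (f i))) :
    PreservesFiniteLimits ((GluingData.cutIn W).op ⋙ (gluingData D).psh i) := by
  have := preservesFiniteLimits_of_isIndObject (isIndObject_psh (D.obj i))
  have : PreservesFiniteLimits (GluingData.cutIn (R := R) W ⋙ chart R (f i)).op :=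
    preservesFiniteLimits_op _
  exact comp_preservesFiniteLimits (GluingData.cutIn (R := R) W ⋙ chart R (f i)).op (psh (D.obj i))

lemma exists_small_weakly_terminal_gluingData (i : ι) :
    ∃ (κ : Type u) (A : κ → (suppIn R (sub (f i))).FullSubcategory)
      (a : ∀ k, ((gluingData D).psh i).obj (op (A k))),
      ∀ (H : (suppIn R (sub (f i))).FullSubcategory) (p : ((gluingData D).psh i).obj (op H)),
        ∃ (k : κ) (g : H ⟶ A k), ((gluingData D).psh i).map g.op (a k) = p := by
  obtain ⟨κ, A, a, h⟩ := exists_small_weakly_terminal (isIndObject_psh (D.obj i))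
  -- The weakly terminal family of `F_i` is extended by zero to `S`.
  refine ⟨κ, fun k ↦ ⟨(extZeroc R (f i)).obj (A k), suppIn_extZeroc _ _⟩,
    fun k ↦ (psh (D.obj i)).map (chartExt (f i) (A k)).op (a k), fun H p ↦ ?_⟩
  obtain ⟨k, g, hg⟩ := h (chartObj (f i) H.2) p
  refine ⟨k, ObjectProperty.homMk ((chartIso (f i) H.2).inv ≫ (extZeroc R (f i)).map g), ?_⟩
  refine (map_map (psh (D.obj i)) _ _ _).trans (Eq.trans ?_ hg)
  exact congrArg (fun c ↦ (psh (D.obj i)).map (Quiver.Hom.op c) (a k))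
    (chartMap_comp_chartExt' (f i) H.2 g)

lemma τ_eq_of_dhom_eq {Y : Opens X} (q : Y ⟶ S) {i k : ι} (f₁ : Y ⟶ U i) (f₂ : Y ⟶ U k)
    {Q : Modc (ringOn R Y)} {H : Modc (ringOn R S)} (hi : suppIn R (sub (f i)) H)
    (hk : suppIn R (sub (f k)) H) (φ : (extZeroc R q).obj Q ⟶ H) [IsIso φ]
    {p : (psh (D.obj i)).obj (op (chartObj (f i) hi))}
    {p' : (psh (D.obj k)).obj (op (chartObj (f k) hk))}
    (h : dhom D q f₁ f₂ ((psh (D.obj i)).map (chartLift (f i) f₁ q (chartIso _ hi) φ).op p) =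
      (psh (D.obj k)).map (chartLift (f k) f₂ q (chartIso _ hk) φ).op p') :
    (gluingData D).τ hi hk p = p' :=
  map_injective_of_isIso _ (chartLift (f k) f₂ q (chartIso _ hk) φ)
    ((isTransport_τ D hi hk p q f₁ f₂ Q φ).symm.trans h)

/-- The comparison map `F_i(P) → F(j_! P)`, where `F` is obtained by gluing the `F_i`. -/
def toGlued (i : ι) (P : Modc (ringOn R (U i))) (p : (psh (D.obj i)).obj (op P)) :
    (gluingData D).glued.obj (op ((extZeroc R (f i)).obj P)) :=
  (gluingData D).toSections (suppIn_extZeroc (f i) P) ((psh (D.obj i)).map (chartExt (f i) P).op p)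

lemma toGlued_bijective (i : ι) (P : Modc (ringOn R (U i))) :
    Function.Bijective (toGlued D i P) :=
  ((gluingData D).toSections_bijective (suppIn_extZeroc (f i) P)).comp
    ((psh (D.obj i)).mapIso (asIso (chartExt (f i) P)).op).toEquiv.bijective

lemma map_toGlued (i : ι) {P P' : Modc (ringOn R (U i))} (g : P' ⟶ P)
    (p : (psh (D.obj i)).obj (op P)) :
    (gluingData D).glued.map ((extZeroc R (f i)).map g).op (toGlued D i P p) =
      toGlued D i P' ((psh (D.obj i)).map g.op p) := by
  refine ((gluingData D).map_toSections (suppIn_extZeroc (f i) P) (suppIn_extZeroc (f i) P')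
    _ _).trans ?_
  refine congrArg ((gluingData D).toSections _) ?_
  refine (map_map (psh (D.obj i)) _ _ p).trans (Eq.trans ?_ (map_map (psh (D.obj i)) _ _ p).symm)
  exact congrArg (fun c ↦ (psh (D.obj i)).map (Quiver.Hom.op c) p)
    (chartMap_comp_chartExt (f i) g)

/-- The comparison maps intertwine the descent isomorphisms with the canonical identifications of
`i_! Q` seen through two charts. So they form an isomorphism of descent data. -/
lemma toGlued_dhom {Y : Opens X} (q : Y ⟶ S) {i k : ι} (f₁ : Y ⟶ U i) (f₂ : Y ⟶ U k)
    {Q : Modc (ringOn R Y)} (x : (psh (D.obj i)).obj (op ((extZeroc R f₁).obj Q))) :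
    (gluingData D).glued.map (compIso R f₂ (f k) q Q).inv.op
        (toGlued D k _ (dhom D q f₁ f₂ x)) =
      (gluingData D).glued.map (compIso R f₁ (f i) q Q).inv.op (toGlued D i _ x) := by
  have hi := suppIn_extZeroc_comp (f i) f₁ q Q
  have hk := suppIn_extZeroc_comp (f k) f₂ q Q
  refine ((gluingData D).map_toSections _ hk _ _).trans (Eq.trans ?_
    ((gluingData D).map_toSections _ hi _ _).symm)
  refine Eq.trans ?_ ((gluingData D).toSections_τ hi hk _)
  refine congrArg ((gluingData D).toSections hk) (Eq.symm ?_)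
  refine τ_eq_of_dhom_eq D q f₁ f₂ hi hk (𝟙 _) ?_
  have key {j : ι} (g : Y ⟶ U j) (hj : suppIn R (sub (f j)) ((extZeroc R q).obj Q))
      (y : (psh (D.obj j)).obj (op ((extZeroc R g).obj Q))) :
      (psh (D.obj j)).map (chartLift (f j) g q (chartIso (f j) hj) (𝟙 _)).op
        ((gluingData D).map (suppIn_extZeroc (f j) _) hj (compIso R g (f j) q Q).inv
          ((psh (D.obj j)).map (chartExt (f j) _).op y)) = y := by
    refine (congrArg _ (map_map (psh (D.obj j)) _ _ y)).trans ?_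
    refine (map_map (psh (D.obj j)) _ _ y).trans (Eq.trans ?_ (map_id_apply (psh (D.obj j)) y))
    exact congrArg (fun c ↦ (psh (D.obj j)).map (Quiver.Hom.op c) y)
      (chartLift_comp_chartExt (f j) g q Q)
  exact (congrArg _ (key f₁ hi x)).trans (key f₂ hk _).symm

end Effective

/-! ### Gluing of morphisms in terms of sheaves on the `U i`. -/

section Charts

variable {X : TopCat.{u}} [T2Space X] [LocallyCompactSpace X]
  {R : Sheaf (Opens.grothendieckTopology X) RingCat.{u}} {S : Opens X} {ι : Type u}
  {U : ι → Opens X} {f : ∀ i, U i ⟶ S} (hU : ∀ x, ∃ i, x ∈ sub (f i))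
  {F G : (Modc (ringOn R S))ᵒᵖ ⥤ Type u} (hG : IsIndObject G)

include hU hG in
lemma natTrans_ext_of_charts {φ φ' : F ⟶ G}
    (h : ∀ i (P : Modc (ringOn R (U i))) (p : F.obj (op ((extZeroc R (f i)).obj P))),
      φ.app (op ((extZeroc R (f i)).obj P)) p = φ'.app (op ((extZeroc R (f i)).obj P)) p) :
    φ = φ' := by
  refine natTrans_ext_of_suppIn hU hG fun i H hi ↦ ?_
  ext p
  refine map_injective_of_isIso G (chartIso (f i) hi).hom ?_
  refine (congr($(φ.naturality (chartIso (f i) hi).hom.op) p) : _).symm.trans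
    (Eq.trans ?_ congr($(φ'.naturality (chartIso (f i) hi).hom.op) p))
  exact h _ _ _

include hU hG in
-- Each `ψ i` is carried by the chart to the sheaves on `S` supported in `U i`; condition `hψ'`
-- makes the result independent of `i`, and `exists_natTrans_of_suppIn` applies.
lemma exists_natTrans_of_charts
    (ψ : ∀ i (P : Modc (ringOn R (U i))), F.obj (op ((extZeroc R (f i)).obj P)) →
      G.obj (op ((extZeroc R (f i)).obj P)))
    (hψ : ∀ i {P P' : Modc (ringOn R (U i))} (g : P' ⟶ P)
      (p : F.obj (op ((extZeroc R (f i)).obj P))),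
      ψ i P' (F.map ((extZeroc R (f i)).map g).op p) =
        G.map ((extZeroc R (f i)).map g).op (ψ i P p))
    (hψ' : ∀ {Y : Opens X} (q : Y ⟶ S) {i k : ι} (f₁ : Y ⟶ U i) (f₂ : Y ⟶ U k)
      (Q : Modc (ringOn R Y)) (p : F.obj (op ((extZeroc R (f i)).obj ((extZeroc R f₁).obj Q)))),
      G.map (compIso R f₂ (f k) q Q).hom.op (G.map (compIso R f₁ (f i) q Q).inv.op (ψ i _ p)) =
        ψ k _ (F.map (compIso R f₂ (f k) q Q).hom.op (F.map (compIso R f₁ (f i) q Q).inv.op p))) :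
    ∃ φ : F ⟶ G, ∀ i (P : Modc (ringOn R (U i))) (p : F.obj (op ((extZeroc R (f i)).obj P))),
      φ.app (op ((extZeroc R (f i)).obj P)) p = ψ i P p := by
  -- The value at `H` defined through the chart is compatible with `ψ i` along any morphism `j_! P →
  -- H`. All the verifications below are instances of this.
  have hc (i) {H : Modc (ringOn R S)} (hi : suppIn R (sub (f i)) H) {P : Modc (ringOn R (U i))}
      (g : P ⟶ chartObj (f i) hi) (b : (extZeroc R (f i)).obj P ⟶ H)
      (e : (extZeroc R (f i)).map g = b ≫ (chartIso (f i) hi).inv) (p : F.obj (op H)) :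
      G.map b.op (G.map (chartIso (f i) hi).inv.op (ψ i _ (F.map (chartIso (f i) hi).hom.op p))) =
        ψ i P (F.map b.op p) := by
    refine (map_map G _ _ _).trans ((congrArg (fun c ↦ G.map (Quiver.Hom.op c) _) e.symm).trans ?_)
    refine (hψ i g _).symm.trans (congrArg (ψ i P) ((map_map F _ _ p).trans ?_))
    exact congrArg (fun c ↦ F.map (Quiver.Hom.op c) p) (by rw [e]; simp)
  refine (exists_natTrans_of_suppIn hU (F := F) hG (fun i H hi p ↦
    G.map (chartIso (f i) hi).inv.op (ψ i _ (F.map (chartIso (f i) hi).hom.op p)))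
      (fun i H H' hi hi' g p ↦ ?_) (fun i k H hi hk p ↦ ?_)).elim fun φ hφ ↦ ?_
  · refine map_injective_of_isIso G (chartIso (f i) hi').hom ?_
    refine (hc i hi' (𝟙 _) _ (by simp) _).trans ?_
    refine Eq.trans ?_ (map_map G _ _ _).symm
    refine Eq.trans ?_ (hc i hi (chartMap (f i) hi' hi g) ((chartIso (f i) hi').hom ≫ g)
      ((extZeroc_map_chartMap _ _ _ _).trans (Category.assoc _ _ _).symm) p).symm
    exact congrArg (ψ i _) (map_map F _ _ p)
  · let f₁ : U i ⊓ U k ⟶ U i := homOfLE inf_le_left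
    let f₂ : U i ⊓ U k ⟶ U k := homOfLE inf_le_right
    obtain ⟨Q, φ, hφ⟩ := exists_isIso_hom (f₁ ≫ f i) (H := H) fun x hx ↦ ⟨hi hx, hk hx⟩
    have h₁ := hc i hi _ _ ((extZeroc_map_chartLift (f i) f₁ (f₁ ≫ f i) (chartIso (f i) hi) φ).trans
      (Category.assoc _ _ _).symm) p
    have h₂ := hc k hk _ _ ((extZeroc_map_chartLift (f k) f₂ (f₁ ≫ f i) (chartIso (f k) hk) φ).trans
      (Category.assoc _ _ _).symm) p
    -- Both values at `H` are compared over `U i ∩ U k`, where `H` becomes `q_! Q` and `hψ'`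
    -- applies.
    refine map_injective_of_isIso G ((compIso R f₂ (f k) (f₁ ≫ f i) Q).hom ≫ φ)
      (Eq.trans ?_ h₂.symm)
    have h := hψ' (f₁ ≫ f i) f₁ f₂ Q (F.map ((compIso R f₁ (f i) (f₁ ≫ f i) Q).hom ≫ φ).op p)
    rw [← h₁] at h
    refine (map_map G _ _ _).symm.trans (Eq.trans (congrArg _ ?_) (h.trans
      (congrArg (ψ k _) ?_)))
    · refine Eq.trans ?_ (map_map G _ _ _).symm
      exact congrArg (fun c ↦ G.map (Quiver.Hom.op c) _) (by simp)
    · refine Eq.trans (congrArg _ (map_map F _ _ _)) ((map_map F _ _ _).trans ?_)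
      exact congrArg (fun c ↦ F.map (Quiver.Hom.op c) _) (by simp)
  · refine ⟨φ, fun i P p ↦ (hφ i _ (suppIn_extZeroc _ P) p).trans ?_⟩
    -- Inserting an identity brings the goal to the form of `hc`, with `b = 𝟙` and `g` the inverse
    -- of `chartExt`.
    refine map_injective_of_isIso G (𝟙 _) ?_
    refine (hc i (suppIn_extZeroc _ P) (inv (chartExt (f i) P)) (𝟙 _) ?_ p).trans ?_
    · rw [Functor.map_inv, Category.id_comp]
      exact IsIso.inv_eq_of_hom_inv_id (by rw [extZeroc_map_chartExt, Iso.hom_inv_id])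
    · rw [map_id_apply, map_id_apply]

end Charts

/-! ### Covering sieves as families of charts. -/

section Covers

variable {X : TopCat.{u}} {S : Opens X}

lemma exists_mem_sub_of_sieve {T : Sieve S} (hT : T ∈ Opens.grothendieckTopology X S)
    (x : sp S) : ∃ g : T.arrows.category, x ∈ sub g.obj.hom := by
  obtain ⟨V, g, hg, hx⟩ := hT x.1 x.2
  exact ⟨⟨Over.mk g, hg⟩, hx⟩

end Covers

/-- The colimit cocone given by the definition of `indLim`. -/
def indLimCocone {C : Type v} [Category.{u} C] {I : Type u} [SmallCategory I] (D : I ⥤ C) :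
    Cocone (D ⋙ yoneda) := colimit.cocone _

lemma nonempty_isColimit_indLimCocone {C : Type v} [Category.{u} C] {I : Type u} [SmallCategory I]
    (D : I ⥤ C) : Nonempty (IsColimit (indLimCocone D)) := ⟨colimit.isColimit _⟩

/-! ### Ind-sheaves form a stack, and the formula for the restriction. -/

section Stack

open Pseudofunctor

variable {X : TopCat.{u}} [T2Space X] [LocallyCompactSpace X]
  {R : Sheaf (Opens.grothendieckTopology X) RingCat.{u}} {S : Opens X} {ι : Type u}
  {U : ι → Opens X} {f : ∀ i, U i ⟶ S} (hU : ∀ x, ∃ i, x ∈ sub (f i))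

lemma indSheaves_hom_ext {M N : (indSheaves R).obj ⟨op S⟩} {a b : M ⟶ N}
    (h : ∀ (P : Modc (ringOn R S)) (p : (psh M).obj (op P)),
      (pshHom a).app (op P) p = (pshHom b).app (op P) p) : a = b :=
  ObjectProperty.hom_ext _ (NatTrans.ext (funext fun P ↦ by
    ext p
    exact h P.unop p) : pshHom a = pshHom b)

/-- The transition maps of the descent datum of an object come from the two identifications of
iterated extensions by zero with `q_! Q`. -/
lemma ofObj_hom_app (M : (indSheaves R).obj ⟨op S⟩) {Y : Opens X} (q : Y ⟶ S) {i k : ι}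
    (f₁ : Y ⟶ U i) (f₂ : Y ⟶ U k) (h₁ : f₁ ≫ f i = q) (h₂ : f₂ ≫ f k = q)
    (Q : Modc (ringOn R Y))
    (x : (psh M).obj (op ((extZeroc R (f i)).obj ((extZeroc R f₁).obj Q)))) :
    (pshHom ((DescentData.ofObj (f := f) M).hom q f₁ f₂ h₁ h₂)).app (op Q) x =
      (psh M).map (compIso R f₂ (f k) q Q).hom.op
        ((psh M).map (compIso R f₁ (f i) q Q).inv.op x) :=
  (congrArg (((pshHom (((indSheaves R).mapComp' (f k).op.toLoc f₂.op.toLoc q.op.toLoc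
    rfl).hom.toNatTrans.app M)).app (op Q))) congr($(mapComp'_inv_app f₁ (f i) q rfl M Q) x)).trans
      congr($(mapComp'_hom_app f₂ (f k) q rfl M Q) _)

/-- The components of a morphism between the descent data given by `M` and `N`. -/
def descHom {M N : (indSheaves R).obj ⟨op S⟩}
    (ψ : DescentData.ofObj (f := f) M ⟶ DescentData.ofObj N) (i : ι) (P : Modc (ringOn R (U i)))
    (p : (psh M).obj (op ((extZeroc R (f i)).obj P))) :
    (psh N).obj (op ((extZeroc R (f i)).obj P)) :=
  (pshHom (ψ.hom i)).app (op P) p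

lemma descHom_naturality {M N : (indSheaves R).obj ⟨op S⟩}
    (ψ : DescentData.ofObj (f := f) M ⟶ DescentData.ofObj N) (i : ι)
    {P P' : Modc (ringOn R (U i))} (g : P' ⟶ P)
    (p : (psh M).obj (op ((extZeroc R (f i)).obj P))) :
    descHom ψ i P' ((psh M).map ((extZeroc R (f i)).map g).op p) =
      (psh N).map ((extZeroc R (f i)).map g).op (descHom ψ i P p) :=
  congr($((pshHom (ψ.hom i)).naturality g.op) p)

lemma descHom_comm {M N : (indSheaves R).obj ⟨op S⟩}
    (ψ : DescentData.ofObj (f := f) M ⟶ DescentData.ofObj N) {Y : Opens X} (q : Y ⟶ S) {i k : ι}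
    (f₁ : Y ⟶ U i) (f₂ : Y ⟶ U k) (Q : Modc (ringOn R Y))
    (p : (psh M).obj (op ((extZeroc R (f i)).obj ((extZeroc R f₁).obj Q)))) :
    (psh N).map (compIso R f₂ (f k) q Q).hom.op
        ((psh N).map (compIso R f₁ (f i) q Q).inv.op (descHom ψ i _ p)) =
      descHom ψ k _ ((psh M).map (compIso R f₂ (f k) q Q).hom.op
        ((psh M).map (compIso R f₁ (f i) q Q).inv.op p)) := by
  have h := congr((pshHom $(ψ.comm q f₁ f₂ (Subsingleton.elim _ _)
    (Subsingleton.elim _ _))).app (op Q) p)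
  refine (ofObj_hom_app N q f₁ f₂ (Subsingleton.elim _ _) (Subsingleton.elim _ _) Q
    (descHom ψ i _ p)).symm.trans (h.trans ?_)
  exact congrArg (descHom ψ k ((extZeroc R f₂).obj Q))
    (ofObj_hom_app M q f₁ f₂ (Subsingleton.elim _ _) (Subsingleton.elim _ _) Q p)

include hU in
lemma bijective_toDescentData_map (M N : (indSheaves R).obj ⟨op S⟩) :
    Function.Bijective (((indSheaves R).toDescentData f).map : (M ⟶ N) → _) := by
  refine ⟨fun φ φ' e ↦ ?_, fun ψ ↦ ?_⟩
  · refine ObjectProperty.hom_ext _ (natTrans_ext_of_charts (F := psh M) hU (isIndObject_psh N)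
      fun i P p ↦ ?_)
    exact congr((pshHom (DescentData.Hom.hom $e i)).app (op P) p)
  · obtain ⟨φ, hφ⟩ := exists_natTrans_of_charts (F := psh M) hU (isIndObject_psh N) (descHom ψ)
      (descHom_naturality ψ) (descHom_comm ψ)
    exact ⟨ObjectProperty.homMk φ, DescentData.hom_ext fun i ↦ indSheaves_hom_ext fun P p ↦ hφ i P p⟩

include hU in
lemma essSurj_toDescentData : ((indSheaves R).toDescentData f).EssSurj where
  mem_essImage D := by
    let M : (indSheaves R).obj ⟨op S⟩ := ⟨(gluingData D).glued, (gluingData D).isIndObject_glued hU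
      (preservesFiniteLimits_gluingData D) (exists_small_weakly_terminal_gluingData D)⟩
    -- The comparison maps are bijective and natural; `toGlued_dhom` below shows that they respect
    -- the descent data.
    let e (i : ι) : psh (D.obj i) ≅ psh (resInd (f i) M) :=
      NatIso.ofComponents (fun P ↦ (Equiv.ofBijective _ (toGlued_bijective D i P.unop)).toIso)
        fun {P P'} g ↦ by
          ext p
          exact (map_toGlued D i g.unop p).symm
    let e' (i : ι) : D.obj i ≅ resInd (f i) M := (ObjectProperty.fullyFaithfulι _).preimageIso (e i)
    refine ⟨M, ⟨(DescentData.isoMk e' fun Y q i k f₁ f₂ h₁ h₂ ↦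
      indSheaves_hom_ext fun Q x ↦ ?_).symm⟩⟩
    refine (ofObj_hom_app M q f₁ f₂ h₁ h₂ Q _).trans ?_
    refine (congrArg ((psh M).map (compIso R f₂ (f k) q Q).hom.op)
      (toGlued_dhom D q f₁ f₂ x).symm).trans ?_
    refine (map_map (psh M) _ _ _).trans (Eq.trans ?_ (map_id_apply (psh M) _))
    exact congrArg (fun c ↦ (psh M).map (Quiver.Hom.op c) (toGlued D k _ (dhom D q f₁ f₂ x)))
      (Iso.hom_inv_id _)

variable (R) in
instance isStack_indSheaves : (indSheaves R).IsStack (Opens.grothendieckTopology X) where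
  toIsPrestack := .of_isPrestackFor fun S T hT ↦ by
    rw [isPrestackFor_iff, Functor.FullyFaithful.nonempty_iff_map_bijective]
    exact bijective_toDescentData_map (exists_mem_sub_of_sieve hT)
  essSurj_of_sieve T hT := essSurj_toDescentData (exists_mem_sub_of_sieve hT)

variable {V : Opens X}

lemma nonempty_resInd_iso (h : V ⟶ S) (F : (indSheaves R).obj ⟨op S⟩) {I : Type u}
    [SmallCategory I] [IsFiltered I] (D : I ⥤ Modc (ringOn R S)) (e : F.obj ≅ indLim D) :
    Nonempty ((((indSheaves R).map h.op.toLoc).toFunctor.obj F).obj ≅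
      indLim (D.prod (𝟭 (RelCompact V)) ⋙ restrCut h)) := by
  obtain ⟨h₁⟩ := nonempty_isColimit_indLimCocone D
  obtain ⟨h₂⟩ := nonempty_isColimit_indLimCocone (D.prod (𝟭 (RelCompact V)) ⋙ restrCut h)
  -- The isomorphism `e` makes `F` itself a colimit of the system, so that its restriction is a
  -- colimit of the cut-off system.
  obtain ⟨h₃⟩ := isColimit_restrPresentation h D ((indLimCocone D).extend e.inv).ι
    (h₁.ofIsoColimit (Cocone.ext e.symm))
  exact ⟨h₃.coconePointUniqueUpToIso h₂⟩

end Stack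

/-! ### A criterion for `U ↦ Ind(Mod(R|_U))` not to be a stack. -/

section NotStack

open Pseudofunctor

variable {X : TopCat.{u}} {R : Sheaf (Opens.grothendieckTopology X) RingCat.{u}} {S : Opens X}

/-- Morphisms of ind-objects of `Mod(R|_S)` which coincide locally are equal, if `U ↦ Ind(Mod(R|_U))`
is a stack. -/
lemma indModules_hom_ext [(indModules R).IsStack (Opens.grothendieckTopology X)] {T : Sieve S}
    (hT : T ∈ Opens.grothendieckTopology X S) {F G : (indModules R).obj ⟨op S⟩} {φ φ' : F ⟶ G}
    (h : ∀ (V : Opens X) (g : V ⟶ S), T g → ∀ P : Mod (ringOn R V),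
      φ.hom.app (op ((extZero R g).obj P)) = φ'.hom.app (op ((extZero R g).obj P))) :
    φ = φ' := by
  obtain ⟨h'⟩ := (isPrestackFor_iff _ _).1 ((indModules R).isPrestackFor' T hT)
  refine h'.map_injective (DescentData.hom_ext fun g ↦ ObjectProperty.hom_ext _
    (NatTrans.ext (funext fun P ↦ ?_)))
  exact h _ g.obj.hom g.property P.unop

variable (M : Mod (ringOn R S)) (W : ℕ →o Opens (sp S))

/-- The inductive system of the sheaves `M / M_{W_n}`. -/
def quotCut : ULift.{u} ℕ ⥤ Mod (ringOn R S) where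
  obj n := cokernel (cutι M (W n.down))
  map {n m} a := cokernel.desc _ (cokernel.π _) (by
    have e : cutι M (W n.down) = cutLE M (W.monotone (show n ≤ m from leOfHom a)) ≫ cutι M (W m.down) := rfl
    rw [e, Category.assoc, cokernel.condition, comp_zero])
  map_id _ := (cancel_epi (cokernel.π _)).1 (by simp)
  map_comp _ _ := (cancel_epi (cokernel.π _)).1 (by simp)

lemma π_comp_quotCut_map {n m : ULift.{u} ℕ} (a : n ⟶ m) :
    cokernel.π (cutι M (W n.down)) ≫ (quotCut M W).map a = cokernel.π (cutι M (W m.down)) :=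
  cokernel.π_desc _ _ _

instance : IsFiltered (ULift.{u} ℕ) := isFiltered_of_directed_le_nonempty _

/-- The ind-object `indlim M / M_{W_n}`. -/
def quotCutPresentation : IndObjectPresentation (indLim (quotCut M W)) :=
  .ofCocone _ (nonempty_isColimit_indLimCocone (quotCut M W)).some

/-- The image of `j_! P` consists of sections vanishing outside `V`, so `g` factors through `M_W`,
which the projection kills. -/
lemma extZero_comp_eq_zero {V : Opens X} (h : V ⟶ S) (P : Mod (ringOn R V)) {W : Opens (sp S)}
    (hW : sub h ≤ W) (g : (extZero R h).obj P ⟶ M) : g ≫ cokernel.π (cutι M W) = 0 := by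
  have key (Z : Opens (sp S)) (s : ((extZero R h).obj P).val.obj (op Z)) (x : sp S) (hx : x ∈ Z)
      (hxW : x ∉ W) : VanishesAt M (g.val.app (op Z) s) x := by
    obtain ⟨W', hW', hx', e⟩ := isExt_sec h P s x hx fun hh ↦ hxW (hW hh)
    have : VanishesAt ((extZero R h).obj P) s x := ⟨W', hW', hx', sec_injective h P e⟩
    exact this.map g
  have e : cutLift W g key ≫ cutι M W = g := rfl
  rw [← e, Category.assoc, cokernel.condition, comp_zero]

/-- The projection from `M` to `“lim” M / M_{W_n}` is locally zero, since each `V` of the covering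
lies in some `W_n`. It is not globally zero, so morphisms are not even separated. -/
lemma not_isStack_indModules (hW : ∀ n, ¬ Epi (cutι M (W n)))
    {T : Sieve S} (hT : T ∈ Opens.grothendieckTopology X S)
    (hTW : ∀ (V : Opens X) (g : V ⟶ S), T g → ∃ n, sub g ≤ W n) :
    ¬ (indModules R).IsStack (Opens.grothendieckTopology X) := by
  intro _
  let P := quotCutPresentation M W
  let F : (indModules R).obj ⟨op S⟩ := ⟨yoneda.obj M, isIndObject_yoneda M⟩
  let G : (indModules R).obj ⟨op S⟩ := ⟨indLim (quotCut M W), ⟨⟨P⟩⟩⟩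
  let φ (a : M ⟶ (quotCut M W).obj ⟨0⟩) : F ⟶ G :=
    ObjectProperty.homMk (yonedaEquiv.symm (indElem P (i := ⟨0⟩) a))
  have hφ (a : M ⟶ (quotCut M W).obj ⟨0⟩) {H : Mod (ringOn R S)} (g : H ⟶ M) :
      (φ a).hom.app (op H) g = indElem P (i := ⟨0⟩) (g ≫ a) := map_indElem P g a
  have e : φ (cokernel.π _) = φ 0 := by
    refine indModules_hom_ext hT fun V g hg Q ↦ ?_
    obtain ⟨n, hn⟩ := hTW V g hg
    ext x
    -- At stage `n`, with `V` contained in `W n`, the projection already vanishes on sheaves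
    -- extended by zero from `V`.
    let a : (⟨0⟩ : ULift.{u} ℕ) ⟶ ⟨n⟩ := homOfLE (Nat.zero_le n)
    refine (hφ _ x).trans (Eq.trans ?_ (hφ _ x).symm)
    refine (indElem_comp_map P (i := ⟨0⟩) _ a).symm.trans
      (Eq.trans ?_ (indElem_comp_map P (i := ⟨0⟩) _ a))
    refine congrArg (indElem P (i := ⟨n⟩)) ?_
    have key (y : (extZero R g).obj Q ⟶ M) :
        (y ≫ cokernel.π (cutι M (W 0))) ≫ (quotCut M W).map a = (y ≫ 0) ≫ (quotCut M W).map a := by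
      rw [comp_zero, zero_comp]
      exact (Category.assoc _ _ _).trans ((congrArg (y ≫ ·) (π_comp_quotCut_map M W a)).trans
        (extZero_comp_eq_zero M g Q hn y))
    exact key x
  -- Evaluated at the identity of `M`, equality of the two morphisms becomes equality of two
  -- elements, hence an equality at a finite stage: the projection to some `M / M_{W_n}` is zero.
  have e' : indElem P (i := ⟨0⟩) (cokernel.π (cutι M (W 0))) = indElem P (i := ⟨0⟩) 0 := by
    have h := (hφ (cokernel.π _) (𝟙 M)).symm.trans
      ((congrArg (fun ψ : F ⟶ G ↦ ψ.hom.app (op M) (𝟙 M)) e).trans (hφ _ (𝟙 M)))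
    exact (congrArg (indElem P (i := ⟨0⟩)) (Category.id_comp _)).symm.trans
      (h.trans (congrArg (indElem P (i := ⟨0⟩)) (Category.id_comp _)))
  obtain ⟨n, a, ha⟩ := exists_of_indElem_eq P e'
  refine hW n.down (Preadditive.epi_of_cokernel_zero ?_)
  exact (π_comp_quotCut_map M W a).symm.trans (ha.trans zero_comp)

end NotStack

/-! ### The counterexample on the real line. -/

section Real

variable (k : Type u) [Field k]

lemma supp_unit_constSheaf (X : TopCat.{u}) (S : Opens X) :
    supp (SheafOfModules.unit (ringOn (toRing (constSheaf k X)) S)) = Set.univ := by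
  refine Set.eq_univ_of_forall fun x ↦ ?_
  rintro hx
  obtain ⟨W, hW, hxW⟩ := Set.mem_iUnion₂.1 hx
  let W' : Opens X := S.isOpenEmbedding.functor.obj W
  have h : (0 : LocallyConstant W' k) = 1 := (hW W le_rfl).elim _ _
  exact zero_ne_one (DFunLike.congr_fun h ⟨x.1, x, hxW, rfl⟩)

/-- The interval `(-n, n)` of the real line. -/
def interval (n : ℕ) : Opens (TopCat.of (ULift.{u} ℝ)) :=
  ⟨{x | |x.down| < n}, isOpen_lt (continuous_abs.comp continuous_uliftDown) continuous_const⟩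

/-- An epimorphism would force the support of `k_X`, the whole line, into the closure of `(-n, n)`,
which misses `n + 1`. -/
lemma not_epi_cutι_interval (n : ℕ) : ¬ Epi (cutι
    (SheafOfModules.unit (ringOn (toRing (constSheaf k (TopCat.of (ULift.{u} ℝ)))) ⊤))
      (sub (homOfLE le_top : interval n ⟶ ⊤))) := by
  intro _
  have h := supp_subset_of_jointly_epi (J := Unit) (fun _ ↦ cutι
    (SheafOfModules.unit (ringOn (toRing (constSheaf k (TopCat.of (ULift.{u} ℝ)))) ⊤))
      (sub (homOfLE le_top : interval n ⟶ ⊤)))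
    (fun g g' e ↦ (cancel_epi _).1 (e ())) isClosed_closure
    fun _ ↦ (supp_cut_subset _ _).trans Set.inter_subset_left
  rw [supp_unit_constSheaf] at h
  have h' := h (Set.mem_univ (⟨⟨(n : ℝ) + 1⟩, trivial⟩ : (⊤ : Opens (TopCat.of (ULift.{u} ℝ)))))
  let C : Set (sp (⊤ : Opens (TopCat.of (ULift.{u} ℝ)))) := {x | |x.1.down| ≤ n}
  have hC : IsClosed C :=
    isClosed_le (continuous_abs.comp (continuous_uliftDown.comp continuous_subtype_val))
      continuous_const
  have hI : ((sub (homOfLE le_top : interval n ⟶ ⊤) : Opens _) : Set _) ⊆ C :=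
    fun x hx ↦ le_of_lt (show |x.1.down| < n from hx)
  have h₁ : |(n : ℝ) + 1| ≤ n := hC.closure_subset_iff.2 hI h'
  linarith [le_abs_self ((n : ℝ) + 1)]

lemma not_isStack_indModules_real :
    ¬ (indModules (toRing (constSheaf k (TopCat.of (ULift.{u} ℝ))))).IsStack
      (Opens.grothendieckTopology (TopCat.of (ULift.{u} ℝ))) := by
  -- The open sets contained in some interval `(-n, n)` cover the line, by the Archimedean property.
  let T : Sieve (⊤ : Opens (TopCat.of (ULift.{u} ℝ))) :=
    { arrows V g := ∃ n, V ≤ interval n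
      downward_closed := fun ⟨n, hn⟩ g ↦ ⟨n, (leOfHom g).trans hn⟩ }
  refine not_isStack_indModules (SheafOfModules.unit _)
    ⟨fun n ↦ sub (homOfLE le_top : interval n ⟶ ⊤), fun n m h x hx ↦ ?_⟩
    (not_epi_cutι_interval k) (T := T) (fun x _ ↦ ?_) (fun V g ⟨n, hn⟩ ↦ ⟨n, fun x hx ↦ hn hx⟩)
  · exact lt_of_lt_of_le (show |x.1.down| < n from hx) (Nat.cast_le.2 h)
  · obtain ⟨n, hn⟩ := exists_nat_gt |x.down|
    exact ⟨interval n, homOfLE le_top, ⟨n, le_rfl⟩, hn⟩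

end Real

end KSInd

end

theorem mainTheorem2 (k : Type u) [Field k] :
    (∀ (X : TopCat.{u}) [T2Space X] [LocallyCompactSpace X] [SigmaCompactSpace X]
        (A : Sheaf (Opens.grothendieckTopology X) (CommAlgCat.{u} k)),
      (∀ (U V : Opens X) (h : V ⟶ U) (F : (KSInd.indSheaves (KSInd.toRing A)).obj ⟨op U⟩)
          (I : Type u) [SmallCategory I] [IsFiltered I] (D : I ⥤ KSInd.Modc (KSInd.ringOn (KSInd.toRing A) U)),
        Nonempty (F.obj ≅ KSInd.indLim D) →
          Nonempty ((((KSInd.indSheaves (KSInd.toRing A)).map h.op.toLoc).toFunctor.obj F).obj ≅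
            KSInd.indLim (D.prod (𝟭 (KSInd.RelCompact V)) ⋙ KSInd.restrCut h))) ∧
      (∀ (U : Opens X) (F G : (KSInd.indSheaves (KSInd.toRing A)).obj ⟨op U⟩),
        Presheaf.IsSheaf ((Opens.grothendieckTopology X).over U)
          ((KSInd.indSheaves (KSInd.toRing A)).presheafHom F G)) ∧
      (KSInd.indSheaves (KSInd.toRing A)).IsStack (Opens.grothendieckTopology X)) ∧
    ¬ (KSInd.indModules (KSInd.toRing (KSInd.constSheaf k (TopCat.of (ULift.{u} ℝ))))).IsStack
        (Opens.grothendieckTopology (TopCat.of (ULift.{u} ℝ))) := by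
  refine ⟨fun X _ _ _ A ↦ ⟨fun U V h F I _ _ D ⟨e⟩ ↦ ?_, fun U F G ↦ ?_, ?_⟩, ?_⟩
  · exact KSInd.nonempty_resInd_iso h F D e
  · exact Pseudofunctor.IsPrestack.isSheaf _ F G
  · exact KSInd.isStack_indSheaves _
  · exact KSInd.not_isStack_indModules_real k
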